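/- Strings are finite binary strings, $[C]$ is the set of infinite paths through a tree $C\subseteq 2^{<\omega}$, and subsets of $\mathbb N$ are identified with points of Cantor space $2^\omega$. A system is a pair $(C,f)$ where $C$ is a tree with $[C]\neq\emptyset$, and $f:2^{<\omega}\to2^{<\omega}$ is order preserving, satisfies $(\forall l)(\exists m)(\forall\sigma\in\{0,1\}^m)\,|f(\sigma)|\ge l$ and $|f(\sigma)|<|\sigma|$ for $\sigma\ne\lambda$, and maps $C$ into $C$. It encodes the continuous map $F(X)=\lim_l f(X\upharpoonright l)$ on $2^\omega$. An almost periodic point of $(C,f)$ is an $X\in[C]$ with $$(\forall c)(\exists b)(\forall n)(\exists k<b)\; F^{n+k}(X)\succeq X\upharpoonright c .$$ $\mathsf{AP}$ is the sentence of second-order arithmetic saying that every system has an almost periodic point. A set is of PA degree if it computes a complete consistent extension of first-order Peano arithmetic. **Theorem.** $\mathsf{WKL}_0$ does not prove $\mathsf{AP}$. Moreover, there is a system $(C,f)$ with $C$ and $f$ computable which is a product of shift systems, that is, for a uniformly computable sequence of trees $T_0,T_1,\dots$, each forming a system with the left shift $\sigma\mapsto$ ($\sigma$ without its first digit), $[C]$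 consists of the $X$ all of whose columns $X^{[e]}$ lie in $[T_e]$, and $F$ shifts every column; and there is a set $X$ of PA degree such that 1. $X$ computes no almost periodic point of $(C,f)$; 2. there is an $\omega$-model of $\mathsf{WKL}_0$, all of whose sets are computable from $X$, which contains no almost periodic point of $(C,f)$ and in which $\mathsf{AP}$ is false. -/

import Mathlib

/-! ## Cantor space, trees and systems

Points of Cantor space are subsets of `ℕ`, identified with their characteristic functions.
Finite binary strings are elements of `List Bool`. -/

namespace CantorDyn

open Classical in
/-- The initial segment of length `l` of the point `X`. -/
noncomputable def res (X : Set ℕ) (l : ℕ) : List Bool :=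
  (List.range l).map fun i => decide (i ∈ X)

/-- The set `[C]` of infinite paths through `C`. -/
def paths (C : Set (List Bool)) : Set (Set ℕ) :=
  {X | ∀ l, res X l ∈ C}

/-- The transformation `F` of Cantor space encoded by `f`, i.e. `F X = lim_l f (X ↾ l)`. -/
def transform (f : List Bool → List Bool) (X : Set ℕ) : Set ℕ :=
  {i | ∃ l, (f (res X l))[i]? = some true}

/-- `f` encodes a continuous transformation of Cantor space (and shortens nonempty strings). -/
structure EncodesTransformation (f : List Bool → List Bool) : Prop where
  mono : ∀ σ τ : List Bool, σ <+: τ → f σ <+: f τ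
  unbounded : ∀ l : ℕ, ∃ m : ℕ, ∀ σ : List Bool, σ.length = m → l ≤ (f σ).length
  shrink : ∀ σ : List Bool, σ ≠ [] → (f σ).length < σ.length

/-- `(C, f)` encodes a topological dynamical system on Cantor space. -/
structure IsSystem (C : Set (List Bool)) (f : List Bool → List Bool) : Prop where
  tree : ∀ σ τ : List Bool, σ <+: τ → τ ∈ C → σ ∈ C
  encodes : EncodesTransformation f
  nonempty : (paths C).Nonempty
  closed : ∀ σ ∈ C, f σ ∈ C

/-- `(C, f)` is a system, and both the tree and the string function are computable. -/
def IsComputableSystem (C : Set (List Bool)) (f : List Bool → List Bool) : Prop :=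
  IsSystem C f ∧ ComputablePred (fun σ : List Bool => σ ∈ C) ∧ Computable f

/-- `X` is an almost periodic point of the system `(C, f)`. -/
def IsAlmostPeriodic (C : Set (List Bool)) (f : List Bool → List Bool) (X : Set ℕ) : Prop :=
  X ∈ paths C ∧
    ∀ c : ℕ, ∃ b : ℕ, ∀ n : ℕ, ∃ k < b, res ((transform f)^[n + k] X) c = res X c

/-- The `e`-th column of `X`. -/
def column (e : ℕ) (X : Set ℕ) : Set ℕ :=
  {m | Nat.pair e m ∈ X}

/-- `(C, f)` is the product of a uniformly computable sequence of subsystems `(T e, shift)` of the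
left shift on Cantor space (the left shift is encoded by `List.tail`): the points of `[C]` are those
whose `e`-th column lies in `[T e]` for all `e`, and the transformation shifts every column. -/
def IsProductShift (C : Set (List Bool)) (f : List Bool → List Bool) : Prop :=
  ∃ T : ℕ → Set (List Bool),
    ComputablePred (fun p : ℕ × List Bool => p.2 ∈ T p.1) ∧
    (∀ e, IsSystem (T e) List.tail) ∧
    (∀ X, X ∈ paths C ↔ ∀ e, column e X ∈ paths (T e)) ∧
    (∀ X e m, m ∈ column e (transform f X) ↔ m + 1 ∈ column e X)

open Classical in
/-- The characteristic function of a set of natural numbers, as an oracle. -/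
noncomputable def chr (A : Set ℕ) : ℕ →. ℕ :=
  fun n => Part.some (if n ∈ A then 1 else 0)

/-- `B` computes `A`: Turing reducibility between sets of natural numbers. -/
def Computes (B A : Set ℕ) : Prop :=
  TuringReducible (chr A) (chr B)

end CantorDyn

/-! ## Second-order arithmetic

Two-sorted first-order logic with de Bruijn indices, number variables and set variables being
indexed separately. The primitive symbols are `0, 1, +, ·, =, <, ∈, ⊥, →` and the two universal
quantifiers. Equality is primitive for numbers only. -/

namespace SOA

/-- The sequence `a, e 0, e 1, e 2, …`. -/
def push {α : Type} (a : α) (e : ℕ → α) : ℕ → α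
  | 0 => a
  | i + 1 => e i

/-- Numerical terms. -/
inductive Term : Type
  | var : ℕ → Term
  | zero : Term
  | one : Term
  | add : Term → Term → Term
  | mul : Term → Term → Term

instance : Zero Term := ⟨Term.zero⟩
instance : One Term := ⟨Term.one⟩
instance : Add Term := ⟨Term.add⟩
instance : Mul Term := ⟨Term.mul⟩

/-- Formulas of the language of second-order arithmetic; `allN` binds number variable `0` and
`allS` binds set variable `0`. -/
inductive Form : Type
  | eq : Term → Term → Form
  | lt : Term → Term → Form
  | mem : Term → ℕ → Form
  | bot : Form
  | imp : Form → Form → Form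
  | allN : Form → Form
  | allS : Form → Form

infix:60 " ≐ " => Form.eq
infix:60 " <ₙ " => Form.lt
infix:60 " ∈ₛ " => Form.mem
infixr:40 " ⇾ " => Form.imp

namespace Form

def neg (φ : Form) : Form := φ ⇾ bot
def and (φ ψ : Form) : Form := neg (φ ⇾ neg ψ)
def or (φ ψ : Form) : Form := neg φ ⇾ ψ
def iff (φ ψ : Form) : Form := and (φ ⇾ ψ) (ψ ⇾ φ)
def exN (φ : Form) : Form := neg (allN (neg φ))
def exS (φ : Form) : Form := neg (allS (neg φ))

end Form

infixr:50 " ⩓ " => Form.and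
infixr:45 " ⩔ " => Form.or
infix:42 " ⇿ " => Form.iff

/-! ### Substitution -/

/-- Simultaneous substitution of terms for number variables. -/
def Term.subst (σ : ℕ → Term) : Term → Term
  | var i => σ i
  | zero => zero
  | one => one
  | add s t => add (s.subst σ) (t.subst σ)
  | mul s t => mul (s.subst σ) (t.subst σ)

/-- Renames all number variables `i` to `i + 1`. -/
def Term.up (t : Term) : Term := t.subst fun i => Term.var (i + 1)

/-- The substitution `σ` moved below a number quantifier. -/
def liftN (σ : ℕ → Term) : ℕ → Term
  | 0 => Term.var 0
  | i + 1 => (σ i).up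

/-- The renaming `ρ` moved below a set quantifier. -/
def liftS (ρ : ℕ → ℕ) : ℕ → ℕ
  | 0 => 0
  | i + 1 => ρ i + 1

/-- Simultaneous capture-avoiding substitution of terms for the free number variables and of
set variables for the free set variables. -/
def Form.subst : (ℕ → Term) → (ℕ → ℕ) → Form → Form
  | σ, _, eq s t => eq (s.subst σ) (t.subst σ)
  | σ, _, lt s t => lt (s.subst σ) (t.subst σ)
  | σ, ρ, mem t i => mem (t.subst σ) (ρ i)
  | _, _, bot => bot
  | σ, ρ, imp φ ψ => imp (φ.subst σ ρ) (ψ.subst σ ρ)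
  | σ, ρ, allN φ => allN (φ.subst (liftN σ) ρ)
  | σ, ρ, allS φ => allS (φ.subst σ (liftS ρ))

/-- Renames the free number variables `i` to `i + 1`. -/
def Form.upN (φ : Form) : Form := φ.subst (fun i => Term.var (i + 1)) id

/-- Renames the free set variables `i` to `i + 1`. -/
def Form.upS (φ : Form) : Form := φ.subst Term.var (fun i => i + 1)

/-- Instantiates number variable `0` by `t` and lowers the other number variables. -/
def Form.instN (t : Term) (φ : Form) : Form :=
  φ.subst (push t Term.var) id

/-- Instantiates set variable `0` by `j` and lowers the other set variables. -/
def Form.instS (j : ℕ) (φ : Form) : Form :=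
  φ.subst Term.var (push j id)

/-- Replaces number variable `0` by its successor, leaving the other variables unchanged. -/
def Form.succ (φ : Form) : Form :=
  φ.subst (push (Term.var 0 + 1) fun i => Term.var (i + 1)) id

/-! ### Provability -/

/-- Classical natural deduction: `Derives T Γ φ` says that `φ` is derivable from the axioms `T` and
the assumptions `Γ`. An axiom with free variables stands for its universal closure. -/
inductive Derives (T : Set Form) : List Form → Form → Prop
  | ax {Γ φ} : φ ∈ T → Derives T Γ φ
  | hyp {Γ φ} : φ ∈ Γ → Derives T Γ φ
  | impI {Γ φ ψ} : Derives T (φ :: Γ) ψ → Derives T Γ (φ ⇾ ψ)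
  | impE {Γ φ ψ} : Derives T Γ (φ ⇾ ψ) → Derives T Γ φ → Derives T Γ ψ
  | raa {Γ φ} : Derives T (φ.neg :: Γ) Form.bot → Derives T Γ φ
  | allNI {Γ φ} : Derives T (Γ.map Form.upN) φ → Derives T Γ (Form.allN φ)
  | allNE {Γ} {φ : Form} (t : Term) : Derives T Γ (Form.allN φ) → Derives T Γ (φ.instN t)
  | allSI {Γ φ} : Derives T (Γ.map Form.upS) φ → Derives T Γ (Form.allS φ)
  | allSE {Γ} {φ : Form} (j : ℕ) : Derives T Γ (Form.allS φ) → Derives T Γ (φ.instS j)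
  | eqI {Γ} (t : Term) : Derives T Γ (t ≐ t)
  | eqE {Γ} {φ : Form} {s t : Term} :
      Derives T Γ (s ≐ t) → Derives T Γ (Form.instN s φ) → Derives T Γ (Form.instN t φ)

/-- The theory `T` proves `φ`. -/
def Proves (T : Set Form) (φ : Form) : Prop := Derives T [] φ

/-! ### The axioms of the base theory -/

local notation "x₀" => Term.var 0
local notation "x₁" => Term.var 1
local notation "x₂" => Term.var 2
local notation "x₃" => Term.var 3

/-- The basic axioms of arithmetic. -/
def basicAxioms : Set Form :=
  { Form.neg (x₀ + 1 ≐ 0),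
    (x₀ + 1 ≐ x₁ + 1) ⇾ (x₀ ≐ x₁),
    x₀ + 0 ≐ x₀,
    x₀ + (x₁ + 1) ≐ (x₀ + x₁) + 1,
    x₀ * 0 ≐ 0,
    x₀ * (x₁ + 1) ≐ x₀ * x₁ + x₀,
    Form.neg (x₀ <ₙ 0),
    (x₀ <ₙ x₁ + 1) ⇿ ((x₀ <ₙ x₁) ⩔ (x₀ ≐ x₁)) }

/-- Bounded-quantifier formulas (with number and set parameters). -/
inductive Form.IsBounded : Form → Prop
  | eq (s t : Term) : IsBounded (s ≐ t)
  | lt (s t : Term) : IsBounded (s <ₙ t)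
  | mem (t : Term) (i : ℕ) : IsBounded (t ∈ₛ i)
  | bot : IsBounded Form.bot
  | imp {φ ψ} : IsBounded φ → IsBounded ψ → IsBounded (φ ⇾ ψ)
  | ball {φ} (t : Term) : IsBounded φ → IsBounded (Form.allN ((x₀ <ₙ t.up) ⇾ φ))

/-- `Σ⁰₁` formulas. -/
def Form.IsSigma (φ : Form) : Prop := ∃ θ : Form, θ.IsBounded ∧ φ = Form.exN θ

/-- `Π⁰₁` formulas. -/
def Form.IsPi (φ : Form) : Prop := ∃ θ : Form, θ.IsBounded ∧ φ = Form.allN θ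

/-- The induction axiom for `φ`, the induction variable being number variable `0`. -/
def induction (φ : Form) : Form :=
  (φ.instN 0 ⩓ Form.allN (φ ⇾ φ.succ)) ⇾ Form.allN φ

/-- `∀ n (φ(n) ↔ ψ(n)) → ∃ X ∀ n (n ∈ X ↔ φ(n))`, with `X` not free in `φ`. -/
def comprehension (φ ψ : Form) : Form :=
  Form.allN (φ ⇿ ψ) ⇾ Form.exS (Form.allN ((x₀ ∈ₛ 0) ⇿ φ.upS))

/-- The axiom system `RCA₀`: basic axioms, `Σ⁰₁` induction and `Δ⁰₁` comprehension. -/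
def RCA0 : Set Form :=
  basicAxioms ∪ {χ | ∃ φ : Form, φ.IsSigma ∧ χ = induction φ} ∪
    {χ | ∃ φ ψ : Form, φ.IsSigma ∧ ψ.IsPi ∧ χ = comprehension φ ψ}

/-! ### Binary strings inside second-order arithmetic

The arguments `s t i …` of the following formulas are terms, and `X Y C f` are indices of set
variables. Below each number quantifier the terms coming from outside are shifted by `up`, below
each set quantifier the set indices are increased by one. -/

/-- The pairing function `(a, b) = (a + b)² + a`. -/
def pr (a b : Term) : Term := (a + b) * (a + b) + a

/-- `a` divides `b`. -/
def dvd (a b : Term) : Form := Form.exN (x₀ * a.up ≐ b.up)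

/-- Bit `i` of the sequence described by the parameters `m, n` is `1`. -/
def bit (m n i : Term) : Form := dvd (m * (i + 1) + 1) n

/-- `s` codes a finite binary string, that is, `s` is the least number of the form `(l, (m, n))`
such that for all `i < l` the `i`-th digit of the string is `1` iff `m (i + 1) + 1` divides `n`. -/
def isStr (s : Term) : Form :=
  Form.exN <| Form.exN <| Form.exN <|
    -- the string is `s = (l, (m, n))` with `l, m, n` the variables `x₂, x₁, x₀`
    (s.up.up.up ≐ pr x₂ (pr x₁ x₀)) ⩓
    Form.allN (Form.allN (
      -- now `m', n'` are `x₁, x₀`, and `l, m, n` are `var 4, x₃, x₂`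
      (pr (Term.var 4) (pr x₁ x₀) <ₙ s.up.up.up.up.up) ⇾
        Form.exN ((x₀ <ₙ Term.var 5) ⩓
          Form.neg (bit x₂ x₁ x₀ ⇿ bit (Term.var 4) x₃ x₀))))

/-- The string coded by `s` has length `l`. -/
def len (s l : Term) : Form :=
  Form.exN (Form.exN (s.up.up ≐ pr l.up.up (pr x₁ x₀)))

/-- `i` is less than the length of the string coded by `s`, and its `i`-th digit is `1`. -/
def digitOne (s i : Term) : Form :=
  Form.exN <| Form.exN <| Form.exN <|
    (s.up.up.up ≐ pr x₂ (pr x₁ x₀)) ⩓ (i.up.up.up <ₙ x₂) ⩓ bit x₁ x₀ i.up.up.up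

/-- The string coded by `s` is an initial segment of the string coded by `t`. -/
def isPrefix (s t : Term) : Form :=
  Form.exN <| Form.exN <|
    len s.up.up x₁ ⩓ len t.up.up x₀ ⩓ (x₁ <ₙ x₀ + 1) ⩓
    Form.allN ((x₀ <ₙ x₂) ⇾ (digitOne s.up.up.up x₀ ⇿ digitOne t.up.up.up x₀))

/-- The string coded by `s` is an initial segment of the set `X`. -/
def isInit (s : Term) (X : ℕ) : Form :=
  Form.exN <| len s.up x₀ ⩓
    Form.allN ((x₀ <ₙ x₁) ⇾ (digitOne s.up.up x₀ ⇿ (x₀ ∈ₛ X)))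

/-- The string coded by `s` is an initial segment of the set `{i | (k, i) ∈ Y}`. -/
def isInitCol (s k : Term) (Y : ℕ) : Form :=
  Form.exN <| len s.up x₀ ⩓
    Form.allN ((x₀ <ₙ x₁) ⇾ (digitOne s.up.up x₀ ⇿ (pr k.up.up x₀ ∈ₛ Y)))

/-- `C` is a tree of binary strings. -/
def isTree (C : ℕ) : Form :=
  Form.allN <| (x₀ ∈ₛ C) ⇾
    (isStr x₀ ⩓ Form.allN ((isStr x₀ ⩓ isPrefix x₀ x₁) ⇾ (x₀ ∈ₛ C)))

/-- `X` is an infinite path through `C`. -/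
def isPath (X C : ℕ) : Form :=
  Form.allN <| (isStr x₀ ⩓ isInit x₀ X) ⇾ (x₀ ∈ₛ C)

/-- Weak König's lemma: every infinite binary tree has an infinite path. -/
def WKL : Form :=
  Form.allS <| (isTree 0 ⩓ Form.allN (Form.exN ((x₁ <ₙ x₀) ⩓ (x₀ ∈ₛ 0)))) ⇾
    Form.exS (isPath 0 1)

/-- The axiom system `WKL₀`. -/
def WKL0 : Set Form := RCA0 ∪ {WKL}

/-! ### The principle `AP` -/

/-- `f` is (the graph of) a total function from binary strings to binary strings. -/
def isStrFun (f : ℕ) : Form :=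
  Form.allN (Form.allN ((pr x₁ x₀ ∈ₛ f) ⇾ (isStr x₁ ⩓ isStr x₀))) ⩓
  Form.allN (isStr x₀ ⇾ Form.exN ((pr x₁ x₀ ∈ₛ f) ⩓
    Form.allN ((pr x₂ x₀ ∈ₛ f) ⇾ (x₀ ≐ x₁))))

/-- `f` encodes a continuous transformation: it is a total function on strings, is order
preserving, has unbounded output length, and shortens nonempty strings. -/
def encodesTransformation (f : ℕ) : Form :=
  isStrFun f ⩓
  -- strings `s, t, s', t'` are `x₃, x₂, x₁, x₀`
  Form.allN (Form.allN (Form.allN (Form.allN (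
    ((pr x₃ x₂ ∈ₛ f) ⩓ (pr x₁ x₀ ∈ₛ f) ⩓ isPrefix x₃ x₁) ⇾ isPrefix x₂ x₀)))) ⩓
  -- `l, m, s, t` are `x₃, x₂, x₁, x₀`, and then `|t|` is a new `x₀`
  Form.allN (Form.exN (Form.allN (Form.allN (
    ((pr x₁ x₀ ∈ₛ f) ⩓ len x₁ x₂) ⇾
      Form.exN (len x₁ x₀ ⩓ (Term.var 4 <ₙ x₀ + 1)))))) ⩓
  -- `s, t, |s|, |t|` are `x₃, x₂, x₁, x₀`
  Form.allN (Form.allN (Form.allN (Form.allN (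
    ((pr x₃ x₂ ∈ₛ f) ⩓ len x₃ x₁ ⩓ len x₂ x₀ ⩓ (0 <ₙ x₁)) ⇾ (x₀ <ₙ x₁)))))

/-- `(C, f)` encodes a topological dynamical system on Cantor space. -/
def isSystem (C f : ℕ) : Form :=
  isTree C ⩓ encodesTransformation f ⩓ Form.exS (isPath 0 (C + 1)) ⩓
  Form.allN (Form.allN (((pr x₁ x₀ ∈ₛ f) ⩓ (x₁ ∈ₛ C)) ⇾ (x₀ ∈ₛ C)))

/-- `Y` codes the orbit of `X`: column `0` of `Y` is `X`, and column `k + 1` is the image of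
column `k` under the transformation encoded by `f`. -/
def isOrbit (Y X f : ℕ) : Form :=
  Form.allN ((pr 0 x₀ ∈ₛ Y) ⇿ (x₀ ∈ₛ X)) ⩓
  -- `k, s, t` are `x₂, x₁, x₀`
  Form.allN (Form.allN (Form.allN (
    ((pr x₁ x₀ ∈ₛ f) ⩓ isInitCol x₁ x₂ Y) ⇾ isInitCol x₀ (x₂ + 1) Y)))

/-- `X` is an almost periodic point of `(C, f)`: it is a path through `C`, and its orbit `Y`
satisfies `∀ c ∃ b ∀ n ∃ k < b ∀ i < c ((n + k, i) ∈ Y ↔ i ∈ X)`. -/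
def isAlmostPeriodic (X C f : ℕ) : Form :=
  isPath X C ⩓
  Form.exS (isOrbit 0 (X + 1) (f + 1) ⩓
    -- `c, b, n, k, i` are `var 4, x₃, x₂, x₁, x₀`
    Form.allN (Form.exN (Form.allN (Form.exN ((x₀ <ₙ x₂) ⩓
      Form.allN ((x₀ <ₙ Term.var 4) ⇾ ((pr (x₂ + x₁) x₀ ∈ₛ 0) ⇿ (x₀ ∈ₛ X + 1))))))))

/-- The principle `AP`: every system on Cantor space contains an almost periodic point. -/
def AP : Form :=
  Form.allS <| Form.allS <| isSystem 1 0 ⇾ Form.exS (isAlmostPeriodic 0 2 1)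

/-! ### `ω`-models -/

/-- The value of a term in the standard natural numbers. -/
def Term.val (e : ℕ → ℕ) : Term → ℕ
  | var i => e i
  | zero => 0
  | one => 1
  | add s t => s.val e + t.val e
  | mul s t => s.val e * t.val e

/-- Satisfaction in the `ω`-structure whose number part is `ℕ` and whose sets are the members
of `S`. -/
def Sat (S : Set (Set ℕ)) : (ℕ → ℕ) → (ℕ → Set ℕ) → Form → Prop
  | e, _, Form.eq s t => s.val e = t.val e
  | e, _, Form.lt s t => s.val e < t.val e
  | e, E, Form.mem t i => t.val e ∈ E i
  | _, _, Form.bot => False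
  | e, E, Form.imp φ ψ => Sat S e E φ → Sat S e E ψ
  | e, E, Form.allN φ => ∀ n : ℕ, Sat S (push n e) E φ
  | e, E, Form.allS φ => ∀ A ∈ S, Sat S e (push A E) φ

/-- The formula `φ` (its universal closure, if it has free variables) is true in the
`ω`-structure with sets `S`. -/
def TrueIn (S : Set (Set ℕ)) (φ : Form) : Prop :=
  ∀ (e : ℕ → ℕ) (E : ℕ → Set ℕ), (∀ i, E i ∈ S) → Sat S e E φ

/-- `S` is (the second-order part of) an `ω`-model of the theory `T`. -/
def IsOmegaModel (S : Set (Set ℕ)) (T : Set Form) : Prop :=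
  S.Nonempty ∧ ∀ φ ∈ T, TrueIn S φ

/-! ### Peano arithmetic and PA degrees -/

/-- All variables of the term are less than `n`. -/
def Term.VarsLT (n : ℕ) : Term → Prop
  | var i => i < n
  | zero => True
  | one => True
  | add s t => s.VarsLT n ∧ t.VarsLT n
  | mul s t => s.VarsLT n ∧ t.VarsLT n

/-- The formula belongs to the language of first-order arithmetic (no set variables, free or
bound), and its free number variables are less than `n`. -/
def Form.IsFirstOrder : ℕ → Form → Prop
  | n, eq s t => s.VarsLT n ∧ t.VarsLT n
  | n, lt s t => s.VarsLT n ∧ t.VarsLT n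
  | _, mem _ _ => False
  | _, bot => True
  | n, imp φ ψ => φ.IsFirstOrder n ∧ ψ.IsFirstOrder n
  | n, allN φ => φ.IsFirstOrder (n + 1)
  | _, allS _ => False

/-- First-order Peano arithmetic. -/
def PA : Set Form :=
  basicAxioms ∪ {χ | ∃ φ : Form, (∃ n, φ.IsFirstOrder n) ∧ χ = induction φ}

/-- `T` is a complete (consistent) extension of Peano arithmetic: a set of sentences of first-order
arithmetic that is consistent with `PA` and decides every such sentence. (Thus `T` contains every
sentence that is provable from `PA` together with `T`.) -/
structure IsCompleteExtensionPA (T : Set Form) : Prop where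
  sentences : ∀ φ ∈ T, φ.IsFirstOrder 0
  complete : ∀ φ : Form, φ.IsFirstOrder 0 → φ ∈ T ∨ φ.neg ∈ T
  consistent : ¬ Proves (PA ∪ T) Form.bot

/-- Gödel numbers of terms. -/
def Term.code : Term → ℕ
  | var i => Nat.pair 0 i
  | zero => Nat.pair 1 0
  | one => Nat.pair 2 0
  | add s t => Nat.pair 3 (Nat.pair s.code t.code)
  | mul s t => Nat.pair 4 (Nat.pair s.code t.code)

/-- Gödel numbers of formulas. -/
def Form.code : Form → ℕ
  | eq s t => Nat.pair 0 (Nat.pair s.code t.code)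
  | lt s t => Nat.pair 1 (Nat.pair s.code t.code)
  | mem t i => Nat.pair 2 (Nat.pair t.code i)
  | bot => Nat.pair 3 0
  | imp φ ψ => Nat.pair 4 (Nat.pair φ.code ψ.code)
  | allN φ => Nat.pair 5 φ.code
  | allS φ => Nat.pair 6 φ.code

/-- The set `X` is of PA degree: it computes (the set of Gödel numbers of) a complete extension of
Peano arithmetic. (The degrees containing a complete extension of `PA` are upward closed, so these
are the sets whose Turing degree contains one.) -/
def IsPADegree (X : Set ℕ) : Prop :=
  ∃ T : Set Form, IsCompleteExtensionPA T ∧ CantorDyn.Computes X (Form.code '' T)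

end SOA

/-! ## Initial segments, compactness, and `Σ⁰₁` predicates on Cantor space -/

namespace CantorDyn

/-! The core is a diagonalization of computable systems against pairs: a functional with index `c`
and a `Π⁰₁` class of oracles, the complement of the `Σ⁰₁` class with index `u`. Column `e = Nat.pair
c u` of the product carries a subshift built against this pair. It watches events: event `j` happens
when every oracle is seen either to leave the class or to make the functional output a column `e`
that does not start with `1 ^ j 0`. By compactness such a statement, if true, is recognized at a
finite stage, so the subshift can react to it computably (`exists_event`).

By `evTree_dichotomy` there are two cases. Either some event `j` never happens and no almost
periodic point of the subshift starts with `1 ^ j 0`; then the oracles without a conflict at `j`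
form a nonempty `Π⁰₁` subclass, on which a total output must start with `1 ^ j 0` and so is useless.
Or every point of the subshift starts with `1 ^ j 0` for some event `j` that has happened; then no
oracle in the class computes a point of it through `c`. So `forcing_step` defeats one functional by
shrinking the class, and iterating it gives, inside any nonempty `Π⁰₁` class, an oracle that
computes no almost periodic point (`exists_not_computes`).

The subshift keeps a word `V` at level `m`: it starts with `0`, ends in `1 ^ (m - 1)`, and its
powers avoid `1 ^ m`. Its windows are pieces of `V`-periodic sequences interrupted by at most one
block of ones. When event `m` happens, `V` is replaced by a long power of `V` followed by `1`, and
the level rises. When event `0` happens, `V` is frozen and interruptions are forbidden. If it is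
frozen, every point starts with `1 ^ j 0` for some `j < m` whose event has happened. If it is stuck
at level `m` without event `0`, the only point starting with `1 ^ m 0` is `1 ^ m V V V …`, in which
`1 ^ m` does not recur. If the level grows forever, a point starting with `0` contains arbitrarily
long blocks of ones, so that its first digit does not recur with bounded gaps.

The class to force in consists of sets whose columns solve all `Π⁰₁` problems about earlier columns
(`IsScott`). It is itself `Π⁰₁` and nonempty. The columns of a member form an `ω`-model of `WKL₀`
(`isOmegaModel_columns`). One of them codes a model of `PA` with its satisfaction relation, so the
member has PA degree (`isPADegree_of_isScott`). All columns are computable from the member, so none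
is almost periodic, while the primitive recursive system has a code in the model; hence `AP` is
false there (`not_trueIn_AP`), and soundness gives unprovability. -/

@[simp] theorem res_length (X : Set ℕ) (l : ℕ) : (res X l).length = l := by simp [res]

open Classical in
theorem res_getElem? (X : Set ℕ) (l i : ℕ) :
    (res X l)[i]? = if i < l then some (decide (i ∈ X)) else none := by
  simp only [res, List.getElem?_map]
  split_ifs with h
  · simp [List.getElem?_range h]
  · simp [h]

open Classical in
theorem res_getElem?_of_lt {X : Set ℕ} {l i : ℕ} (h : i < l) :
    (res X l)[i]? = some (decide (i ∈ X)) := by rw [res_getElem?, if_pos h]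

open Classical in
theorem res_getD {X : Set ℕ} {l i : ℕ} (h : i < l) :
    (res X l).getD i false = decide (i ∈ X) := by
  rw [List.getD_eq_getElem?_getD, res_getElem?, if_pos h]; rfl

theorem res_take (X : Set ℕ) (l k : ℕ) : (res X l).take k = res X (min k l) := by
  simp [res, ← List.map_take, List.take_range]

theorem res_take_of_le {X : Set ℕ} {l k : ℕ} (h : k ≤ l) : (res X l).take k = res X k := by
  rw [res_take, min_eq_left h]

theorem res_prefix {X : Set ℕ} {k l : ℕ} (h : k ≤ l) : res X k <+: res X l := by
  rw [← res_take_of_le h]; exact List.take_prefix _ _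

open Classical in
theorem res_succ (X : Set ℕ) (l : ℕ) : res X (l + 1) = res X l ++ [decide (l ∈ X)] := by
  simp [res, List.range_succ]

theorem res_eq_iff {X Y : Set ℕ} {l : ℕ} : res X l = res Y l ↔ ∀ i < l, (i ∈ X ↔ i ∈ Y) := by
  constructor
  · intro h i hi
    have := congrArg (fun L => L[i]?) h
    simp only [res_getElem?, if_pos hi, Option.some.injEq, decide_eq_decide] at this
    exact this
  · intro h
    simp only [res]
    apply List.map_congr_left
    intro i hi
    simp [h i (List.mem_range.1 hi)]

theorem eq_res_of_prefix {X : Set ℕ} {l : ℕ} {σ : List Bool} (h : σ <+: res X l) :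
    σ = res X σ.length := by
  have h1 := List.prefix_iff_eq_take.1 h
  have h2 := h.length_le
  rw [res_length] at h2
  rwa [res_take_of_le h2] at h1

/-- The set of positions at which the string `σ` has the digit `1`. -/
def ofStr (σ : List Bool) : Set ℕ := {i | σ[i]? = some true}

theorem res_ofStr (σ : List Bool) : res (ofStr σ) σ.length = σ := by
  apply List.ext_getElem?
  intro i
  rw [res_getElem?]
  split_ifs with h
  · simp [ofStr, List.getElem?_eq_getElem h]
  · simp at h; simp [h]

theorem res_eq_iff_str {X : Set ℕ} {σ : List Bool} :
    res X σ.length = σ ↔ ∀ i < σ.length, (i ∈ X ↔ σ[i]? = some true) := by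
  conv_lhs => rhs; rw [← res_ofStr σ]
  exact res_eq_iff

/-- Compactness of Cantor space. -/
theorem exists_path_of_infinite (D : Set (List Bool)) (hD : ∀ σ τ, σ <+: τ → τ ∈ D → σ ∈ D)
    (hinf : ∀ l, ∃ σ ∈ D, σ.length = l) : (paths D).Nonempty := by
  let big : List Bool → Prop := fun σ => ∀ l, ∃ τ ∈ D, σ <+: τ ∧ l ≤ τ.length
  have hstep : ∀ σ, big σ → ∃ b, big (σ ++ [b]) := by
    intro σ hσ
    by_contra hcon
    push Not at hcon
    have h0 := hcon true
    have h1 := hcon false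
    simp only [big] at h0 h1
    push Not at h0 h1
    obtain ⟨l0, h0⟩ := h0
    obtain ⟨l1, h1⟩ := h1
    -- The bound `σ.length + 1` makes `τ` a proper extension; its next digit then contradicts one of
    -- the two bounds.
    obtain ⟨τ, hτ, hp, hl⟩ := hσ (max (max l0 l1) (σ.length + 1))
    obtain ⟨ρ, rfl⟩ := hp
    cases ρ with
    | nil => simp at hl
    | cons b ρ =>
      have hpre : σ ++ [b] <+: σ ++ b :: ρ := ⟨ρ, by simp⟩
      cases b with
      | true =>
        have := h0 _ hτ hpre
        omega
      | false =>
        have := h1 _ hτ hpre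
        omega
  have h0 : big [] := fun l => by
    obtain ⟨σ, h, hl⟩ := hinf l
    exact ⟨σ, h, List.nil_prefix, hl.ge⟩
  choose! nxt hnxt using hstep
  let s : ℕ → List Bool := fun n => Nat.rec [] (fun _ σ => σ ++ [nxt σ]) n
  have hs : ∀ n, big (s n) := by
    intro n
    induction n with
    | zero => exact h0
    | succ n ih => exact hnxt _ ih
  have hlen : ∀ n, (s n).length = n := by
    intro n
    induction n with
    | zero => rfl
    | succ n ih => show (s n ++ [nxt (s n)]).length = n + 1; simp [ih]
  refine ⟨{i | nxt (s i) = true}, fun l => ?_⟩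
  have : res {i | nxt (s i) = true} l = s l := by
    induction l with
    | zero => simp [res, s]
    | succ n ih =>
      rw [res_succ, ih]
      show _ = s n ++ [nxt (s n)]
      simp
  rw [this]
  obtain ⟨τ, hτ, hp, -⟩ := hs l 0
  exact hD _ _ hp hτ

end CantorDyn

/-! ### Closure properties of primitive recursive predicates and functions -/

section PrimrecLemmas

variable {α β γ : Type*} [Primcodable α] [Primcodable β] [Primcodable γ]

theorem PrimrecPred.bex {p : α → ℕ → Prop} {g : α → ℕ}
    (hp : PrimrecPred fun x : α × ℕ => p x.1 x.2) (hg : Primrec g) :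
    PrimrecPred fun a => ∃ i < g a, p a i := by
  have hR : PrimrecRel fun (i : ℕ) (a : α) => p a i :=
    PrimrecPred.primrecRel (p := fun x : ℕ × α => p x.2 x.1)
      (hp.comp (f := fun x : ℕ × α => (x.2, x.1)) (Primrec.pair Primrec.snd Primrec.fst))
  exact (hR.exists_mem_list.comp (Primrec.list_range.comp hg) Primrec.id).of_eq (by simp)

theorem PrimrecPred.ball {p : α → ℕ → Prop} {g : α → ℕ}
    (hp : PrimrecPred fun x : α × ℕ => p x.1 x.2) (hg : Primrec g) :
    PrimrecPred fun a => ∀ i < g a, p a i := by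
  have hR : PrimrecRel fun (i : ℕ) (a : α) => p a i :=
    PrimrecPred.primrecRel (p := fun x : ℕ × α => p x.2 x.1)
      (hp.comp (f := fun x : ℕ × α => (x.2, x.1)) (Primrec.pair Primrec.snd Primrec.fst))
  exact (hR.forall_mem_list.comp (Primrec.list_range.comp hg) Primrec.id).of_eq (by simp)

theorem PrimrecPred.bexList {p : α → β → Prop} {g : α → List β}
    (hp : PrimrecPred fun x : α × β => p x.1 x.2) (hg : Primrec g) :
    PrimrecPred fun a => ∃ i ∈ g a, p a i := by
  have hR : PrimrecRel fun (i : β) (a : α) => p a i :=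
    PrimrecPred.primrecRel (p := fun x : β × α => p x.2 x.1)
      (hp.comp (f := fun x : β × α => (x.2, x.1)) (Primrec.pair Primrec.snd Primrec.fst))
  exact hR.exists_mem_list.comp hg Primrec.id

theorem PrimrecPred.ballList {p : α → β → Prop} {g : α → List β}
    (hp : PrimrecPred fun x : α × β => p x.1 x.2) (hg : Primrec g) :
    PrimrecPred fun a => ∀ i ∈ g a, p a i := by
  have hR : PrimrecRel fun (i : β) (a : α) => p a i :=
    PrimrecPred.primrecRel (p := fun x : β × α => p x.2 x.1)
      (hp.comp (f := fun x : β × α => (x.2, x.1)) (Primrec.pair Primrec.snd Primrec.fst))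
  exact hR.forall_mem_list.comp hg Primrec.id

theorem PrimrecPred.imp {p q : α → Prop} (hp : PrimrecPred p) (hq : PrimrecPred q) :
    PrimrecPred fun a => p a → q a :=
  (hp.not.or hq).of_eq fun a => by tauto

theorem PrimrecPred.const (p : Prop) : PrimrecPred fun _ : α => p := by
  classical
  exact ⟨fun _ => inferInstance, Primrec.const _⟩

theorem PrimrecPred.natLt {f g : α → ℕ} (hf : Primrec f) (hg : Primrec g) :
    PrimrecPred fun a => f a < g a := Primrec.nat_lt.comp hf hg

theorem PrimrecPred.natLe {f g : α → ℕ} (hf : Primrec f) (hg : Primrec g) :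
    PrimrecPred fun a => f a ≤ g a := Primrec.nat_le.comp hf hg

theorem PrimrecPred.eq' {f g : α → β} (hf : Primrec f) (hg : Primrec g) :
    PrimrecPred fun a => f a = g a := Primrec.eq.comp hf hg

theorem Primrec.pairNat {f g : α → ℕ} (hf : Primrec f) (hg : Primrec g) :
    Primrec fun a => Nat.pair (f a) (g a) := Primrec₂.natPair.comp hf hg

theorem Primrec.unpair1 {f : α → ℕ} (hf : Primrec f) : Primrec fun a => (f a).unpair.1 :=
  Primrec.fst.comp (Primrec.unpair.comp hf)

theorem Primrec.unpair2 {f : α → ℕ} (hf : Primrec f) : Primrec fun a => (f a).unpair.2 :=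
  Primrec.snd.comp (Primrec.unpair.comp hf)

theorem Primrec.add' {f g : α → ℕ} (hf : Primrec f) (hg : Primrec g) :
    Primrec fun a => f a + g a := Primrec.nat_add.comp hf hg

theorem Primrec.mul' {f g : α → ℕ} (hf : Primrec f) (hg : Primrec g) :
    Primrec fun a => f a * g a := Primrec.nat_mul.comp hf hg

theorem Primrec.sub' {f g : α → ℕ} (hf : Primrec f) (hg : Primrec g) :
    Primrec fun a => f a - g a := Primrec.nat_sub.comp hf hg

theorem Primrec.getElem?' {f : α → List β} {g : α → ℕ} (hf : Primrec f) (hg : Primrec g) :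
    Primrec fun a => (f a)[g a]? := Primrec.list_getElem?.comp hf hg

theorem Primrec.getD' {f : α → List β} {g : α → ℕ} (d : β) (hf : Primrec f) (hg : Primrec g) :
    Primrec fun a => (f a).getD (g a) d := (Primrec.list_getD d).comp hf hg

theorem Primrec.length' {f : α → List β} (hf : Primrec f) :
    Primrec fun a => (f a).length := Primrec.list_length.comp hf

theorem Primrec.mapRange {f : α → ℕ} {g : α → ℕ → β} (hf : Primrec f)
    (hg : Primrec fun x : α × ℕ => g x.1 x.2) :
    Primrec fun a => (List.range (f a)).map (g a) :=
  Primrec.list_map (Primrec.list_range.comp hf) hg.to₂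

theorem PrimrecPred.isPrefix [DecidableEq β] {f g : α → List β} (hf : Primrec f) (hg : Primrec g) :
    PrimrecPred fun a => f a <+: g a := by
  have ht : Primrec₂ (List.take : ℕ → List β → List β) := Primrec.list_take
  exact (PrimrecPred.eq' hf (ht.comp (Primrec.length' hf) hg)).of_eq fun a =>
    List.prefix_iff_eq_take.symm

end PrimrecLemmas

/-- The list of all binary strings of length `l`. -/
def allStrings : ℕ → List (List Bool)
  | 0 => [[]]
  | l + 1 => (allStrings l).flatMap fun σ => [σ ++ [false], σ ++ [true]]

theorem mem_allStrings {l : ℕ} {σ : List Bool} : σ ∈ allStrings l ↔ σ.length = l := by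
  induction l generalizing σ with
  | zero => simp [allStrings]
  | succ l ih =>
    simp only [allStrings, List.mem_flatMap, ih]
    constructor
    · rintro ⟨τ, rfl, h⟩
      simp at h
      rcases h with rfl | rfl <;> simp
    · intro h
      rcases List.eq_nil_or_concat σ with rfl | ⟨τ, b, rfl⟩
      · simp at h
      · refine ⟨τ, by simpa using h, ?_⟩
        cases b <;> simp

theorem primrec_allStrings : Primrec allStrings := by
  let step : List (List Bool) → List (List Bool) := fun L =>
    L.flatMap fun σ => [σ ++ [false], σ ++ [true]]
  have hstep : Primrec step := by
    have h : ∀ b : Bool, Primrec fun x : List (List Bool) × List Bool => x.2 ++ [b] :=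
      fun b => Primrec.list_concat.comp Primrec.snd (Primrec.const b)
    have h2 : Primrec fun x : List (List Bool) × List Bool => [x.2 ++ [false], x.2 ++ [true]] :=
      Primrec.list_cons.comp (h false) (Primrec.list_cons.comp (h true) (Primrec.const []))
    exact Primrec.list_flatMap Primrec.id h2.to₂
  have : Primrec (fun n : ℕ => (Nat.rec [[]] (fun _ L => step L) n : List (List Bool))) :=
    Primrec.nat_rec₁ _ (hstep.comp Primrec.snd).to₂
  exact this.of_eq fun n => by
    induction n with
    | zero => rfl
    | succ n ih => simp only [allStrings, ← ih, step]

/-! ### `Σ⁰₁` predicates with a number parameter and a set parameter -/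

namespace CantorDyn

/-- `P` is a `Σ⁰₁` predicate with a parameter from `α` and a set parameter. -/
def Sig {α : Type} [Primcodable α] (P : α → Set ℕ → Prop) : Prop :=
  -- Monotonicity of `R` lets finitely many witnesses be merged into one longer initial segment.
  ∃ R : α → List Bool → Prop, (PrimrecPred fun x : α × List Bool => R x.1 x.2) ∧
    (∀ a σ τ, σ <+: τ → R a σ → R a τ) ∧ ∀ a X, P a X ↔ ∃ s, R a (res X s)

namespace Sig

variable {α β : Type} [Primcodable α] [Primcodable β]

theorem of_iff {P Q : α → Set ℕ → Prop} (hP : Sig P) (h : ∀ a X, Q a X ↔ P a X) : Sig Q := by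
  have : Q = P := by funext a X; exact propext (h a X)
  rwa [this]

theorem pred {p : α → Prop} (hp : PrimrecPred p) : Sig fun a _ => p a :=
  ⟨fun a _ => p a, hp.comp Primrec.fst, fun _ _ _ _ h => h, fun _ _ => by simp⟩

theorem and {P Q : α → Set ℕ → Prop} (hP : Sig P) (hQ : Sig Q) :
    Sig fun a X => P a X ∧ Q a X := by
  obtain ⟨R, hR, hm, h⟩ := hP
  obtain ⟨R', hR', hm', h'⟩ := hQ
  refine ⟨fun a σ => R a σ ∧ R' a σ, hR.and hR',
    fun a σ τ hs hh => ⟨hm _ _ _ hs hh.1, hm' _ _ _ hs hh.2⟩, fun a X => ?_⟩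
  beta_reduce
  rw [h, h']
  constructor
  · rintro ⟨⟨s, hs⟩, ⟨t, ht⟩⟩
    exact ⟨max s t, hm _ _ _ (res_prefix (le_max_left _ _)) hs,
      hm' _ _ _ (res_prefix (le_max_right _ _)) ht⟩
  · rintro ⟨s, hs, ht⟩
    exact ⟨⟨s, hs⟩, ⟨s, ht⟩⟩

theorem or {P Q : α → Set ℕ → Prop} (hP : Sig P) (hQ : Sig Q) :
    Sig fun a X => P a X ∨ Q a X := by
  obtain ⟨R, hR, hm, h⟩ := hP
  obtain ⟨R', hR', hm', h'⟩ := hQ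
  refine ⟨fun a σ => R a σ ∨ R' a σ, hR.or hR',
    fun a σ τ hs hh => hh.imp (hm _ _ _ hs) (hm' _ _ _ hs), fun a X => ?_⟩
  beta_reduce
  rw [h, h', exists_or]

theorem comp {P : β → Set ℕ → Prop} (hP : Sig P) {f : α → β} (hf : Primrec f) :
    Sig fun a X => P (f a) X := by
  obtain ⟨R, hR, hm, h⟩ := hP
  exact ⟨fun a σ => R (f a) σ, hR.comp (f := fun x : α × List Bool => (f x.1, x.2))
    (Primrec.pair (hf.comp Primrec.fst) Primrec.snd), fun a => hm _, fun a => h _⟩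

theorem ex {P : α → ℕ → Set ℕ → Prop} (hP : Sig fun (x : α × ℕ) X => P x.1 x.2 X) :
    Sig fun a X => ∃ n, P a n X := by
  obtain ⟨R, hR, hm, h⟩ := hP
  -- Bounding the witness by the length of the string keeps the matrix primitive recursive; large
  -- witnesses are reached by reading more of `X`.
  refine ⟨fun a σ => ∃ n < σ.length, R (a, n) σ, ?_, ?_, fun a X => ?_⟩
  · refine PrimrecPred.bex (p := fun (x : α × List Bool) n => R (x.1, n) x.2) ?_
      (Primrec.length' Primrec.snd)
    exact hR.comp (f := fun x : (α × List Bool) × ℕ => ((x.1.1, x.2), x.1.2))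
      (Primrec.pair (Primrec.pair (Primrec.fst.comp Primrec.fst) Primrec.snd)
        (Primrec.snd.comp Primrec.fst))
  · rintro a σ τ hs ⟨n, hn, hh⟩
    exact ⟨n, hn.trans_le hs.length_le, hm _ _ _ hs hh⟩
  · constructor
    · rintro ⟨n, hn⟩
      obtain ⟨s, hs⟩ := (h (a, n) X).1 hn
      exact ⟨max s (n + 1), n, by simp, hm _ _ _ (res_prefix (le_max_left _ _)) hs⟩
    · rintro ⟨s, n, -, hn⟩
      exact ⟨n, (h (a, n) X).2 ⟨s, hn⟩⟩

theorem ball {P : α → ℕ → Set ℕ → Prop} {g : α → ℕ}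
    (hP : Sig fun (x : α × ℕ) X => P x.1 x.2 X) (hg : Primrec g) :
    Sig fun a X => ∀ n < g a, P a n X := by
  obtain ⟨R, hR, hm, h⟩ := hP
  refine ⟨fun a σ => ∀ n < g a, R (a, n) σ, ?_, ?_, fun a X => ?_⟩
  · refine PrimrecPred.ball (p := fun (x : α × List Bool) n => R (x.1, n) x.2) ?_
      (hg.comp Primrec.fst)
    exact hR.comp (f := fun x : (α × List Bool) × ℕ => ((x.1.1, x.2), x.1.2))
      (Primrec.pair (Primrec.pair (Primrec.fst.comp Primrec.fst) Primrec.snd)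
        (Primrec.snd.comp Primrec.fst))
  · intro a σ τ hs hh n hn
    exact hm _ _ _ hs (hh n hn)
  · constructor
    · intro hh
      have : ∀ n < g a, ∃ s, R (a, n) (res X s) := fun n hn => (h (a, n) X).1 (hh n hn)
      choose! s hs using this
      refine ⟨(Finset.range (g a)).sup s, fun n hn => hm _ _ _ (res_prefix ?_) (hs n hn)⟩
      exact Finset.le_sup (f := s) (Finset.mem_range.2 hn)
    · rintro ⟨s, hs⟩ n hn
      exact (h (a, n) X).2 ⟨s, hs n hn⟩

theorem bex {P : α → ℕ → Set ℕ → Prop} {g : α → ℕ}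
    (hP : Sig fun (x : α × ℕ) X => P x.1 x.2 X) (hg : Primrec g) :
    Sig fun a X => ∃ n < g a, P a n X :=
  of_iff (ex (P := fun a n X => n < g a ∧ P a n X)
    (and (pred (PrimrecPred.natLt Primrec.snd (hg.comp Primrec.fst))) hP)) fun _ _ => Iff.rfl

theorem mem {g : α → ℕ} (hg : Primrec g) : Sig fun a X => g a ∈ X := by
  refine ⟨fun a σ => σ[g a]? = some true, PrimrecPred.eq'
    (Primrec.getElem?' Primrec.snd (hg.comp Primrec.fst)) (Primrec.const _), ?_, fun a X => ?_⟩
  · rintro a σ τ ⟨ρ, rfl⟩ h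
    rw [List.getElem?_append_left (List.getElem?_eq_some_iff.1 h).1]; exact h
  · constructor
    · intro h
      refine ⟨g a + 1, ?_⟩
      change (res X (g a + 1))[g a]? = _
      rw [res_getElem?_of_lt (Nat.lt_succ_self _)]; simpa using h
    · rintro ⟨s, hs⟩
      rw [res_getElem?] at hs
      split_ifs at hs
      simpa using hs

theorem notMem {g : α → ℕ} (hg : Primrec g) : Sig fun a X => g a ∉ X := by
  refine ⟨fun a σ => σ[g a]? = some false, PrimrecPred.eq'
    (Primrec.getElem?' Primrec.snd (hg.comp Primrec.fst)) (Primrec.const _), ?_, fun a X => ?_⟩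
  · rintro a σ τ ⟨ρ, rfl⟩ h
    rw [List.getElem?_append_left (List.getElem?_eq_some_iff.1 h).1]; exact h
  · constructor
    · intro h
      refine ⟨g a + 1, ?_⟩
      change (res X (g a + 1))[g a]? = _
      rw [res_getElem?_of_lt (Nat.lt_succ_self _)]; simpa using h
    · rintro ⟨s, hs⟩
      rw [res_getElem?] at hs
      split_ifs at hs
      simpa using hs

open Classical in
/-- A primitive recursive property of a finite string of queries to the set parameter. -/
theorem strings {R : α → List Bool → Prop} (hR : PrimrecPred fun x : α × List Bool => R x.1 x.2)
    {l : α → ℕ} (hl : Primrec l) {b : α → ℕ → Bool} (hb : Primrec fun x : α × ℕ => b x.1 x.2)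
    {h : α → ℕ → ℕ} (hh : Primrec fun x : α × ℕ => h x.1 x.2) :
    Sig fun a X => R a ((List.range (l a)).map fun i => b a i && decide (h a i ∈ X)) := by
  have key : Primrec fun x : α × List Bool =>
      (List.range (l x.1)).map fun i => b x.1 i && x.2.getD (h x.1 i) false := by
    refine Primrec.mapRange (hl.comp Primrec.fst)
      (Primrec.and.comp (hb.comp (Primrec.pair (Primrec.fst.comp Primrec.fst) Primrec.snd)) ?_)
    exact Primrec.getD' _ (Primrec.snd.comp Primrec.fst)
      (hh.comp (Primrec.pair (Primrec.fst.comp Primrec.fst) Primrec.snd))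
  -- All queries must lie inside `σ`; otherwise the default value `false` would be mistaken for an
  -- answer.
  refine ⟨fun a σ => (∀ i < l a, h a i < σ.length) ∧
    R a ((List.range (l a)).map fun i => b a i && σ.getD (h a i) false), ?_, ?_, fun a X => ?_⟩
  · refine PrimrecPred.and (PrimrecPred.ball
      (p := fun (x : α × List Bool) i => h x.1 i < x.2.length) ?_ (hl.comp Primrec.fst)) ?_
    · exact PrimrecPred.natLt (hh.comp (Primrec.pair (Primrec.fst.comp Primrec.fst) Primrec.snd))
        (Primrec.length' (Primrec.snd.comp Primrec.fst))
    · exact hR.comp (f := fun x : α × List Bool => (x.1,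
        (List.range (l x.1)).map fun i => b x.1 i && x.2.getD (h x.1 i) false))
        (Primrec.pair Primrec.fst key)
  · rintro a σ τ ⟨ρ, rfl⟩ ⟨h1, h2⟩
    refine ⟨fun i hi => (h1 i hi).trans_le (by simp), ?_⟩
    convert h2 using 1
    apply List.map_congr_left
    intro i hi
    rw [List.getD_append _ _ _ _ (h1 i (List.mem_range.1 hi))]
  · have e : ∀ s, (∀ i < l a, h a i < s) →
        ((List.range (l a)).map fun i => b a i && (res X s).getD (h a i) false) =
          (List.range (l a)).map fun i => b a i && decide (h a i ∈ X) := by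
      intro s hs
      apply List.map_congr_left
      intro i hi
      rw [res_getD (hs i (List.mem_range.1 hi))]
    constructor
    · intro hx
      refine ⟨(Finset.range (l a)).sup (fun i => h a i + 1), ?_⟩
      have h1 : ∀ i < l a, h a i < (Finset.range (l a)).sup (fun i => h a i + 1) := fun i hi =>
        Nat.lt_of_succ_le
          (Finset.le_sup (f := fun i => h a i + 1) (Finset.mem_range.2 hi))
      refine ⟨by simpa using h1, ?_⟩
      rw [e _ h1]; exact hx
    · rintro ⟨s, h1, h2⟩
      rw [res_length] at h1
      rwa [e s h1] at h2

open Classical in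
/-- Substitution of a set that is obtained from the set parameter by queries. -/
theorem subst {P : α → Set ℕ → Prop} (hP : Sig P) {b : α → ℕ → Bool}
    (hb : Primrec fun x : α × ℕ => b x.1 x.2)
    {h : α → ℕ → ℕ} (hh : Primrec fun x : α × ℕ => h x.1 x.2) :
    Sig fun a X => P a {i | b a i = true ∧ h a i ∈ X} := by
  obtain ⟨R, hR, -, hPR⟩ := hP
  have := strings (α := α × ℕ) (R := fun x σ => R x.1 σ)
    (hR.comp (f := fun x : (α × ℕ) × List Bool => (x.1.1, x.2))
      (Primrec.pair (Primrec.fst.comp Primrec.fst) Primrec.snd))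
    (l := fun x => x.2) Primrec.snd (b := fun x i => b x.1 i)
    (hb.comp (g := fun x : (α × ℕ) × ℕ => (x.1.1, x.2))
      (Primrec.pair (Primrec.fst.comp Primrec.fst) Primrec.snd)) (h := fun x i => h x.1 i)
    (hh.comp (g := fun x : (α × ℕ) × ℕ => (x.1.1, x.2))
      (Primrec.pair (Primrec.fst.comp Primrec.fst) Primrec.snd))
  refine of_iff (ex (P := fun a s X => R a ((List.range s).map fun i =>
    b a i && decide (h a i ∈ X))) this) fun a X => ?_
  rw [hPR]
  have : ∀ s, res {i | b a i = true ∧ h a i ∈ X} s =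
      (List.range s).map fun i => b a i && decide (h a i ∈ X) := by
    intro s
    simp only [res]
    apply List.map_congr_left
    intro i _
    by_cases h1 : b a i <;> simp [h1]
  simp only [this]

end Sig

/-! ### A universal `Σ⁰₁` predicate -/

open Nat.Partrec

/-- The stages of the universal `Σ⁰₁` predicate. -/
def UnivStage (u : ℕ) (σ : List Bool) : Prop :=
  -- The length of `σ` is also the time bound. Testing all initial segments of `σ` makes acceptance
  -- persist under extension.
  ∃ l < σ.length + 1, Code.evaln σ.length (Denumerable.ofNat Code u.unpair.1)
    (Nat.pair u.unpair.2 (Encodable.encode (σ.take l))) = some 1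

/-- The universal `Σ⁰₁` predicate. -/
def Univ (u : ℕ) (X : Set ℕ) : Prop := ∃ s, UnivStage u (res X s)

theorem primrec_univStage : PrimrecPred fun x : ℕ × List Bool => UnivStage x.1 x.2 := by
  refine PrimrecPred.bex (p := fun (x : ℕ × List Bool) l =>
    Code.evaln x.2.length (Denumerable.ofNat Code x.1.unpair.1)
    (Nat.pair x.1.unpair.2 (Encodable.encode (x.2.take l))) = some 1) ?_
    (Primrec.succ.comp (Primrec.length' Primrec.snd))
  refine PrimrecPred.eq' ?_ (Primrec.const _)
  have hu : Primrec fun x : (ℕ × List Bool) × ℕ => x.1.1 := Primrec.fst.comp Primrec.fst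
  have hs : Primrec fun x : (ℕ × List Bool) × ℕ => x.1.2 := Primrec.snd.comp Primrec.fst
  exact Code.primrec_evaln.comp (Primrec.pair (Primrec.pair (Primrec.length' hs)
    ((Primrec.ofNat Code).comp (Primrec.unpair1 hu)))
    (Primrec.pairNat (Primrec.unpair2 hu)
      (Primrec.encode.comp (Primrec.list_take.comp Primrec.snd hs))))

theorem UnivStage.mono {u : ℕ} {σ τ : List Bool} (h : σ <+: τ) (hs : UnivStage u σ) :
    UnivStage u τ := by
  obtain ⟨l, hl, he⟩ := hs
  refine ⟨l, hl.trans_le (by have := h.length_le; omega), ?_⟩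
  obtain ⟨ρ, rfl⟩ := h
  rw [List.take_append_of_le_length (by omega)]
  exact Code.evaln_mono (by simp) he

theorem sig_univ : Sig Univ :=
  ⟨UnivStage, primrec_univStage, fun _ _ _ h hs => hs.mono h, fun _ _ => Iff.rfl⟩

/-- The matrix is primitive recursive, hence computed by a code that returns `1` on acceptance. The
number `n` remains an argument, so one code serves all `n`; this uniformity later lets a requirement
mention its own number. -/
theorem Sig.exists_code {P : ℕ → Set ℕ → Prop} (hP : Sig P) :
    ∃ c, ∀ n X, P n X ↔ Univ (Nat.pair c n) X := by
  obtain ⟨R, hR, hm, h⟩ := hP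
  obtain ⟨hd, hR⟩ := hR
  have : ∀ n σ, Decidable (R n σ) := fun n σ => hd (n, σ)
  have hR' : Primrec fun x : ℕ × List Bool => if R x.1 x.2 then 1 else 0 :=
    Primrec.ite ⟨hd, hR⟩ (Primrec.const 1) (Primrec.const 0)
  have hN : Primrec fun m : ℕ =>
      (if R m.unpair.1 ((Encodable.decode (α := List Bool) m.unpair.2).getD []) then 1 else 0 : ℕ) :=
    hR'.comp (Primrec.pair (Primrec.fst.comp Primrec.unpair)
      (Primrec.option_getD.comp (Primrec.decode.comp (Primrec.snd.comp Primrec.unpair))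
        (Primrec.const [])))
  obtain ⟨c, hc⟩ := Code.exists_code.1 (Nat.Partrec.of_primrec (Primrec.nat_iff.1 hN))
  have hc' : ∀ n σ, 1 ∈ c.eval (Nat.pair n (Encodable.encode σ)) ↔ R n σ := by
    intro n σ
    rw [hc]
    simp
  refine ⟨Encodable.encode c, fun n X => ?_⟩
  rw [h]
  simp only [Univ, UnivStage, Nat.unpair_pair, Denumerable.ofNat_encode, res_length]
  constructor
  · rintro ⟨s, hs⟩
    obtain ⟨k, hk⟩ := Code.evaln_complete.1 ((hc' n _).2 hs)
    refine ⟨max k s, s, by have := le_max_right k s; omega, ?_⟩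
    rw [res_take_of_le (le_max_right _ _)]
    exact Code.evaln_mono (le_max_left _ _) hk
  · rintro ⟨s, l, hl, he⟩
    rw [res_take_of_le (by omega)] at he
    exact ⟨l, (hc' n _).1 (Code.evaln_complete.2 ⟨s, he⟩)⟩

theorem Sig.exists_index {P : Set ℕ → Prop} (hP : Sig fun (_ : ℕ) X => P X) :
    ∃ u, ∀ X, P X ↔ Univ u X := by
  obtain ⟨c, hc⟩ := hP.exists_code
  exact ⟨_, hc 0⟩

end CantorDyn

/-! ## A subshift that defeats a given sequence of `Σ⁰₁` events -/

namespace CantorDyn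

/-- The `k`-fold repetition of the word `V`. -/
def pw (V : List Bool) (k : ℕ) : List Bool := (List.replicate k V).flatten

@[simp] theorem pw_zero (V : List Bool) : pw V 0 = [] := rfl

theorem pw_succ (V : List Bool) (k : ℕ) : pw V (k + 1) = V ++ pw V k := by
  simp [pw, List.replicate_succ]

theorem pw_add (V : List Bool) (k l : ℕ) : pw V (k + l) = pw V k ++ pw V l := by
  rw [pw, List.replicate_add, List.flatten_append]; rfl

theorem pw_succ' (V : List Bool) (k : ℕ) : pw V (k + 1) = pw V k ++ V := by
  rw [pw_add]; simp [pw]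

@[simp] theorem length_pw (V : List Bool) (k : ℕ) : (pw V k).length = k * V.length := by
  simp [pw]

theorem prefix_trunc {σ A B : List Bool} (h : σ <+: A ++ B) (hl : σ.length ≤ A.length) : σ <+: A :=
  List.prefix_of_prefix_length_le h (List.prefix_append A B) hl

theorem prefix_tail {σ τ : List Bool} (h : σ <+: τ) : σ.tail <+: τ.tail := by
  obtain ⟨ρ, rfl⟩ := h
  cases σ with
  | nil => exact List.nil_prefix
  | cons a σ => exact List.prefix_append _ _

/-- A block of ones crossing the boundary would make `B` begin with `1`. -/
theorem replicate_infix_append {r : ℕ} {A B : List Bool}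
    (hB : ∀ B', B ≠ true :: B') (h : List.replicate r true <:+: A ++ B) :
    List.replicate r true <:+: A ∨ List.replicate r true <:+: B := by
  obtain ⟨s, t, h⟩ := h
  rw [List.append_eq_append_iff] at h
  rcases h with ⟨c, hc, -⟩ | ⟨c, hc, hB'⟩
  · exact Or.inl ⟨s, c, hc.symm⟩
  · rw [List.append_eq_append_iff] at hc
    rcases hc with ⟨a, ha, hac⟩ | ⟨a, -, hac⟩
    · cases c with
      | nil => left; exact ⟨s, [], by simp_all⟩
      | cons b c =>
        have : b ∈ List.replicate r true := by rw [hac]; simp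
        obtain rfl := (List.mem_replicate.1 this).2
        exact absurd hB' (by simpa using hB (c ++ t))
    · right; exact ⟨a, t, by simp_all⟩

/-- The words `α V ^ k 1 ^ l V ^ N` with `α` a suffix of `V`. -/
def lword (V α : List Bool) (k l N : ℕ) : List Bool :=
  α ++ (pw V k ++ (List.replicate l true ++ pw V N))

/-- `V` is a word at level `m`: it starts with `0`, ends in `1 ^ (m - 1)`, and its powers do not
contain `1 ^ m`. -/
structure LevelWord (V : List Bool) (m : ℕ) : Prop where
  pos : 1 ≤ m
  head : ∃ V', V = false :: V'
  suffix : List.replicate (m - 1) true <:+ V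
  avoid : ∀ N, ¬ List.replicate m true <:+: pw V N

theorem LevelWord.zero : LevelWord [false] 1 := by
  refine ⟨le_rfl, ⟨[], rfl⟩, by simp, fun N h => ?_⟩
  have : true ∈ pw [false] N := h.subset (by simp)
  simp [pw] at this

theorem pw_ne_true {V : List Bool} (hV : ∃ V', V = false :: V') (N : ℕ) (B : List Bool) :
    pw V N ≠ true :: B := by
  obtain ⟨V', rfl⟩ := hV
  cases N <;> simp [pw_succ]

/-- An occurrence of `1 ^ (m + 1)` in `V ^ b 1` can lose only one digit to the final `1`, leaving `1
^ m` inside `V ^ b`. None crosses from one copy of the new word to the next, since each copy starts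
with `0`. The final `1` prolongs the terminal run of ones of `V`. -/
theorem LevelWord.succ {V : List Bool} {m : ℕ} (h : LevelWord V m) (b : ℕ) (hb : b ≠ 0) :
    LevelWord (pw V b ++ [true]) (m + 1) := by
  obtain ⟨b, rfl⟩ := Nat.exists_eq_succ_of_ne_zero hb
  have hhead : ∃ V', pw V (b + 1) ++ [true] = false :: V' := by
    obtain ⟨V', hV'⟩ := h.head
    exact ⟨V' ++ (pw V b ++ [true]), by rw [pw_succ]; nth_rw 1 [hV']; simp⟩
  refine ⟨by omega, hhead, ?_, fun N => ?_⟩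
  · obtain ⟨s, hs⟩ := h.suffix
    refine ⟨pw V b ++ s, ?_⟩
    have hm : List.replicate (m + 1 - 1) true = List.replicate (m - 1) true ++ [true] := by
      rw [← List.replicate_succ']; congr 1; have := h.pos; omega
    rw [hm, Nat.succ_eq_add_one, pw_succ', ← hs]
    simp
  · have one : ¬ List.replicate (m + 1) true <:+: pw V (b + 1) ++ [true] := by
      rintro ⟨s, t, hst⟩
      have := h.avoid (b + 1)
      apply this
      rcases List.eq_nil_or_concat t with rfl | ⟨t, c, rfl⟩
      · rw [List.replicate_succ', List.append_nil, ← List.append_assoc] at hst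
        have := (List.append_inj' hst rfl).1
        exact ⟨s, [], by simpa using this⟩
      · rw [List.concat_eq_append, ← List.append_assoc] at hst
        have := (List.append_inj' hst rfl).1
        rw [List.replicate_succ] at this
        exact ⟨s ++ [true], t, by simpa using this⟩
    induction N with
    | zero => simp
    | succ N ih =>
      rw [pw_succ]
      intro hh
      rcases replicate_infix_append (pw_ne_true hhead N) hh with hh | hh
      · exact one hh
      · exact ih hh

theorem LevelWord.length_pos {V : List Bool} {m : ℕ} (h : LevelWord V m) : 1 ≤ V.length := by
  obtain ⟨V', rfl⟩ := h.head; simp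

section

open Classical

variable (ev : ℕ → ℕ → Prop)

/-- The current word and its level at stage `n`. -/
noncomputable def stage : ℕ → List Bool × ℕ
  | 0 => ([false], 1)
  | n + 1 =>
    -- Event `0` freezes the word. The size condition delays a change until the current word fits
    -- into windows of length `n`, which `not_shiftAP_of_unbounded` needs. The exponent `n + 1`
    -- makes the change invisible to windows of length at most `n`.
    if ¬ ev 0 n ∧ ev (stage n).2 n ∧ 2 * (stage n).1.length + (stage n).2 ≤ n then
      (pw (stage n).1 (n + 1) ++ [true], (stage n).2 + 1)
    else stage n

/-- The words that are admissible at stage `n`. -/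
def lang (n : ℕ) : Set (List Bool) :=
  -- One block of ones may interrupt the periodic pattern as long as event `0` has not happened;
  -- afterwards only pieces of `V V V …` remain.
  {σ | ∃ α k l N, α <:+ (stage ev n).1 ∧ σ <+: lword (stage ev n).1 α k l N ∧
    (ev 0 n → k = 0 ∧ l = 0)}

/-- The tree of the subshift. -/
def evTree : Set (List Bool) := {σ | σ ∈ lang ev σ.length}

variable {ev}

theorem stage_level (n : ℕ) : LevelWord (stage ev n).1 (stage ev n).2 := by
  induction n with
  | zero => exact LevelWord.zero
  | succ n ih =>
    simp only [stage]
    split_ifs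
    · exact ih.succ _ (by omega)
    · exact ih

/-- A level is left only after its event has happened. -/
theorem stage_history (n j : ℕ) (hj : 1 ≤ j) (hjn : j < (stage ev n).2) : ∃ t, ev j t := by
  induction n with
  | zero => simp [stage] at hjn; omega
  | succ n ih =>
    simp only [stage] at hjn
    split_ifs at hjn with hc
    · rcases Nat.lt_or_ge j (stage ev n).2 with h | h
      · exact ih h
      · have : j = (stage ev n).2 := by simp at hjn; omega
        exact ⟨n, this ▸ hc.2.1⟩
    · exact ih hjn

theorem lang_prefix {n : ℕ} {σ τ : List Bool} (h : σ <+: τ) (hτ : τ ∈ lang ev n) :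
    σ ∈ lang ev n := by
  obtain ⟨α, k, l, N, h1, h2, h3⟩ := hτ
  exact ⟨α, k, l, N, h1, h.trans h2, h3⟩

/-- A nonempty suffix of the next word, read in terms of the current word `V`: a cut copy of `V`,
some whole copies, and the final `1`. -/
theorem suffix_pw_true {V α : List Bool} {b : ℕ} (h : α <:+ pw V b ++ [true]) :
    α = [] ∨ ∃ β j, β <:+ V ∧ α = β ++ (pw V j ++ [true]) := by
  rcases List.eq_nil_or_concat α with rfl | ⟨α, c, rfl⟩
  · exact Or.inl rfl
  · right
    rw [List.concat_eq_append] at h ⊢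
    obtain ⟨s, hs⟩ := h
    rw [← List.append_assoc] at hs
    obtain ⟨hs', hc⟩ := List.append_inj' hs rfl
    rw [hc]
    clear hc hs
    rename' hs' => hs
    induction b generalizing s with
    | zero =>
      simp at hs
      exact ⟨[], 0, by simp, by simp [hs]⟩
    | succ b ih =>
      rw [pw_succ, List.append_eq_append_iff] at hs
      rcases hs with ⟨a, h1, h2⟩ | ⟨a, h1, h2⟩
      · exact ⟨a, b, ⟨s, h1.symm⟩, by rw [h2]; simp⟩
      · exact ih a h2.symm

/-- Once `V` is replaced by `V ^ (n + 1) 1`, a window of length at most `n` is shorter than `V ^ (n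
+ 1)`, so it sees at most one block of ones between powers of `V` and was already admissible. -/
theorem lang_succ (hev : ∀ j s t, s ≤ t → ev j s → ev j t) {n : ℕ} {σ : List Bool}
    (hσ : σ ∈ lang ev (n + 1)) (hl : σ.length ≤ n) : σ ∈ lang ev n := by
  obtain ⟨α, k, l, N, h1, h2, h3⟩ := hσ
  have hpos := (stage_level (ev := ev) n).length_pos
  simp only [stage] at h1 h2
  split_ifs at h1 h2 with hc
  · set V := (stage ev n).1 with hV
    have hbig : σ.length ≤ (pw V (n + 1)).length := by
      rw [length_pw]; nlinarith
    -- The power `V ^ (n + 1)` outlasts `σ`, so whatever follows it can be cut off. The clause on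
    -- event `0` is vacuous, because the word has just changed.
    have key : ∀ β j r L, β <:+ V →
        σ <+: β ++ (pw V j ++ (List.replicate r true ++ (pw V (n + 1) ++ L))) →
        σ ∈ lang ev n := by
      intro β j r L hβ hh
      refine ⟨β, j, r, n + 1, hβ, ?_, fun h => absurd h hc.1⟩
      refine prefix_trunc (B := L) ?_ ?_
      · simpa [lword, ← hV] using hh
      · simp only [lword, ← hV, List.length_append]; omega
    have hpre : ∀ N, σ.length ≤ (pw (pw V (n + 1) ++ [true]) (N + 1)).length := by
      intro N
      rw [pw_succ]
      simp only [List.length_append]; omega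
    have key0 : ∀ β j r M, β <:+ V → σ <+: β ++ (pw V j ++ (List.replicate r true ++
        pw (pw V (n + 1) ++ [true]) M)) → σ ∈ lang ev n := by
      intro β j r M hβ hh
      cases M with
      | zero => exact key β j r [] hβ (hh.trans ⟨pw V (n + 1), by simp⟩)
      | succ M =>
        rw [pw_succ] at hh
        exact key β j r ([true] ++ pw (pw V (n + 1) ++ [true]) M) hβ (by simpa using hh)
    rcases suffix_pw_true h1 with rfl | ⟨β, j, hβ, rfl⟩
    · cases k with
      | zero => exact key0 [] 0 l N (List.nil_suffix) (by simpa [lword] using h2)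
      | succ k =>
        refine key0 [] 0 0 1 (List.nil_suffix) ?_
        rw [lword, pw_succ] at h2
        refine prefix_trunc (B := pw (pw V (n + 1) ++ [true]) k ++ (List.replicate l true ++
          pw (pw V (n + 1) ++ [true]) N)) ?_ ?_
        · simpa [pw_succ] using h2
        · have := hpre 0
          simpa using this
    · cases k with
      | zero =>
        refine key0 β j (l + 1) N hβ ?_
        simpa [lword, List.replicate_succ] using h2
      | succ k =>
        refine key0 β j 1 1 hβ ?_
        rw [lword, pw_succ] at h2
        refine prefix_trunc (B := pw (pw V (n + 1) ++ [true]) k ++ (List.replicate l true ++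
          pw (pw V (n + 1) ++ [true]) N)) ?_ ?_
        · simpa [pw_succ] using h2
        · have := hpre 0
          simp only [List.length_append] at this ⊢
          simp only [Nat.zero_add] at this
          omega
  · exact ⟨α, k, l, N, h1, h2, fun h => h3 (hev 0 _ _ (Nat.le_succ n) h)⟩

theorem lang_anti (hev : ∀ j s t, s ≤ t → ev j s → ev j t) {n m : ℕ} (hnm : n ≤ m) {σ : List Bool}
    (hσ : σ ∈ lang ev m) (hl : σ.length ≤ n) : σ ∈ lang ev n := by
  induction m, hnm using Nat.le_induction with
  | base => exact hσ
  | succ m hm ih => exact ih (lang_succ hev hσ (hl.trans hm))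

/-- The deleted digit belongs to the first nonempty piece of `α V ^ k 1 ^ l V ^ N`. Beheading a copy
of `V` turns the rest of that copy into the new suffix `α`. -/
theorem lang_tail {n : ℕ} {σ : List Bool} (hσ : σ ∈ lang ev n) : σ.tail ∈ lang ev n := by
  obtain ⟨α, k, l, N, h1, h2, h3⟩ := hσ
  obtain ⟨V', hV'⟩ := (stage_level (ev := ev) n).head
  set V := (stage ev n).1 with hV
  have ht : ∀ L : List Bool, σ <+: L → σ.tail <+: L.tail := fun L h => prefix_tail h
  have hsuf : V' <:+ V := hV' ▸ List.suffix_cons _ _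
  cases α with
  | cons a α =>
    exact ⟨α, k, l, N, (List.suffix_cons _ _).trans h1, by simpa [lword] using ht _ h2, h3⟩
  | nil =>
    cases k with
    | succ k =>
      refine ⟨V', k, l, N, hsuf, ?_, fun h => by have := h3 h; omega⟩
      have := ht _ h2
      rw [lword, pw_succ] at this
      nth_rw 1 [hV'] at this
      simpa [lword, ← hV] using this
    | zero =>
      cases l with
      | succ l =>
        exact ⟨[], 0, l, N, List.nil_suffix, by
          simpa [lword, List.replicate_succ, ← hV] using ht _ h2, fun h => by have := h3 h; omega⟩
      | zero =>
        cases N with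
        | zero => exact ⟨[], 0, 0, 0, List.nil_suffix, by
            simpa [lword] using ht _ h2, fun _ => by simp⟩
        | succ N =>
          refine ⟨V', 0, 0, N, hsuf, ?_, fun _ => by simp⟩
          have := ht _ h2
          simp only [lword, pw_succ] at this
          nth_rw 1 [hV'] at this
          simpa [lword, ← hV, hV'] using this

theorem evTree_prefix (hev : ∀ j s t, s ≤ t → ev j s → ev j t) {σ τ : List Bool} (h : σ <+: τ)
    (hτ : τ ∈ evTree ev) : σ ∈ evTree ev :=
  lang_anti hev h.length_le (lang_prefix h hτ) le_rfl

theorem stage_frozen (hev : ∀ j s t, s ≤ t → ev j s → ev j t) {n m : ℕ} (h : ev 0 n)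
    (hnm : n ≤ m) : stage ev m = stage ev n := by
  induction m, hnm using Nat.le_induction with
  | base => rfl
  | succ m hm ih =>
    rw [stage, if_neg, ih]
    intro hc
    exact hc.1 (hev 0 _ _ hm h)

theorem prefix_pw {V : List Bool} {k l : ℕ} (h : k ≤ l) : pw V k <+: pw V l := by
  obtain ⟨r, rfl⟩ := Nat.exists_eq_add_of_le h
  rw [pw_add]; exact List.prefix_append _ _

theorem exists_periodic (V : List Bool) (hV : 1 ≤ V.length) :
    ∃ Y : Set ℕ, ∀ n, res Y n <+: pw V n := by
  obtain ⟨Y, hY⟩ := exists_path_of_infinite {σ | σ <+: pw V σ.length}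
    (fun σ τ h hτ => by
      obtain ⟨ρ, hρ⟩ := prefix_pw (V := V) h.length_le
      exact prefix_trunc (B := ρ) (hρ ▸ h.trans hτ) (by rw [length_pw]; nlinarith))
    (fun l => ⟨(pw V l).take l, by
      have : ((pw V l).take l).length = l := by simp; nlinarith
      simp only [Set.mem_ofPred_eq, this]
      exact List.take_prefix _ _, by simp; nlinarith⟩)
  exact ⟨Y, fun n => by simpa using hY n⟩

/-- If event `0` happens, the periodic sequence of the frozen word is a path; otherwise the constant
sequence of ones is, as the interrupting block may be arbitrarily long. -/
theorem evTree_nonempty (hev : ∀ j s t, s ≤ t → ev j s → ev j t) : (paths (evTree ev)).Nonempty := by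
  by_cases h : ∃ n, ev 0 n
  · obtain ⟨n, hn⟩ := h
    obtain ⟨Y, hY⟩ := exists_periodic (stage ev n).1 (stage_level n).length_pos
    have big : ∀ l, n ≤ l → res Y l ∈ evTree ev := by
      intro l hl
      refine ⟨[], 0, 0, l, List.nil_suffix, ?_, fun _ => by simp⟩
      rw [res_length, stage_frozen hev hn hl]
      simpa [lword] using hY l
    exact ⟨Y, fun l => evTree_prefix hev (res_prefix (le_max_left l n)) (big _ (le_max_right l n))⟩
  · refine ⟨Set.univ, fun l => ⟨[], 0, l, 0, List.nil_suffix, ?_, fun h' => absurd ⟨_, h'⟩ h⟩⟩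
    have : res Set.univ l = List.replicate l true := by
      simp [res, List.map_const']
    simp [lword, this]

theorem evTree_isSystem (hev : ∀ j s t, s ≤ t → ev j s → ev j t) :
    IsSystem (evTree ev) List.tail where
  tree _ _ h hτ := evTree_prefix hev h hτ
  encodes :=
    { mono := fun _ _ h => prefix_tail h
      unbounded := fun l => ⟨l + 1, fun σ h => by simp [h]⟩
      shrink := fun σ h => by
        cases σ with
        | nil => exact absurd rfl h
        | cons a σ => simp }
  nonempty := evTree_nonempty hev
  closed σ h := lang_anti hev (by simp) (lang_tail h) le_rfl

end

end CantorDyn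

/-! ### Almost periodic points of the subshift -/

namespace CantorDyn

/-- `Y` starts with `1 ^ j 0`. -/
def Starts (j : ℕ) (Y : Set ℕ) : Prop := (∀ i < j, i ∈ Y) ∧ j ∉ Y

/-- `Y` is an almost periodic point of the shift. -/
def ShiftAP (Y : Set ℕ) : Prop :=
  ∀ c, ∃ b, ∀ n, ∃ k < b, ∀ m < c, (n + k + m ∈ Y ↔ m ∈ Y)

theorem res_drop_eq {Y : Set ℕ} {p m : ℕ} (h : ∀ i < m, p + i ∈ Y) :
    (res Y (p + m)).drop p = List.replicate m true := by
  apply List.ext_getElem?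
  intro i
  rw [List.getElem?_drop, List.getElem?_replicate]
  split_ifs with hi
  · rw [res_getElem?_of_lt (by omega)]; simp [h i hi]
  · simp; omega

theorem mem_of_suffix_res {Y : Set ℕ} {n m : ℕ} (h : List.replicate m true <:+ res Y n) :
    ∃ p, p + m = n ∧ ∀ i < m, p + i ∈ Y := by
  obtain ⟨s, hs⟩ := h
  have hl := congrArg List.length hs
  simp at hl
  refine ⟨s.length, hl, fun i hi => ?_⟩
  have := congrArg (fun L => L[s.length + i]?) hs
  simpa [List.getElem?_append_right, List.getElem?_replicate, hi,
    res_getElem?_of_lt (X := Y) (show s.length + i < n by omega), eq_comm] using this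

section

variable {ev : ℕ → ℕ → Prop}

theorem LevelWord.avoid_append {V : List Bool} {m : ℕ} (h : LevelWord V m) {α : List Bool}
    (hα : α <:+ V) (N : ℕ) : ¬ List.replicate m true <:+: α ++ pw V N := by
  intro hh
  apply h.avoid (N + 1)
  obtain ⟨s, rfl⟩ := hα
  refine hh.trans ⟨s, [], by simp [pw_succ]⟩

/-- With the word frozen at level `m`, windows are pieces of its powers and avoid `1 ^ m`. So the
first `0` of `Y` is at a position `j < m`, and event `j` has happened: it is the freezing event if
`j = 0`, and a level already passed otherwise. -/
theorem starts_of_flag (hev : ∀ j s t, s ≤ t → ev j s → ev j t) {n₀ : ℕ} (h₀ : ev 0 n₀)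
    {Y : Set ℕ} (hY : Y ∈ paths (evTree ev)) : ∃ j, (∃ t, ev j t) ∧ Starts j Y := by
  have hV := stage_level (ev := ev) n₀
  set m := (stage ev n₀).2
  have : ∃ i, i < m ∧ i ∉ Y := by
    by_contra! hcon
    obtain ⟨α, k, l, N, h1, h2, h3⟩ := hY (max n₀ m)
    rw [res_length] at h1 h2 h3
    have hk := h3 (hev 0 _ _ (le_max_left _ _) h₀)
    rw [stage_frozen hev h₀ (le_max_left _ _)] at h1 h2
    refine hV.avoid_append h1 N ?_
    have hr := res_drop_eq (Y := Y) (p := 0) (m := m) (by simpa using hcon)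
    simp only [Nat.zero_add, List.drop_zero] at hr
    rw [← hr]
    refine ((res_prefix (le_max_right _ _)).trans h2).isInfix.trans ?_
    simp [lword, hk]
  classical
  let j := Nat.find this
  have hj := Nat.find_spec this
  refine ⟨j, ?_, fun i hi => ?_, hj.2⟩
  · rcases Nat.eq_zero_or_pos j with h | h
    · exact ⟨n₀, h ▸ h₀⟩
    · exact stage_history n₀ j h hj.1
  · by_contra hi'
    exact Nat.find_min this hi ⟨lt_trans hi hj.1, hi'⟩

/-- Here `Y` is `1 ^ m V V V …`. A recurrence of `1 ^ m` at a positive position would lie in `1 ^ (m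
- 1) V ^ N`, a suffix of a power of `V`, where `1 ^ m` does not occur. -/
theorem not_shiftAP_of_prefix {V : List Bool} {m : ℕ} (hV : LevelWord V m) {Y : Set ℕ}
    (h : ∀ l, ∃ n N, l ≤ n ∧ res Y n <+: List.replicate m true ++ pw V N) (hY : ∀ i < m, i ∈ Y) :
    ¬ ShiftAP Y := by
  intro hap
  obtain ⟨b, hb⟩ := hap (m + 1)
  -- Starting from shift `1` excludes the trivial recurrence at position `0`.
  obtain ⟨k, -, hk⟩ := hb 1
  have hp : ∀ i < m, 1 + k + i ∈ Y := fun i hi => (hk i (by omega)).2 (hY i hi)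
  have hd := res_drop_eq hp
  obtain ⟨n, N, hn, hN⟩ := h (1 + k + m)
  have h1 := prefix_tail ((res_prefix hn).trans hN)
  refine hV.avoid_append hV.suffix N ?_
  obtain ⟨m, rfl⟩ := Nat.exists_eq_succ_of_ne_zero (Nat.one_le_iff_ne_zero.1 hV.pos)
  have h2 : List.replicate (m + 1) true <:+ (res Y (1 + k + (m + 1))).tail := by
    rw [← hd, Nat.add_comm 1 k, ← List.drop_drop, ← List.drop_one]
    rw [List.drop_drop, Nat.add_comm k 1, ← List.drop_drop]
    exact List.drop_suffix _ _
  refine h2.isInfix.trans (h1.isInfix.trans ?_)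
  simp [List.replicate_succ]

/-- The initial `1 ^ m` does not fit into `α V ^ k`, which therefore consists of ones; as `V` starts
with `0`, this forces `k = 0`. The `0` at position `m` then marks where the first copy of `V`
begins, so `α` and the block have total length exactly `m`. -/
theorem prefix_of_stable {V α : List Bool} {m k r N : ℕ} (hV : LevelWord V m) (hα : α <:+ V)
    {Y : Set ℕ} (hY : Starts m Y) {l : ℕ} (hl : m < l) (h : res Y l <+: lword V α k r N) :
    ∃ N, res Y l <+: List.replicate m true ++ pw V N := by
  have hm : res Y m = List.replicate m true := by
    simpa using res_drop_eq (Y := Y) (p := 0) (m := m) (by simpa using hY.1)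
  have hm1 : res Y (m + 1) = List.replicate m true ++ [false] := by
    rw [res_succ, hm]; simp [hY.2]
  have h1 : List.replicate m true ++ [false] <+: α ++ pw V k ++ (List.replicate r true ++ pw V N) := by
    rw [← hm1]
    simpa [lword] using (res_prefix hl).trans h
  have hlen : (α ++ pw V k).length < m := by
    by_contra! hc
    refine hV.avoid_append hα k (List.IsPrefix.isInfix ?_)
    exact prefix_trunc ((List.prefix_append _ _).trans h1) (by simpa using hc)
  have hones : α ++ pw V k <+: List.replicate m true :=
    List.prefix_of_prefix_length_le (List.prefix_append _ _)
      ((List.prefix_append _ _).trans h1) (by simpa using hlen.le)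
  have hall : ∀ b ∈ α ++ pw V k, b = true := fun b hb => (List.mem_replicate.1 (hones.subset hb)).2
  have hk : k = 0 := by
    obtain ⟨V', hV'⟩ := hV.head
    cases k with
    | zero => rfl
    | succ k => have := hall false (by rw [pw_succ]; simp [hV']); simp at this
  subst hk
  have hα1 : α = List.replicate α.length true :=
    List.eq_replicate_iff.2 ⟨rfl, fun b hb => hall b (by simp [hb])⟩
  set a := α.length
  have hw : lword V α 0 r N = List.replicate (a + r) true ++ pw V N := by
    rw [lword, hα1, List.replicate_add]; simp [-List.replicate_append_replicate, a]
  have h2 : List.replicate m true ++ [false] <+: List.replicate (a + r) true ++ pw V N := by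
    rw [← hw, ← hm1]; exact (res_prefix hl).trans h
  have hbit := fun (i : ℕ) (hi : i < m + 1) => List.prefix_iff_getElem?.1 h2 i (by simpa using hi)
  have e : a + r = m := by
    rcases lt_trichotomy (a + r) m with hlt | heq | hgt
    · exfalso
      have := hbit (a + r) (by omega)
      obtain ⟨V', hV'⟩ := hV.head
      cases N with
      | zero => simp at this
      | succ N =>
        rw [List.getElem?_append_right (by simp), List.getElem_append_left (by simpa using hlt),
          pw_succ, hV'] at this
        simp at this
    · exact heq
    · exfalso
      have := hbit m (by omega)
      rw [List.getElem?_append_left (by simpa using hgt)] at this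
      simp [hgt] at this
  exact ⟨N, by rw [← e, ← hw]; exact h⟩

/-- If `α` starts with `0`, it is not contained in the terminal run `1 ^ (m - 1)` of `V` and so
contains that run; if `α` is empty, the word starts with a full copy of `V`. -/
theorem suffix_of_starts_zero {V α : List Bool} {m k r N : ℕ} (hV : LevelWord V m) (hα : α <:+ V)
    {B : List Bool} (h : lword V α k r N = false :: B) :
    ∃ β, β <+: lword V α k r N ∧ β.length ≤ V.length ∧ List.replicate (m - 1) true <:+ β := by
  cases α with
  | cons a α =>
    simp [lword] at h
    refine ⟨a :: α, List.prefix_append _ _, hα.length_le, ?_⟩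
    rcases List.suffix_or_suffix_of_suffix hα hV.suffix with h' | h'
    · have : a ∈ List.replicate (m - 1) true := h'.subset (by simp)
      rw [h.1] at this
      simp [List.mem_replicate] at this
    · exact h'
  | nil =>
    refine ⟨V, ?_, le_rfl, hV.suffix⟩
    cases k with
    | succ k => exact ⟨_, by simp only [lword, pw_succ, List.append_assoc, List.nil_append]; rfl⟩
    | zero =>
      cases r with
      | succ r => simp [lword, List.replicate_succ] at h
      | zero =>
        cases N with
        | zero => simp [lword] at h
        | succ N => exact ⟨pw V N, by simp [lword, pw_succ]⟩

/-- If the digit `0` recurred with gaps bounded by `b`, no `b` consecutive digits could all be ones.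
At a level above `b`, however, the first copy or cut copy of the word ends in at least `b` ones, and
the size condition puts it inside the window of length `n`. -/
theorem not_shiftAP_of_unbounded (h₀ : 0 ∉ (Y : Set ℕ)) (hY : Y ∈ paths (evTree ev))
    (hun : ∀ L, ∃ n, 2 * (stage ev n).1.length + (stage ev n).2 ≤ n ∧ L < (stage ev n).2) :
    ¬ ShiftAP Y := by
  intro hap
  obtain ⟨b, hb⟩ := hap 1
  obtain ⟨n, hn, hL⟩ := hun b
  have hV := stage_level (ev := ev) n
  obtain ⟨α, k, r, N, h1, h2, -⟩ := hY n
  rw [res_length] at h1 h2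
  have hpos := hV.length_pos
  obtain ⟨B, hB⟩ : ∃ B, lword (stage ev n).1 α k r N = false :: B := by
    have h3 : res Y 1 <+: lword (stage ev n).1 α k r N := (res_prefix (by omega)).trans h2
    have h4 : res Y 1 = [false] := by simp [res, h₀]
    rw [h4] at h3
    obtain ⟨B, hB⟩ := h3
    exact ⟨B, hB.symm⟩
  obtain ⟨β, hβ1, hβ2, hβ3⟩ := suffix_of_starts_zero hV h1 hB
  have h5 : β <+: res Y n := List.prefix_of_prefix_length_le hβ1 h2 (by simp; omega)
  rw [eq_res_of_prefix h5] at hβ3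
  obtain ⟨p, hp, hpi⟩ := mem_of_suffix_res hβ3
  obtain ⟨k, hk, hk'⟩ := hb p
  have := (hk' 0 (by omega)).1 (hpi k (by omega))
  exact h₀ this

theorem stage_snd_mono {n m : ℕ} (h : n ≤ m) : (stage ev n).2 ≤ (stage ev m).2 := by
  induction m, h using Nat.le_induction with
  | base => exact le_rfl
  | succ m _ ih =>
    rw [stage]
    split_ifs
    · exact ih.trans (Nat.le_succ _)
    · exact ih

/-- The three regimes: frozen by event `0` (second alternative); stuck forever at level `j`, whose
event then cannot have happened; or levels growing without bound, where `j = 0` works because event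
`0` never happens. -/
theorem evTree_dichotomy (hev : ∀ j s t, s ≤ t → ev j s → ev j t) :
    (∃ j, (¬ ∃ t, ev j t) ∧ ∀ Y ∈ paths (evTree ev), Starts j Y → ¬ ShiftAP Y) ∨
    ∀ Y ∈ paths (evTree ev), ∃ j, (∃ t, ev j t) ∧ Starts j Y := by
  by_cases hflag : ∃ n, ev 0 n
  · obtain ⟨n, hn⟩ := hflag
    exact Or.inr fun Y hY => starts_of_flag hev hn hY
  left
  by_cases hstab : ∃ n₀, ∀ n ≥ n₀, stage ev n = stage ev n₀
  · obtain ⟨n₀, hn₀⟩ := hstab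
    have hV := stage_level (ev := ev) n₀
    refine ⟨(stage ev n₀).2, ?_, fun Y hY hs => not_shiftAP_of_prefix hV (fun l => ?_) hs.1⟩
    · rintro ⟨t, ht⟩
      -- At this stage all conditions for raising the level would be met, contradicting stability.
      have hadv := hn₀ (n₀ + t + 2 * (stage ev n₀).1.length + (stage ev n₀).2 + 1) (by omega)
      have hadv' := hn₀ (n₀ + t + 2 * (stage ev n₀).1.length + (stage ev n₀).2) (by omega)
      rw [stage, hadv', if_pos] at hadv
      · have := congrArg Prod.snd hadv
        simp at this
      · exact ⟨fun h => hflag ⟨_, h⟩, hev _ _ _ (by omega) ht, by omega⟩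
    · obtain ⟨α, k, r, N, h1, h2, -⟩ := hY (n₀ + l + (stage ev n₀).2 + 1)
      have hst := hn₀ (n₀ + l + (stage ev n₀).2 + 1) (by omega)
      rw [res_length, hst] at h1 h2
      obtain ⟨N, hN⟩ := prefix_of_stable hV h1 hs (l := n₀ + l + (stage ev n₀).2 + 1)
        (by omega) h2
      exact ⟨_, N, by omega, hN⟩
  · refine ⟨0, hflag, fun Y hY hs => not_shiftAP_of_unbounded hs.2 hY ?_⟩
    -- A stage sequence that never stabilizes changes infinitely often, and each change passes the
    -- size test.
    have hadv : ∀ n₀, ∃ n ≥ n₀, 2 * (stage ev n).1.length + (stage ev n).2 ≤ n ∧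
        (stage ev (n + 1)).2 = (stage ev n).2 + 1 := by
      intro n₀
      by_contra! hcon
      refine hstab ⟨n₀, fun n hn => ?_⟩
      induction n, hn using Nat.le_induction with
      | base => rfl
      | succ n hn ih =>
        rw [← ih]
        have := hcon n hn
        rw [stage] at this ⊢
        split_ifs with hc
        · rw [if_pos hc] at this
          exact absurd rfl (this hc.2.2)
        · rfl
    intro L
    induction L with
    | zero =>
      obtain ⟨n, -, h1, -⟩ := hadv 0
      exact ⟨n, h1, (stage_level n).pos⟩
    | succ L ih =>
      obtain ⟨n, -, hn⟩ := ih
      -- The change at `n1` raises the level above `L + 1`; the next change, at `n2`, supplies the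
      -- size condition at that level or beyond.
      obtain ⟨n1, hn1, -, h1⟩ := hadv n
      obtain ⟨n2, hn2, h2, -⟩ := hadv (n1 + 1)
      have := stage_snd_mono (ev := ev) hn1
      have := stage_snd_mono (ev := ev) hn2
      exact ⟨n2, h2, by omega⟩

end

end CantorDyn

/-! ### Primitive recursiveness of the subshift trees -/

namespace CantorDyn

theorem primrec_pw {α : Type*} [Primcodable α] {V : α → List Bool} {k : α → ℕ} (hV : Primrec V)
    (hk : Primrec k) : Primrec fun a => pw (V a) (k a) := by
  have : Primrec fun a => (List.range (k a)).flatMap fun _ => V a :=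
    Primrec.list_flatMap (Primrec.list_range.comp hk) (hV.comp Primrec.fst).to₂
  refine this.of_eq fun a => ?_
  rw [pw, List.flatMap_def, List.map_const', List.length_range]

theorem primrec_lword {α : Type*} [Primcodable α] {V A : α → List Bool} {k l N : α → ℕ}
    (hV : Primrec V) (hA : Primrec A) (hk : Primrec k) (hl : Primrec l) (hN : Primrec N) :
    Primrec fun a => lword (V a) (A a) (k a) (l a) (N a) := by
  have hr : Primrec fun a => List.replicate (l a) true :=
    (Primrec.mapRange (g := fun _ _ => true) hl (Primrec.const true)).of_eq fun a => by
      simp [List.map_const']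
  exact Primrec.list_append.comp hA (Primrec.list_append.comp (primrec_pw hV hk)
    (Primrec.list_append.comp hr (primrec_pw hV hN)))

/-- A string of length at most `n` cannot see past `n` ones or `n` copies of a nonempty word, so the
exponents can be truncated at `n`, and membership becomes a bounded search. -/
theorem mem_lang_iff {ev : ℕ → ℕ → Prop} {n : ℕ} {σ : List Bool} (hσ : σ.length ≤ n) :
    σ ∈ lang ev n ↔ ∃ p < (stage ev n).1.length + 1, ∃ k < n + 1, ∃ l < n + 1,
      σ <+: lword (stage ev n).1 ((stage ev n).1.drop p) k l n ∧ (ev 0 n → k = 0 ∧ l = 0) := by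
  constructor
  · rintro ⟨α, k, l, N, h1, h2, h3⟩
    have hpos := (stage_level (ev := ev) n).length_pos
    set V := (stage ev n).1
    refine ⟨V.length - α.length, by omega, ?_⟩
    rw [← List.suffix_iff_eq_drop.1 h1]
    have hlen : ∀ r, r ≤ (pw V r).length := fun r => by rw [length_pw]; nlinarith
    have hN : σ <+: lword V α k l n := by
      rcases le_total N n with h | h
      · obtain ⟨t, ht⟩ := prefix_pw (V := V) h
        exact h2.trans ⟨t, by simp [lword, ← ht]⟩
      · obtain ⟨t, ht⟩ := prefix_pw (V := V) h
        refine prefix_trunc (B := t) ?_ (by simp only [lword, List.length_append]; have := hlen n; omega)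
        simpa [lword, ← ht] using h2
    by_cases hk : n < k
    · refine ⟨n, by omega, 0, by omega, ?_, fun h => by have := h3 h; omega⟩
      obtain ⟨t, ht⟩ := prefix_pw (V := V) hk.le
      have : σ <+: α ++ pw V n := by
        refine prefix_trunc (B := t ++ (List.replicate l true ++ pw V n)) ?_
          (by simp only [List.length_append]; have := hlen n; omega)
        simpa [lword, ← ht] using hN
      exact this.trans ⟨pw V n, by simp [lword]⟩
    · refine ⟨k, by omega, ?_⟩
      by_cases hl : n < l
      · refine ⟨n, by omega, ?_, fun h => by have := h3 h; omega⟩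
        obtain ⟨r, rfl⟩ := Nat.exists_eq_add_of_le hl.le
        have : σ <+: α ++ (pw V k ++ List.replicate n true) := by
          refine prefix_trunc (B := List.replicate r true ++ pw V n) ?_ (by simp; omega)
          rw [lword, List.replicate_add] at hN
          simpa only [List.append_assoc] using hN
        exact this.trans ⟨pw V n, by simp [lword]⟩
      · exact ⟨l, by omega, hN, h3⟩
  · rintro ⟨p, -, k, -, l, -, h1, h2⟩
    exact ⟨_, k, l, n, List.drop_suffix _ _, h1, h2⟩

section

variable {ev : ℕ → ℕ → ℕ → Prop}

theorem primrec_stage (hev : PrimrecPred fun x : ℕ × ℕ × ℕ => ev x.1 x.2.1 x.2.2) :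
    Primrec₂ fun e n => stage (ev e) n := by
  classical
  let g : ℕ → ℕ × (List Bool × ℕ) → List Bool × ℕ := fun e x =>
    if ¬ ev e 0 x.1 ∧ ev e x.2.2 x.1 ∧ 2 * x.2.1.length + x.2.2 ≤ x.1 then
      (pw x.2.1 (x.1 + 1) ++ [true], x.2.2 + 1) else x.2
  have h1 : Primrec fun x : ℕ × ℕ × (List Bool × ℕ) => x.2.1 := Primrec.fst.comp Primrec.snd
  have h2 : Primrec fun x : ℕ × ℕ × (List Bool × ℕ) => x.2.2.1 :=
    Primrec.fst.comp (Primrec.snd.comp Primrec.snd)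
  have h3 : Primrec fun x : ℕ × ℕ × (List Bool × ℕ) => x.2.2.2 :=
    Primrec.snd.comp (Primrec.snd.comp Primrec.snd)
  have e1 := hev.comp (f := fun x : ℕ × ℕ × (List Bool × ℕ) => (x.1, 0, x.2.1))
    (Primrec.fst.pair ((Primrec.const 0).pair h1))
  have e2 := hev.comp (f := fun x : ℕ × ℕ × (List Bool × ℕ) => (x.1, x.2.2.2, x.2.1))
    (Primrec.fst.pair (h3.pair h1))
  have e3 : PrimrecPred fun x : ℕ × ℕ × (List Bool × ℕ) => 2 * x.2.2.1.length + x.2.2.2 ≤ x.2.1 :=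
    PrimrecPred.natLe (((Primrec.const 2).mul' h2.length').add' h3) h1
  have hg : Primrec₂ g := by
    refine Primrec.ite (e1.not.and (e2.and e3)) ?_ (Primrec.snd.comp Primrec.snd)
    exact (Primrec.list_concat.comp (primrec_pw h2 (Primrec.succ.comp h1)) (Primrec.const true)).pair
      (Primrec.succ.comp h3)
  have := Primrec.nat_rec (f := fun _ : ℕ => (([false], 1) : List Bool × ℕ)) (Primrec.const _) hg
  refine this.of_eq fun e n => ?_
  induction n with
  | zero => rfl
  | succ n ih => simp only [ih, stage, g]

theorem primrec_evTree (hev : PrimrecPred fun x : ℕ × ℕ × ℕ => ev x.1 x.2.1 x.2.2) :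
    PrimrecPred fun x : ℕ × List Bool => x.2 ∈ evTree (ev x.1) := by
  have hn : Primrec fun x : ℕ × List Bool => x.2.length := Primrec.length' Primrec.snd
  have hV : Primrec fun x : ℕ × List Bool => (stage (ev x.1) x.2.length).1 :=
    Primrec.fst.comp ((primrec_stage hev).comp Primrec.fst hn)
  have key : PrimrecPred fun y : (((ℕ × List Bool) × ℕ) × ℕ) × ℕ =>
      y.1.1.1.2 <+: lword (stage (ev y.1.1.1.1) y.1.1.1.2.length).1
        ((stage (ev y.1.1.1.1) y.1.1.1.2.length).1.drop y.1.1.2) y.1.2 y.2 y.1.1.1.2.length ∧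
      (ev y.1.1.1.1 0 y.1.1.1.2.length → y.1.2 = 0 ∧ y.2 = 0) := by
    have b : Primrec fun y : (((ℕ × List Bool) × ℕ) × ℕ) × ℕ => y.1.1.1 :=
      Primrec.fst.comp (Primrec.fst.comp Primrec.fst)
    have hV' := hV.comp b
    have hn' := hn.comp b
    have hp : Primrec fun y : (((ℕ × List Bool) × ℕ) × ℕ) × ℕ => y.1.1.2 :=
      Primrec.snd.comp (Primrec.fst.comp Primrec.fst)
    have hk : Primrec fun y : (((ℕ × List Bool) × ℕ) × ℕ) × ℕ => y.1.2 :=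
      Primrec.snd.comp Primrec.fst
    refine (PrimrecPred.isPrefix (Primrec.snd.comp b)
      (primrec_lword hV' ((Primrec.list_drop (α := Bool)).comp hp hV') hk Primrec.snd hn')).and ?_
    refine PrimrecPred.imp
      (hev.comp (f := fun y : (((ℕ × List Bool) × ℕ) × ℕ) × ℕ =>
        (y.1.1.1.1, 0, y.1.1.1.2.length))
        ((Primrec.fst.comp b).pair ((Primrec.const 0).pair hn'))) ?_
    exact (PrimrecPred.eq' hk (Primrec.const 0)).and
      (PrimrecPred.eq' Primrec.snd (Primrec.const 0))
  have hn1 := Primrec.succ.comp hn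
  refine PrimrecPred.of_eq (PrimrecPred.bex
      (p := fun (x : ℕ × List Bool) p => ∃ k < x.2.length + 1, ∃ l < x.2.length + 1,
      x.2 <+: lword (stage (ev x.1) x.2.length).1 ((stage (ev x.1) x.2.length).1.drop p) k l
      x.2.length ∧ (ev x.1 0 x.2.length → k = 0 ∧ l = 0))
    (PrimrecPred.bex (p := fun (x : (ℕ × List Bool) × ℕ) k => ∃ l < x.1.2.length + 1,
      x.1.2 <+: lword (stage (ev x.1.1) x.1.2.length).1 ((stage (ev x.1.1) x.1.2.length).1.drop x.2)
      k l x.1.2.length ∧ (ev x.1.1 0 x.1.2.length → k = 0 ∧ l = 0))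
      (PrimrecPred.bex (p := fun (x : ((ℕ × List Bool) × ℕ) × ℕ) l =>
      x.1.1.2 <+: lword (stage (ev x.1.1.1) x.1.1.2.length).1
      ((stage (ev x.1.1.1) x.1.1.2.length).1.drop x.1.2)
      x.2 l x.1.1.2.length ∧ (ev x.1.1.1 0 x.1.1.2.length → x.2 = 0 ∧ l = 0)) key
      (hn1.comp (Primrec.fst.comp Primrec.fst)))
      (hn1.comp Primrec.fst)) (Primrec.succ.comp (Primrec.length' hV))) fun x => ?_
  exact (mem_lang_iff le_rfl).symm

end

/-! ## Products of shift systems -/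

/-- The first `m` digits of column `e` of the string `σ`. -/
def colStr (e m : ℕ) (σ : List Bool) : List Bool :=
  (List.range m).map fun i => σ.getD (Nat.pair e i) false

/-- The position in the original sequence of digit `i` of the sequence with shifted columns. -/
def shiftIdx (i : ℕ) : ℕ := Nat.pair i.unpair.1 (i.unpair.2 + 1)

/-- The string function that shifts every column. -/
def shiftCols (σ : List Bool) : List Bool :=
  (List.range ((σ.length.sqrt - 1) * (σ.length.sqrt - 1))).map fun i => σ.getD (shiftIdx i) false

/-- The tree whose paths have their columns in the given trees. -/
def prodTree (T : ℕ → Set (List Bool)) : Set (List Bool) :=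
  -- `Nat.pair e` is increasing, so every digit that is read lies inside `σ` and no default value of
  -- `getD` intervenes.
  {σ | ∀ e m, Nat.pair e m < σ.length → colStr e (m + 1) σ ∈ T e}

theorem pair_mono {e m n : ℕ} (h : m ≤ n) : Nat.pair e m ≤ Nat.pair e n := by
  rcases h.eq_or_lt with rfl | h
  · exact le_rfl
  · exact (Nat.pair_lt_pair_right e h).le

/-- `Nat.pair` fills squares: the pairs with both components below `s` are exactly the numbers below
`s * s`. Shifting by one digit stays in the square of side `n.sqrt` if the start is in the square of
side `n.sqrt - 1`. -/
theorem shiftIdx_lt {i n : ℕ} (h : i < (n.sqrt - 1) * (n.sqrt - 1)) : shiftIdx i < n := by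
  have h1 : i.unpair.1 < n.sqrt - 1 ∧ i.unpair.2 < n.sqrt - 1 := by
    have := Nat.max_sq_add_min_le_pair i.unpair.1 i.unpair.2
    rw [Nat.pair_unpair] at this
    have h2 : max i.unpair.1 i.unpair.2 < n.sqrt - 1 := by
      by_contra hc
      nlinarith [Nat.zero_le (min i.unpair.1 i.unpair.2)]
    exact ⟨lt_of_le_of_lt (le_max_left _ _) h2, lt_of_le_of_lt (le_max_right _ _) h2⟩
  have h2 := Nat.pair_lt_max_add_one_sq i.unpair.1 (i.unpair.2 + 1)
  have h3 := Nat.sqrt_le n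
  have h4 : max i.unpair.1 (i.unpair.2 + 1) + 1 ≤ n.sqrt := by omega
  calc shiftIdx i < _ := h2
    _ ≤ n.sqrt ^ 2 := Nat.pow_le_pow_left h4 2
    _ ≤ n := by rw [sq]; exact h3

theorem getElem?_shiftCols {σ : List Bool} {i : ℕ} (h : i < (shiftCols σ).length) :
    (shiftCols σ)[i]? = σ[shiftIdx i]? := by
  have h' : i < (σ.length.sqrt - 1) * (σ.length.sqrt - 1) := by simpa [shiftCols] using h
  have := shiftIdx_lt h'
  simp [shiftCols, h', this]

theorem length_shiftCols (σ : List Bool) :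
    (shiftCols σ).length = (σ.length.sqrt - 1) * (σ.length.sqrt - 1) := by simp [shiftCols]

theorem length_shiftCols_mono {σ τ : List Bool} (h : σ.length ≤ τ.length) :
    (shiftCols σ).length ≤ (shiftCols τ).length := by
  rw [length_shiftCols, length_shiftCols]
  have := Nat.sub_le_sub_right (Nat.sqrt_le_sqrt h) 1
  exact Nat.mul_le_mul this this

theorem prefix_of_getElem? {σ τ : List Bool} (h : ∀ i < σ.length, σ[i]? = τ[i]?) : σ <+: τ := by
  rw [List.prefix_iff_getElem?]
  intro i hi
  rw [← h i hi, List.getElem?_eq_getElem hi]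

theorem getElem?_of_prefix {σ τ : List Bool} (h : σ <+: τ) {i : ℕ} (hi : i < σ.length) :
    τ[i]? = σ[i]? := by
  rw [List.getElem?_eq_getElem hi]
  exact List.prefix_iff_getElem?.1 h i hi

theorem shiftCols_encodes : EncodesTransformation shiftCols where
  mono σ τ h := by
    refine prefix_of_getElem? fun i hi => ?_
    rw [getElem?_shiftCols hi,
      getElem?_shiftCols (hi.trans_le (length_shiftCols_mono h.length_le))]
    have := shiftIdx_lt (length_shiftCols σ ▸ hi)
    exact (getElem?_of_prefix h this).symm
  unbounded l := by
    refine ⟨(l + 1) * (l + 1), fun σ h => ?_⟩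
    rw [length_shiftCols, h, Nat.sqrt_eq]
    simp
    nlinarith
  shrink σ h := by
    rw [length_shiftCols]
    have h1 := Nat.sqrt_le σ.length
    have h2 : 0 < σ.length.sqrt := Nat.sqrt_pos.2 (List.length_pos_iff.2 h)
    obtain ⟨s, hs⟩ := Nat.exists_eq_succ_of_ne_zero h2.ne'
    rw [hs] at h1 ⊢
    simp only [Nat.succ_eq_add_one, Nat.add_sub_cancel] at h1 ⊢
    nlinarith

theorem colStr_congr {e m : ℕ} {σ τ : List Bool} (h : ∀ i < m, σ[Nat.pair e i]? = τ[Nat.pair e i]?) :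
    colStr e m σ = colStr e m τ := by
  refine List.map_congr_left fun i hi => ?_
  simp only [List.getD_eq_getElem?_getD, h i (List.mem_range.1 hi)]

theorem colStr_tail {e m : ℕ} {σ τ : List Bool}
    (h : ∀ i < m, σ[Nat.pair e i]? = τ[Nat.pair e (i + 1)]?) :
    colStr e m σ = (colStr e (m + 1) τ).tail := by
  rw [colStr, colStr, List.range_succ_eq_map]
  simp only [List.map_cons, List.map_map, List.tail_cons]
  refine List.map_congr_left fun i hi => ?_
  simp only [Function.comp, List.getD_eq_getElem?_getD, h i (List.mem_range.1 hi),
    Nat.succ_eq_add_one]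

theorem colStr_res {e m l : ℕ} (h : Nat.pair e m < l) (X : Set ℕ) :
    colStr e (m + 1) (res X l) = res (column e X) (m + 1) := by
  refine List.map_congr_left fun i hi => ?_
  have hi := List.mem_range.1 hi
  rw [res_getD (lt_of_le_of_lt (pair_mono (Nat.lt_succ_iff.1 hi)) h)]
  rfl

theorem mem_transform_shiftCols (X : Set ℕ) (i : ℕ) :
    i ∈ transform shiftCols X ↔ shiftIdx i ∈ X := by
  constructor
  · rintro ⟨l, hl⟩
    have hi : i < (shiftCols (res X l)).length := by
      by_contra h
      rw [List.getElem?_eq_none (by omega)] at hl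
      simp at hl
    rw [getElem?_shiftCols hi, res_getElem?_of_lt] at hl
    · simpa using hl
    · simpa using shiftIdx_lt (lt_of_lt_of_eq hi (length_shiftCols _))
  · intro h
    obtain ⟨m, hm⟩ := shiftCols_encodes.unbounded (i + 1)
    have hi : i < (shiftCols (res X m)).length := hm _ (by simp)
    refine ⟨m, ?_⟩
    rw [getElem?_shiftCols hi, res_getElem?_of_lt]
    · simpa using h
    · simpa using shiftIdx_lt (lt_of_lt_of_eq hi (length_shiftCols _))

theorem mem_column_transform (X : Set ℕ) (e m : ℕ) :
    m ∈ column e (transform shiftCols X) ↔ m + 1 ∈ column e X := by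
  simp only [column, Set.mem_ofPred_eq, mem_transform_shiftCols, shiftIdx, Nat.unpair_pair]

theorem mem_column_iterate (X : Set ℕ) (e m n : ℕ) :
    m ∈ column e ((transform shiftCols)^[n] X) ↔ n + m ∈ column e X := by
  induction n generalizing X with
  | zero => simp
  | succ n ih =>
    rw [Function.iterate_succ_apply, ih, mem_column_transform, Nat.add_right_comm]

section

variable {T : ℕ → Set (List Bool)}

theorem mem_paths_prodTree (hT : ∀ e σ τ, σ <+: τ → τ ∈ T e → σ ∈ T e) (X : Set ℕ) :
    X ∈ paths (prodTree T) ↔ ∀ e, column e X ∈ paths (T e) := by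
  constructor
  · intro h e l
    have := h (Nat.pair e l + 1) e l (by simp)
    rw [colStr_res (by omega)] at this
    exact hT e _ _ (res_prefix (Nat.le_succ l)) this
  · intro h l e m hm
    rw [colStr_res (by simpa using hm)]
    exact h e _

theorem prodTree_isSystem (hT : ∀ e, IsSystem (T e) List.tail) :
    IsSystem (prodTree T) shiftCols where
  tree σ τ h hτ e m hm := by
    rw [colStr_congr (τ := τ)]
    · exact hτ e m (hm.trans_le h.length_le)
    · intro i hi
      exact (getElem?_of_prefix h (lt_of_le_of_lt (pair_mono (Nat.lt_succ_iff.1 hi)) hm)).symm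
  encodes := shiftCols_encodes
  nonempty := by
    choose Y hY using fun e => (hT e).nonempty
    refine ⟨{n | n.unpair.2 ∈ Y n.unpair.1}, ?_⟩
    rw [mem_paths_prodTree fun e => (hT e).tree]
    intro e
    have : column e {n | n.unpair.2 ∈ Y n.unpair.1} = Y e := by
      ext m; simp [column]
    rw [this]
    exact hY e
  closed σ hσ e m hm := by
    rw [colStr_tail (τ := σ)]
    · refine (hT e).closed _ (hσ e (m + 1) ?_)
      have := shiftIdx_lt (lt_of_lt_of_eq hm (length_shiftCols σ))
      rw [shiftIdx, Nat.unpair_pair] at this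
      exact this
    · intro i hi
      rw [getElem?_shiftCols (lt_of_le_of_lt (pair_mono (Nat.lt_succ_iff.1 hi)) hm)]
      simp [shiftIdx]

theorem primrec_prodTree (hp : PrimrecPred fun x : ℕ × List Bool => x.2 ∈ T x.1) :
    PrimrecPred fun σ : List Bool => σ ∈ prodTree T := by
  have hcol : Primrec fun x : List Bool × ℕ => colStr x.2.unpair.1 (x.2.unpair.2 + 1) x.1 := by
    have h1 : Primrec fun x : List Bool × ℕ => x.2.unpair.2 + 1 :=
      Primrec.succ.comp (Primrec.unpair2 Primrec.snd)
    refine Primrec.mapRange h1 ?_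
    exact Primrec.getD' false (Primrec.fst.comp Primrec.fst)
      (Primrec.pairNat (Primrec.unpair1 (Primrec.snd.comp Primrec.fst)) Primrec.snd)
  refine (PrimrecPred.ball (g := List.length)
    (p := fun σ i => colStr i.unpair.1 (i.unpair.2 + 1) σ ∈ T i.unpair.1)
    (hp.comp ((Primrec.unpair1 Primrec.snd).pair hcol)) Primrec.list_length).of_eq fun σ => ?_
  constructor
  · intro h e m hm
    simpa using h _ hm
  · intro h i hi
    exact h _ _ (by simpa using hi)

theorem primrec_shiftCols : Primrec shiftCols := by
  have hs : Primrec fun σ : List Bool => σ.length.sqrt - 1 :=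
    Primrec.sub' (Primrec.nat_sqrt.comp Primrec.list_length) (Primrec.const 1)
  refine Primrec.mapRange (Primrec.mul' hs hs) ?_
  exact Primrec.getD' false Primrec.fst (Primrec.pairNat (Primrec.unpair1 Primrec.snd)
    (Primrec.succ.comp (Primrec.unpair2 Primrec.snd)))

theorem prodTree_isComputableSystem (hT : ∀ e, IsSystem (T e) List.tail)
    (hp : PrimrecPred fun x : ℕ × List Bool => x.2 ∈ T x.1) :
    IsComputableSystem (prodTree T) shiftCols :=
  ⟨prodTree_isSystem hT, (primrec_prodTree hp).computablePred, primrec_shiftCols.to_comp⟩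

theorem prodTree_isProductShift (hT : ∀ e, IsSystem (T e) List.tail)
    (hp : PrimrecPred fun x : ℕ × List Bool => x.2 ∈ T x.1) :
    IsProductShift (prodTree T) shiftCols :=
  ⟨T, hp.computablePred, hT, mem_paths_prodTree fun e => (hT e).tree, mem_column_transform⟩

theorem shiftAP_column {C : Set (List Bool)} {Z : Set ℕ} (h : IsAlmostPeriodic C shiftCols Z)
    (e : ℕ) : ShiftAP (column e Z) := by
  intro c
  -- The first `c` digits of column `e` sit at positions below `Nat.pair e c`.
  obtain ⟨b, hb⟩ := h.2 (Nat.pair e c)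
  refine ⟨b, fun n => ?_⟩
  obtain ⟨k, hk, hk'⟩ := hb n
  refine ⟨k, hk, fun m hm => ?_⟩
  rw [res_eq_iff] at hk'
  have := hk' (Nat.pair e m) (Nat.pair_lt_pair_right e hm)
  rw [← mem_column_iterate]
  exact this

end

end CantorDyn

/-! ## Turing reductions are `Σ⁰₁` -/

namespace CantorDyn

theorem Sig.exCode {α β : Type} [Primcodable α] [Primcodable β] [Inhabited β]
    {P : α → β → Set ℕ → Prop} (hP : Sig fun (x : α × β) X => P x.1 x.2 X) :
    Sig fun a X => ∃ b, P a b X := by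
  have h := hP.comp (f := fun x : α × ℕ => (x.1, (Encodable.decode (α := β) x.2).getD default))
    (Primrec.fst.pair (Primrec.option_getD.comp
        (Primrec.decode.comp Primrec.snd) (Primrec.const default)))
  refine (Sig.ex (P := fun a n X => P a ((Encodable.decode (α := β) n).getD default) X) h).of_iff
    fun a X => ⟨fun ⟨b, hb⟩ => ⟨Encodable.encode b, by simpa using hb⟩, fun ⟨n, hn⟩ => ⟨_, hn⟩⟩

/-- The list `s` records the history of the recursion, so that the graph needs one existential
quantifier over a finite object. -/
theorem mem_prec_iff {f : ℕ →. ℕ} {h : ℕ →. ℕ} {a n y : ℕ} :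
    y ∈ (Nat.rec (f a) (fun y IH => IH >>= fun i => h (Nat.pair a (Nat.pair y i))) n : Part ℕ) ↔
    ∃ s : List ℕ, s.getD 0 0 ∈ f a ∧
      (∀ i < n, s.getD (i + 1) 0 ∈ h (Nat.pair a (Nat.pair i (s.getD i 0)))) ∧ s.getD n 0 = y := by
  have key : y ∈ (Nat.rec (f a) (fun y IH => IH >>= fun i => h (Nat.pair a (Nat.pair y i))) n : Part ℕ) ↔
    ∃ s : ℕ → ℕ, s 0 ∈ f a ∧
      (∀ i < n, s (i + 1) ∈ h (Nat.pair a (Nat.pair i (s i)))) ∧ s n = y := by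
    induction n generalizing y with
    | zero =>
      constructor
      · intro hy; exact ⟨fun _ => y, hy, by simp, rfl⟩
      · rintro ⟨s, h0, -, rfl⟩; exact h0
    | succ n ih =>
      simp only [Part.bind_eq_bind, Part.mem_bind_iff] at ih ⊢
      constructor
      · rintro ⟨z, hz, hy⟩
        obtain ⟨s, h0, h1, rfl⟩ := ih.1 hz
        refine ⟨fun i => if i ≤ n then s i else y, by simpa using h0, fun i hi => ?_, by simp⟩
        rcases Nat.lt_succ_iff_lt_or_eq.1 hi with hi | rfl
        · simpa [hi.le, Nat.succ_le_of_lt hi] using h1 i hi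
        · simpa using hy
      · rintro ⟨s, h0, h1, rfl⟩
        exact ⟨s n, ih.2 ⟨s, h0, fun i hi => h1 i (by omega), rfl⟩, h1 n (by omega)⟩
  rw [key]
  constructor
  · rintro ⟨s, h0, h1, h2⟩
    have e : ∀ i ≤ n, ((List.range (n + 1)).map s).getD i 0 = s i := by
      intro i hi
      rw [List.getD_eq_getElem _ _ (by simp; omega)]
      simp
    refine ⟨(List.range (n + 1)).map s, by rwa [e 0 (by omega)], fun i hi => ?_,
      by rwa [e n le_rfl]⟩
    rw [e _ hi, e _ hi.le]
    exact h1 i hi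
  · rintro ⟨s, hs⟩
    exact ⟨fun i => s.getD i 0, hs⟩

/-- Induction on how the reduction is generated. Agreement is claimed only at the given `X`, but `G`
is a `Σ⁰₁` predicate of every oracle, so its index can play the part of a functional in the forcing.
-/
theorem sig_graph_of_recursiveIn {X : Set ℕ} {f : ℕ →. ℕ} (hf : Nat.RecursiveIn {chr X} f) :
    ∃ G : ℕ × ℕ → Set ℕ → Prop, Sig G ∧ ∀ x y, y ∈ f x ↔ G (x, y) X := by
  have p1 : Primrec fun x : ℕ × ℕ => x.1 := Primrec.fst
  have p2 : Primrec fun x : ℕ × ℕ => x.2 := Primrec.snd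
  induction hf with
  | zero =>
    refine ⟨_, Sig.pred (PrimrecPred.eq' p2 (Primrec.const 0)), fun x y => ?_⟩
    exact Part.mem_some_iff
  | succ =>
    refine ⟨_, Sig.pred (PrimrecPred.eq' p2 (Primrec.succ.comp p1)), fun x y => ?_⟩
    exact Part.mem_some_iff
  | left =>
    refine ⟨_, Sig.pred (PrimrecPred.eq' p2 (Primrec.unpair1 p1)), fun x y => ?_⟩
    exact Part.mem_some_iff
  | right =>
    refine ⟨_, Sig.pred (PrimrecPred.eq' p2 (Primrec.unpair2 p1)), fun x y => ?_⟩
    exact Part.mem_some_iff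
  | oracle g hg =>
    obtain rfl := Set.mem_singleton_iff.1 hg
    refine ⟨_, ((Sig.mem p1).and (Sig.pred (PrimrecPred.eq' p2 (Primrec.const 1)))).or
      ((Sig.notMem p1).and (Sig.pred (PrimrecPred.eq' p2 (Primrec.const 0)))), fun x y => ?_⟩
    by_cases hx : x ∈ X <;> simp [chr, hx, Part.mem_some_iff]
  | @pair f h _ _ ihf ihh =>
    obtain ⟨F, hF, hF'⟩ := ihf
    obtain ⟨H, hH, hH'⟩ := ihh
    refine ⟨fun x X => ∃ a, (∃ b, (F (x.1, a) X ∧ H (x.1, b) X) ∧ x.2 = Nat.pair a b),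
      Sig.ex (P := fun (x : ℕ × ℕ) a X => ∃ b, (F (x.1, a) X ∧ H (x.1, b) X) ∧ x.2 = Nat.pair a b)
        (Sig.ex (P := fun (x : (ℕ × ℕ) × ℕ) b X =>
          (F (x.1.1, x.2) X ∧ H (x.1.1, b) X) ∧ x.1.2 = Nat.pair x.2 b) ?_), fun x y => ?_⟩
    · have q : Primrec fun x : ((ℕ × ℕ) × ℕ) × ℕ => x.1.1.1 :=
        Primrec.fst.comp (Primrec.fst.comp Primrec.fst)
      have q' : Primrec fun x : ((ℕ × ℕ) × ℕ) × ℕ => x.1.2 := Primrec.snd.comp Primrec.fst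
      refine ((hF.comp (q.pair q')).and (hH.comp (q.pair Primrec.snd))).and (Sig.pred ?_)
      exact PrimrecPred.eq' (Primrec.snd.comp (Primrec.fst.comp Primrec.fst))
        (Primrec.pairNat q' Primrec.snd)
    · simp only [Seq.seq, Part.map_eq_map, Part.mem_bind_iff, Part.mem_map_iff, ← hF', ← hH']
      aesop
  | @comp f h _ _ ihf ihh =>
    obtain ⟨F, hF, hF'⟩ := ihf
    obtain ⟨H, hH, hH'⟩ := ihh
    refine ⟨fun x X => ∃ a, H (x.1, a) X ∧ F (a, x.2) X,
      Sig.ex (P := fun (x : ℕ × ℕ) a X => H (x.1, a) X ∧ F (a, x.2) X) ?_, fun x y => ?_⟩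
    · have q : Primrec fun x : (ℕ × ℕ) × ℕ => x.1.1 := Primrec.fst.comp Primrec.fst
      have q' : Primrec fun x : (ℕ × ℕ) × ℕ => x.1.2 := Primrec.snd.comp Primrec.fst
      exact (hH.comp (q.pair Primrec.snd)).and (hF.comp (Primrec.snd.pair q'))
    · simp only [← hF', ← hH']
      exact Part.mem_bind_iff
  | @prec f h _ _ ihf ihh =>
    obtain ⟨F, hF, hF'⟩ := ihf
    obtain ⟨H, hH, hH'⟩ := ihh
    refine ⟨fun x X => ∃ s : List ℕ, F (x.1.unpair.1, s.getD 0 0) X ∧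
      (∀ i < x.1.unpair.2, H (Nat.pair x.1.unpair.1 (Nat.pair i (s.getD i 0)), s.getD (i + 1) 0) X) ∧
        s.getD x.1.unpair.2 0 = x.2,
      Sig.exCode (P := fun (x : ℕ × ℕ) (s : List ℕ) X => F (x.1.unpair.1, s.getD 0 0) X ∧
      (∀ i < x.1.unpair.2, H (Nat.pair x.1.unpair.1 (Nat.pair i (s.getD i 0)), s.getD (i + 1) 0) X) ∧
        s.getD x.1.unpair.2 0 = x.2) ?_, fun x y => ?_⟩
    · have a : Primrec fun x : (ℕ × ℕ) × List ℕ => x.1.1.unpair.1 :=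
        Primrec.unpair1 (Primrec.fst.comp Primrec.fst)
      have n : Primrec fun x : (ℕ × ℕ) × List ℕ => x.1.1.unpair.2 :=
        Primrec.unpair2 (Primrec.fst.comp Primrec.fst)
      refine (hF.comp (a.pair (Primrec.getD' 0 Primrec.snd (Primrec.const 0)))).and
        (Sig.and (Sig.ball (P := fun (x : (ℕ × ℕ) × List ℕ) i X =>
          H (Nat.pair x.1.1.unpair.1 (Nat.pair i (x.2.getD i 0)), x.2.getD (i + 1) 0) X) ?_ n)
        (Sig.pred (PrimrecPred.eq' (Primrec.getD' 0 Primrec.snd n) (Primrec.snd.comp Primrec.fst))))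
      have s : Primrec fun x : ((ℕ × ℕ) × List ℕ) × ℕ => x.1.2 := Primrec.snd.comp Primrec.fst
      exact hH.comp ((Primrec.pairNat (a.comp Primrec.fst) (Primrec.pairNat Primrec.snd
        (Primrec.getD' 0 s Primrec.snd))).pair (Primrec.getD' 0 s (Primrec.succ.comp Primrec.snd)))
    · simp only [← hF', ← hH']
      exact mem_prec_iff
  | @rfind f _ ihf =>
    obtain ⟨F, hF, hF'⟩ := ihf
    refine ⟨fun x X => F (Nat.pair x.1 x.2, 0) X ∧
      ∀ m < x.2, ∃ z, z ≠ 0 ∧ F (Nat.pair x.1 m, z) X, (hF.comp ?_).and (Sig.ball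
        (P := fun (x : ℕ × ℕ) m X => ∃ z, z ≠ 0 ∧ F (Nat.pair x.1 m, z) X)
        (Sig.ex (P := fun (x : (ℕ × ℕ) × ℕ) z X => z ≠ 0 ∧ F (Nat.pair x.1.1 x.2, z) X) ?_) p2),
      fun x y => ?_⟩
    · exact (Primrec.pairNat p1 p2).pair (Primrec.const 0)
    · refine (Sig.pred (PrimrecPred.eq' Primrec.snd (Primrec.const 0)).not).and
        (hF.comp ((Primrec.pairNat ?_ ?_).pair Primrec.snd))
      · exact Primrec.fst.comp (Primrec.fst.comp Primrec.fst)
      · exact Primrec.snd.comp Primrec.fst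
    · simp only [← hF']
      refine Nat.mem_rfind.trans ?_
      simp only [Part.map_eq_map, Part.mem_map_iff, decide_eq_true_eq, decide_eq_false_iff_not]
      refine and_congr (by simp) ⟨fun h m hm => ?_, fun h m hm => ?_⟩
      · obtain ⟨a, ha, h0⟩ := h hm
        exact ⟨a, h0, ha⟩
      · obtain ⟨a, h0, ha⟩ := h m hm
        exact ⟨a, ha, h0⟩

/-- If `X` computes `Z` then both `Z` and its complement are `Σ⁰₁` in `X`. -/
theorem Computes.exists_sig {X Z : Set ℕ} (h : Computes X Z) :
    ∃ G : ℕ × ℕ → Set ℕ → Prop, Sig G ∧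
      (∀ i, i ∈ Z ↔ G (i, 1) X) ∧ ∀ i, i ∉ Z ↔ G (i, 0) X := by
  obtain ⟨G, hG, hG'⟩ := sig_graph_of_recursiveIn (RecursiveIn.iff_nat.1 h)
  refine ⟨G, hG, fun i => ?_, fun i => ?_⟩ <;> rw [← hG'] <;>
    by_cases hi : i ∈ Z <;> simp [chr, hi, Part.mem_some_iff]

theorem computes_preimage {g : ℕ → ℕ} (hg : Primrec g) (X : Set ℕ) : Computes X {n | g n ∈ X} := by
  refine RecursiveIn.iff_nat.2 ?_
  have h1 := Nat.RecursiveIn.comp (Nat.RecursiveIn.oracle (chr X) (Set.mem_singleton _))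
    ((Primrec.nat_iff.1 hg).recursiveIn (O := {chr X}))
  refine h1.of_eq fun n => ?_
  exact Part.bind_some _ _

theorem computes_column (X : Set ℕ) (e : ℕ) : Computes X (column e X) :=
  computes_preimage (Primrec.pairNat (Primrec.const e) Primrec.id) X

end CantorDyn

/-! ## A `Π⁰₁` class of Scott sets -/

namespace CantorDyn

theorem Sig.resPred {α : Type} [Primcodable α] {R : α → List Bool → Prop}
    (hR : PrimrecPred fun x : α × List Bool => R x.1 x.2) {l : α → ℕ} (hl : Primrec l) :
    Sig fun a X => R a (res X (l a)) :=
  (Sig.strings hR hl (b := fun _ _ => true) (Primrec.const true) (h := fun _ i => i)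
    Primrec.snd).of_iff fun a X => by simp [res]

/-- The set whose columns below `n` are those of `X`, whose column `n` is `A`, and whose other
columns are empty. -/
def glue (n : ℕ) (X A : Set ℕ) : Set ℕ :=
  {i | (i.unpair.1 < n ∧ i ∈ X) ∨ (i.unpair.1 = n ∧ i.unpair.2 ∈ A)}

/-- The set whose columns below `n` are those of `X` and whose other columns are empty. -/
def mask (n : ℕ) (X : Set ℕ) : Set ℕ := {i | i.unpair.1 < n ∧ i ∈ X}

theorem glue_empty (n : ℕ) (X : Set ℕ) : glue n X ∅ = mask n X := by
  ext i; simp [glue, mask]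

theorem glue_column (n : ℕ) (X : Set ℕ) : glue n X (column n X) = mask (n + 1) X := by
  ext i
  simp only [glue, mask, column, Set.mem_ofPred_eq]
  constructor
  · rintro (⟨h, hi⟩ | ⟨h, hi⟩)
    · exact ⟨by omega, hi⟩
    · rw [← h, Nat.pair_unpair] at hi; exact ⟨by omega, hi⟩
  · rintro ⟨h, hi⟩
    rcases Nat.lt_succ_iff_lt_or_eq.1 h with h | h
    · exact Or.inl ⟨h, hi⟩
    · refine Or.inr ⟨h, ?_⟩
      rw [← h, Nat.pair_unpair]; exact hi

theorem glue_mask (n : ℕ) (X A : Set ℕ) : glue n (mask n X) A = glue n X A := by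
  ext i; simp [glue, mask]

theorem glue_glue {N n : ℕ} (h : N ≤ n) (X A B : Set ℕ) : glue N (glue n X A) B = glue N X B := by
  ext i
  simp only [glue, Set.mem_ofPred_eq]
  constructor
  · rintro (⟨h1, h2 | h2⟩ | h1)
    · exact Or.inl ⟨h1, h2.2⟩
    · omega
    · exact Or.inr h1
  · rintro (⟨h1, h2⟩ | h1)
    · exact Or.inl ⟨h1, Or.inl ⟨by omega, h2⟩⟩
    · exact Or.inr h1

@[simp] theorem column_glue_self (n : ℕ) (X A : Set ℕ) : column n (glue n X A) = A := by
  ext i; simp [glue, column]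

theorem column_glue_of_lt {n m : ℕ} (h : m < n) (X A : Set ℕ) :
    column m (glue n X A) = column m X := by
  ext i; simp [glue, column, h, h.ne]

theorem column_mask_of_lt {n m : ℕ} (h : m < n) (X : Set ℕ) :
    column m (mask n X) = column m X := by
  ext i; simp [mask, column, h]

theorem res_glue_congr {n l : ℕ} {X A B : Set ℕ} (h : res A l = res B l) :
    res (glue n X A) l = res (glue n X B) l := by
  rw [res_eq_iff] at h ⊢
  intro i hi
  simp only [glue, Set.mem_ofPred_eq, h _ ((Nat.unpair_right_le i).trans_lt hi)]

/-- The effect of `glue` on strings. -/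
def glueStr (n : ℕ) (τ σ : List Bool) : List Bool :=
  (List.range τ.length).map fun i =>
    if i.unpair.1 < n then τ.getD i false else decide (i.unpair.1 = n) && σ.getD i.unpair.2 false

open Classical in
theorem glueStr_res (n : ℕ) (X A : Set ℕ) (l : ℕ) :
    glueStr n (res X l) (res A l) = res (glue n X A) l := by
  rw [glueStr, res_length]
  unfold res
  refine List.map_congr_left fun i hi => ?_
  have hi := List.mem_range.1 hi
  change (if _ then (res X l).getD i false else _ && (res A l).getD _ false) = _
  rw [res_getD hi, res_getD ((Nat.unpair_right_le i).trans_lt hi)]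
  by_cases h : i.unpair.1 < n
  · rw [if_pos h]
    exact decide_eq_decide.2 (by simp [h, glue, h.ne])
  · rw [if_neg h, ← Bool.decide_and]
    exact decide_eq_decide.2 (by simp [h, glue])

theorem primrec_glueStr {α : Type*} [Primcodable α] {n : α → ℕ} {τ σ : α → List Bool}
    (hn : Primrec n) (hτ : Primrec τ) (hσ : Primrec σ) :
    Primrec fun a => glueStr (n a) (τ a) (σ a) := by
  refine Primrec.mapRange hτ.length' ?_
  have i1 : Primrec fun x : α × ℕ => x.2.unpair.1 := Primrec.unpair1 Primrec.snd
  have hn' := hn.comp (Primrec.fst (α := α) (β := ℕ))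
  refine Primrec.ite (PrimrecPred.natLt i1 hn')
    (Primrec.getD' false (hτ.comp Primrec.fst) Primrec.snd) ?_
  exact Primrec.and.comp (PrimrecPred.eq' i1 hn').decide
    (Primrec.getD' false (hσ.comp Primrec.fst) (Primrec.unpair2 Primrec.snd))

/-- `X` satisfies the `n`-th requirement of a Scott set: if some set avoids the `Σ⁰₁` event with
index `n` relative to the columns of `X` below `n`, then column `n` does. -/
def ScottAt (n : ℕ) (X A : Set ℕ) : Prop :=
  -- Stating the implication separately for each `l` turns the search for `B` into a finite one over
  -- strings of length `l`, so the requirement is `Π⁰₁`. The index contains `n` itself, which lets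
  -- the event refer to column `n`.
  ∀ l, (∃ B, ¬ UnivStage (Nat.pair n.unpair.1 n) (res (glue n X B) l)) →
    ¬ UnivStage (Nat.pair n.unpair.1 n) (res (glue n X A) l)

/-- The class of sets whose columns satisfy all requirements of a Scott set. -/
def IsScott (X : Set ℕ) : Prop := ∀ n, ScottAt n X (column n X)

/-- If avoidance is possible at every length, compactness gives one set avoiding the event forever.
Otherwise a set avoiding it at the last possible length also avoids it at all smaller lengths, and
the larger ones impose nothing. -/
theorem exists_scottAt (n : ℕ) (X : Set ℕ) : ∃ A, ScottAt n X A := by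
  set u := Nat.pair n.unpair.1 n
  have anti : ∀ {l l' : ℕ} {A}, l ≤ l' → ¬ UnivStage u (res (glue n X A) l') →
      ¬ UnivStage u (res (glue n X A) l) := fun hl h h' => h (h'.mono (res_prefix hl))
  by_cases h : ∀ l, ∃ B, ¬ UnivStage u (res (glue n X B) l)
  · obtain ⟨A, hA⟩ := exists_path_of_infinite
      {σ | ¬ UnivStage u (res (glue n X (ofStr σ)) σ.length)} (fun σ τ hστ hτ hσ => by
        refine hτ (hσ.mono ?_)
        have e : res (ofStr σ) σ.length = res (ofStr τ) σ.length := by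
          rw [res_ofStr, ← eq_res_of_prefix (l := τ.length)]
          rwa [res_ofStr]
        rw [res_glue_congr e]
        exact res_prefix hστ.length_le) (fun l => by
        obtain ⟨B, hB⟩ := h l
        refine ⟨res B l, ?_, by simp⟩
        simp only [Set.mem_ofPred_eq, res_length]
        rwa [res_glue_congr (B := B)]
        have := res_ofStr (res B l)
        rwa [res_length] at this)
    refine ⟨A, fun l _ => ?_⟩
    have := hA l
    simp only [Set.mem_ofPred_eq, res_length] at this
    rwa [res_glue_congr (B := A)] at this
    have := res_ofStr (res A l)
    rwa [res_length] at this
  · push Not at h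
    classical
    have hmin := fun {m} => Nat.find_min h (m := m)
    have hspec := Nat.find_spec h
    rcases Nat.eq_zero_or_pos (Nat.find h) with h0 | h0
    -- Avoidance fails already at length `0`, so the requirement is vacuous and any set will do.
    · refine ⟨∅, fun l ⟨B, hB⟩ => absurd (hspec B) (anti (by omega) hB)⟩
    · obtain ⟨A, hA⟩ := not_forall.1 (hmin (Nat.sub_lt h0 one_pos))
      refine ⟨A, fun l ⟨B, hB⟩ => anti (l' := Nat.find h - 1) ?_ hA⟩
      by_contra hl
      exact anti (l := Nat.find h) (by omega) hB (hspec B)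

/-- Each requirement involves only columns up to its own number, so the columns can be chosen one
after another. -/
theorem exists_isScott : ∃ X, IsScott X := by
  choose sel hsel using exists_scottAt
  let B : ℕ → Set ℕ := fun n => Nat.rec ∅ (fun n B => glue n B (sel n B)) n
  have hB : ∀ n, B (n + 1) = glue n (B n) (sel n (B n)) := fun n => rfl
  let X : Set ℕ := {i | i ∈ B (i.unpair.1 + 1)}
  have hm : ∀ n, mask n X = B n := by
    intro n
    induction n with
    | zero => ext i; simp [mask, B]
    | succ n ih =>
      rw [hB]
      nth_rw 1 [← ih]
      rw [glue_mask]
      ext i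
      simp only [mask, glue, Set.mem_ofPred_eq]
      constructor
      · rintro ⟨h, hi⟩
        rcases Nat.lt_succ_iff_lt_or_eq.1 h with h | h
        · exact Or.inl ⟨h, hi⟩
        · change i ∈ B (i.unpair.1 + 1) at hi
          rw [h, hB] at hi
          exact hi.imp (fun h' => absurd h'.1 (by omega)) id
      · rintro (⟨h, hi⟩ | ⟨h, hi⟩)
        · exact ⟨by omega, hi⟩
        · refine ⟨by omega, ?_⟩
          change i ∈ B (i.unpair.1 + 1)
          rw [h, hB]
          exact Or.inr ⟨h, hi⟩
  refine ⟨X, fun n => ?_⟩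
  have : column n X = sel n (B n) := by
    rw [← column_mask_of_lt (Nat.lt_succ_self n), Nat.succ_eq_add_one, hm, hB, column_glue_self]
  have h2 := hsel n (B n)
  rw [this]
  intro l
  have h3 := h2 l
  simpa only [← hm n, glue_mask] using h3

/-- A failure shows at one `n` and one `l`: a string of length `l` avoids the event while the
columns of `X` do not, which is decidable from `res X l`. -/
theorem sig_not_isScott : Sig fun (_ : ℕ) X => ¬ IsScott X := by
  let R : ℕ × ℕ → List Bool → Prop := fun x τ =>
    (∃ σ ∈ allStrings x.2, ¬ UnivStage (Nat.pair x.1.unpair.1 x.1) (glueStr x.1 τ σ)) ∧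
      -- Gluing an empty column at `n + 1` keeps columns `0` to `n` of `τ`, so that column `n` of
      -- `X` is the candidate under test.
      UnivStage (Nat.pair x.1.unpair.1 x.1) (glueStr (x.1 + 1) τ [])
  have hu : Primrec fun x : ℕ × ℕ => Nat.pair x.1.unpair.1 x.1 :=
    Primrec.pairNat (Primrec.unpair1 Primrec.fst) Primrec.fst
  have hR : PrimrecPred fun x : (ℕ × ℕ) × List Bool => R x.1 x.2 := by
    refine (PrimrecPred.bexList (p := fun (x : (ℕ × ℕ) × List Bool) σ =>
      ¬ UnivStage (Nat.pair x.1.1.unpair.1 x.1.1) (glueStr x.1.1 x.2 σ)) ?_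
      (primrec_allStrings.comp (Primrec.snd.comp Primrec.fst))).and ?_
    · have f := Primrec.fst (α := (ℕ × ℕ) × List Bool) (β := List Bool)
      exact (primrec_univStage.comp ((hu.comp (Primrec.fst.comp f)).pair
        (primrec_glueStr (Primrec.fst.comp (Primrec.fst.comp f)) (Primrec.snd.comp f)
          Primrec.snd))).not
    · exact primrec_univStage.comp ((hu.comp Primrec.fst).pair
        (primrec_glueStr (Primrec.succ.comp (Primrec.fst.comp Primrec.fst)) Primrec.snd
          (Primrec.const [])))
  refine (Sig.ex (P := fun (_ : ℕ) n X => ∃ l, R (n, l) (res X l))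
    (Sig.ex (P := fun (x : ℕ × ℕ) l X => R (x.2, l) (res X l)) ?_)).of_iff fun _ X => ?_
  · exact (Sig.resPred hR Primrec.snd).comp
      (f := fun x : (ℕ × ℕ) × ℕ => (x.1.2, x.2))
      ((Primrec.snd.comp Primrec.fst).pair Primrec.snd)
  · simp only [IsScott, ScottAt, not_forall, not_not, exists_prop]
    refine exists_congr fun n => exists_congr fun l => and_congr ?_ ?_
    · constructor
      · rintro ⟨B, hB⟩
        refine ⟨res B l, mem_allStrings.2 (by simp), ?_⟩
        rwa [glueStr_res]
      · rintro ⟨σ, hσ, h⟩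
        refine ⟨ofStr σ, ?_⟩
        have hl : σ.length = l := mem_allStrings.1 hσ
        have hr := res_ofStr σ
        rw [hl] at hr
        rw [← glueStr_res, hr]
        exact h
    · have : glueStr (n + 1) (res X l) [] = res (glue (n + 1) X ∅) l := by
        rw [← glueStr_res]
        refine List.map_congr_left fun i hi => ?_
        rw [res_length] at hi
        rw [res_getD ((Nat.unpair_right_le i).trans_lt (List.mem_range.1 hi))]
        simp
      dsimp only
      rw [glue_column, this, glue_empty]

/-- The columns of `X`. -/
def columns (X : Set ℕ) : Set (Set ℕ) := Set.range fun n => column n X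

theorem sig_glue {α : Type} [Primcodable α] {P : α → Set ℕ → Prop} (hP : Sig P) {N n : α → ℕ}
    (hN : Primrec N) (hn : Primrec n) :
    Sig fun a X => P a (glue (N a) X (column (n a) X)) := by
  have hN' := hN.comp (Primrec.fst (α := α) (β := ℕ))
  have hn' := hn.comp (Primrec.fst (α := α) (β := ℕ))
  have i1 : Primrec fun x : α × ℕ => x.2.unpair.1 := Primrec.unpair1 Primrec.snd
  refine (hP.subst (b := fun a i => decide (i.unpair.1 ≤ N a))
    (PrimrecPred.natLe i1 hN').decide
    (h := fun a i => if i.unpair.1 < N a then i else Nat.pair (n a) i.unpair.2)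
    (Primrec.ite (PrimrecPred.natLt i1 hN') Primrec.snd
      (Primrec.pairNat hn' (Primrec.unpair2 Primrec.snd)))).of_iff fun a X => ?_
  have : glue (N a) X (column (n a) X) = {i | decide (i.unpair.1 ≤ N a) = true ∧
      (if i.unpair.1 < N a then i else Nat.pair (n a) i.unpair.2) ∈ X} := by
    ext i
    simp only [glue, column, Set.mem_ofPred_eq, decide_eq_true_eq]
    rcases lt_trichotomy i.unpair.1 (N a) with h | h | h
    · simp [h, h.le, h.ne]
    · simp [h]
    · simp [h.not_gt, h.not_ge, h.ne']
  rw [this]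

theorem sig_mask {α : Type} [Primcodable α] {P : α → Set ℕ → Prop} (hP : Sig P) {N : α → ℕ}
    (hN : Primrec N) : Sig fun a X => P a (mask (N a) X) := by
  refine (hP.subst (b := fun a i => decide (i.unpair.1 < N a))
    (PrimrecPred.natLt (Primrec.unpair1 Primrec.snd) (hN.comp Primrec.fst)).decide
    (h := fun a i => i) Primrec.snd).of_iff fun a X => ?_
  simp [mask]

/-- Let `c` be an index, uniform in `n`, of the event that `P` holds of the columns below `N`
together with column `n`. Requirement `n = Nat.pair c N` is then about `P`, and `N ≤ n` ensures that
the columns below `N` are visible to it. -/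
theorem IsScott.exists_column {X : Set ℕ} (hX : IsScott X) {P : Set ℕ → Prop}
    (hP : Sig fun (_ : ℕ) X => P X) (N : ℕ) (h : ∃ A, ¬ P (glue N X A)) :
    ∃ n, ¬ P (glue N X (column n X)) := by
  obtain ⟨A, hA⟩ := h
  obtain ⟨c, hc⟩ := (sig_glue hP (Primrec.const N) (Primrec.id (α := ℕ))).exists_code
  simp only [id] at hc
  have hn : N ≤ Nat.pair c N := Nat.right_le_pair c N
  set n := Nat.pair c N
  refine ⟨n, fun hcon => ?_⟩
  have hcn : n.unpair.1 = c := by simp [n]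
  have h1 : ¬ Univ (Nat.pair c n) (glue n X A) := by
    rw [← hc, column_glue_self, glue_glue hn]; exact hA
  have h2 : Univ (Nat.pair c n) (glue n X (column n X)) := by
    rw [← hc, column_glue_self, glue_glue hn]; exact hcon
  obtain ⟨l, hl⟩ := h2
  have := hX n l
  rw [hcn] at this
  exact this ⟨A, fun h' => h1 ⟨l, h'⟩⟩ hl

/-- The wanted set is the only one avoiding the event that column `N` is wrong at some `m`; this
event is `Σ⁰₁` because `P` and `Q` are. -/
theorem IsScott.exists_column_eq {X : Set ℕ} (hX : IsScott X) {P Q : ℕ → Set ℕ → Prop}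
    (hP : Sig P) (hQ : Sig Q) (N : ℕ) (h : ∀ m, P m (mask N X) ↔ ¬ Q m (mask N X)) :
    ∃ n, column n X = {m | P m (mask N X)} := by
  have hs : Sig fun (_ : ℕ) W => ∃ m, (Nat.pair N m ∈ W ∧ Q m (mask N W)) ∨
      (Nat.pair N m ∉ W ∧ P m (mask N W)) := by
    refine Sig.ex (P := fun _ m W => (Nat.pair N m ∈ W ∧ Q m (mask N W)) ∨
      (Nat.pair N m ∉ W ∧ P m (mask N W))) ?_
    have p : Primrec fun x : ℕ × ℕ => Nat.pair N x.2 := Primrec.pairNat (Primrec.const N) Primrec.snd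
    exact ((Sig.mem p).and ((sig_mask hQ (Primrec.const N)).comp Primrec.snd)).or
      ((Sig.notMem p).and ((sig_mask hP (Primrec.const N)).comp Primrec.snd))
  have e : ∀ A m, (Nat.pair N m ∈ glue N X A ↔ m ∈ A) := fun A m => by simp [glue]
  have e2 : ∀ A, mask N (glue N X A) = mask N X := fun A => by
    rw [← glue_empty, glue_glue le_rfl, glue_empty]
  obtain ⟨n, hn⟩ := hX.exists_column hs N ⟨{m | P m (mask N X)}, by
    simp only [e, e2, Set.mem_ofPred_eq]
    rintro ⟨m, ⟨h1, h2⟩ | ⟨h1, h2⟩⟩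
    · exact (h m).1 h1 h2
    · exact h1 h2⟩
  refine ⟨n, ?_⟩
  simp only [e, e2] at hn
  push Not at hn
  ext m
  simp only [Set.mem_ofPred_eq]
  have := hn m
  rw [h m]
  constructor
  · exact fun hm => (hn m).1 hm
  · intro hq
    by_contra hm
    exact (hn m).2 hm ((h m).2 hq)

end CantorDyn

/-! ## Forcing with `Π⁰₁` classes -/

namespace CantorDyn

/-- Either `X` lies in the `Σ⁰₁` class with index `u`, or the functional with index `c` applied to
`X` has an output whose column `e` does not start with `1 ^ j 0`; here `e` codes `c` and `u`. -/
def Conflict (x : ℕ × ℕ) (X : Set ℕ) : Prop :=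
  (Univ x.1.unpair.2 X ∨ ∃ i < x.2, Univ (Nat.pair x.1.unpair.1 (Nat.pair (Nat.pair x.1 i) 0)) X) ∨
    Univ (Nat.pair x.1.unpair.1 (Nat.pair (Nat.pair x.1 x.2) 1)) X

theorem sig_conflict : Sig Conflict := by
  have c : Primrec fun x : ℕ × ℕ => x.1.unpair.1 := Primrec.unpair1 Primrec.fst
  refine ((sig_univ.comp (Primrec.unpair2 Primrec.fst)).or (Sig.bex
    (P := fun (x : ℕ × ℕ) i X => Univ (Nat.pair x.1.unpair.1 (Nat.pair (Nat.pair x.1 i) 0)) X)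
    (sig_univ.comp ?_) Primrec.snd)).or (sig_univ.comp ?_)
  · exact Primrec.pairNat (c.comp Primrec.fst) (Primrec.pairNat
      (Primrec.pairNat (Primrec.fst.comp Primrec.fst) Primrec.snd) (Primrec.const 0))
  · exact Primrec.pairNat c (Primrec.pairNat
      (Primrec.pairNat Primrec.fst Primrec.snd) (Primrec.const 1))

/-- By compactness, a `Σ⁰₁` class that covers Cantor space is seen to cover it at a finite stage,
when all strings of one length are accepted. -/
theorem exists_event : ∃ ev : ℕ → ℕ → ℕ → Prop,
    (PrimrecPred fun x : ℕ × ℕ × ℕ => ev x.1 x.2.1 x.2.2) ∧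
    (∀ e j s t, s ≤ t → ev e j s → ev e j t) ∧
    ∀ e j, (∃ t, ev e j t) ↔ ∀ X, Conflict (e, j) X := by
  obtain ⟨R, hR, hm, h⟩ := sig_conflict
  refine ⟨fun e j t => ∀ σ ∈ allStrings t, R (e, j) σ, ?_, ?_, fun e j => ⟨?_, ?_⟩⟩
  · refine PrimrecPred.ballList (p := fun (x : ℕ × ℕ × ℕ) σ => R (x.1, x.2.1) σ) ?_
      (primrec_allStrings.comp (Primrec.snd.comp Primrec.snd))
    have f : Primrec fun x : (ℕ × ℕ × ℕ) × List Bool => x.1 := Primrec.fst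
    exact hR.comp (((Primrec.fst.comp f).pair (Primrec.fst.comp (Primrec.snd.comp f))).pair
      Primrec.snd)
  · intro e j s t hst hs σ hσ
    refine hm _ _ _ (List.take_prefix s σ) (hs _ (mem_allStrings.2 ?_))
    rw [List.length_take, mem_allStrings.1 hσ, min_eq_left hst]
  · rintro ⟨t, ht⟩ X
    exact (h _ _).2 ⟨t, ht _ (mem_allStrings.2 (res_length X t))⟩
  · intro hX
    by_contra! hcon
    obtain ⟨X, hX'⟩ := exists_path_of_infinite {σ | ¬ R (e, j) σ}
      (fun σ τ hστ hτ hσ => hτ (hm _ _ _ hστ hσ))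
      (fun l => by
        obtain ⟨σ, hσ, h'⟩ := hcon l
        exact ⟨σ, h', mem_allStrings.1 hσ⟩)
    obtain ⟨s, hs⟩ := (h _ _).1 (hX X)
    exact hX' s hs

/-- The events used in the construction of the computable product of shift systems. -/
def event : ℕ → ℕ → ℕ → Prop := exists_event.choose

theorem primrec_event : PrimrecPred fun x : ℕ × ℕ × ℕ => event x.1 x.2.1 x.2.2 :=
  exists_event.choose_spec.1

theorem event_mono (e j s t : ℕ) : s ≤ t → event e j s → event e j t :=
  exists_event.choose_spec.2.1 e j s t

theorem exists_event_iff (e j : ℕ) : (∃ t, event e j t) ↔ ∀ X, Conflict (e, j) X :=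
  exists_event.choose_spec.2.2 e j

/-- The tree of a computable product of shift systems all of whose almost periodic points are hard
to compute. -/
def hardTree : Set (List Bool) := prodTree fun e => evTree (event e)

theorem evTree_event_isSystem (e : ℕ) : IsSystem (evTree (event e)) List.tail :=
  evTree_isSystem (event_mono e)

theorem primrec_evTree_event : PrimrecPred fun x : ℕ × List Bool => x.2 ∈ evTree (event x.1) :=
  primrec_evTree primrec_event

/-- The dichotomy for column `e = Nat.pair c u`. If event `j` never happens, pass to the nonempty
class without a conflict at `j`: there a correct output has a column starting with `1 ^ j 0`, hence
not almost periodic. Otherwise keep the class: each point of the subshift starts with some `1 ^ j 0`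
for which every oracle conflicts, and an oracle in the class can do so only through an output
contradicting that start. -/
theorem forcing_step (c u : ℕ) (hu : ∃ X, ¬ Univ u X) :
    ∃ u', (∃ X, ¬ Univ u' X) ∧ (∀ X, ¬ Univ u' X → ¬ Univ u X) ∧
      ∀ X, ¬ Univ u' X → ∀ Z, IsAlmostPeriodic hardTree shiftCols Z →
        ¬ ∀ i, (i ∈ Z ↔ Univ (Nat.pair c (Nat.pair i 1)) X) ∧
          (i ∉ Z ↔ Univ (Nat.pair c (Nat.pair i 0)) X) := by
  set e := Nat.pair c u
  have hZ : ∀ Z, IsAlmostPeriodic hardTree shiftCols Z → column e Z ∈ paths (evTree (event e)) :=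
    fun Z h => (mem_paths_prodTree (fun e => (evTree_event_isSystem e).tree) Z).1 h.1 e
  rcases evTree_dichotomy (event_mono e) with ⟨j, hj, hY⟩ | hY
  · rw [exists_event_iff] at hj
    obtain ⟨u', hu'⟩ := (sig_conflict.comp (Primrec.const (α := ℕ) (e, j))).exists_index
    have hc : ∀ X, Univ u' X ↔ (Univ u X ∨
        ∃ i < j, Univ (Nat.pair c (Nat.pair (Nat.pair e i) 0)) X) ∨
        Univ (Nat.pair c (Nat.pair (Nat.pair e j) 1)) X := fun X => by
      rw [← hu' X, Conflict]; simp [e]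
    refine ⟨u', ?_, fun X hX h => hX ((hc X).2 (Or.inl (Or.inl h))), fun X hX Z hAP hf => ?_⟩
    · simpa only [hu', not_forall] using hj
    · refine hY _ (hZ Z hAP) ⟨fun i hi => ?_, fun hj' => ?_⟩ (shiftAP_column hAP e)
      · by_contra hi'
        exact hX ((hc X).2 (Or.inl (Or.inr ⟨i, hi, (hf _).2.1 hi'⟩)))
      · exact hX ((hc X).2 (Or.inr ((hf _).1.1 hj')))
  · refine ⟨u, hu, fun _ h => h, fun X hX Z hAP hf => ?_⟩
    obtain ⟨j, hj, hs1, hs2⟩ := hY _ (hZ Z hAP)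
    have := (exists_event_iff e j).1 hj X
    simp only [Conflict, e, Nat.unpair_pair] at this
    rcases this with (h | ⟨i, hi, h⟩) | h
    · exact hX h
    · exact (hf _).2.2 h (hs1 i hi)
    · exact hs2 ((hf _).1.2 h)

/-- Step `c` defeats functional `c`; compactness gives a member of the intersection of the
decreasing nonempty classes. -/
theorem exists_not_computes (u₀ : ℕ) (h₀ : ∃ X, ¬ Univ u₀ X) :
    ∃ X, ¬ Univ u₀ X ∧ ∀ Z, IsAlmostPeriodic hardTree shiftCols Z → ¬ Computes X Z := by
  choose next hn1 hn2 hn3 using forcing_step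
  let q : ℕ → {u // ∃ X, ¬ Univ u X} := fun n =>
    Nat.rec ⟨u₀, h₀⟩ (fun c u => ⟨next c u.1 u.2, hn1 c u.1 u.2⟩) n
  have hq : ∀ c, (q (c + 1)).1 = next c (q c).1 (q c).2 := fun c => rfl
  have hanti : ∀ {c d X}, c ≤ d → ¬ Univ (q d).1 X → ¬ Univ (q c).1 X := by
    intro c d X hcd
    induction d, hcd using Nat.le_induction with
    | base => exact id
    | succ d _ ih => exact fun h => ih (hn2 d _ _ _ (hq d ▸ h))
  -- Strings of length `l` are tested against the first `l` classes only, all of which contain class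
  -- `l`.
  obtain ⟨X, hX⟩ := exists_path_of_infinite {σ | ∀ c < σ.length, ¬ UnivStage (q c).1 σ}
    (fun σ τ hστ hτ c hc h => hτ c (hc.trans_le hστ.length_le) (h.mono hστ))
    (fun l => by
      obtain ⟨X, hX⟩ := (q l).2
      refine ⟨res X l, fun c hc h => ?_, res_length X l⟩
      exact hanti (by simpa using hc.le) hX ⟨l, h⟩)
  have hX' : ∀ c, ¬ Univ (q c).1 X := by
    rintro c ⟨s, hs⟩
    exact hX (max s (c + 1)) c (by simp) (hs.mono (res_prefix (le_max_left _ _)))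
  refine ⟨X, hX' 0, fun Z hZ hc => ?_⟩
  obtain ⟨G, hG, hG1, hG0⟩ := hc.exists_sig
  obtain ⟨c, hc⟩ := (hG.comp Primrec.unpair).exists_code
  refine hn3 c _ (q c).2 X (hq c ▸ hX' (c + 1)) Z hZ fun i => ?_
  rw [← hc, ← hc, Nat.unpair_pair, Nat.unpair_pair]
  exact ⟨hG1 i, hG0 i⟩

end CantorDyn

/-! ## Structures for second-order arithmetic and soundness -/

namespace SOA

/-- A structure for the language of second-order arithmetic. -/
structure Model where
  Dom : Type
  zero : Dom
  one : Dom
  add : Dom → Dom → Dom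
  mul : Dom → Dom → Dom
  lt : Dom → Dom → Prop
  sets : Set (Set Dom)

namespace Model

variable (M : Model)

/-- The value of a term. -/
def val (e : ℕ → M.Dom) : Term → M.Dom
  | Term.var i => e i
  | Term.zero => M.zero
  | Term.one => M.one
  | Term.add s t => M.add (val e s) (val e t)
  | Term.mul s t => M.mul (val e s) (val e t)

/-- Satisfaction of a formula. -/
def Holds : (ℕ → M.Dom) → (ℕ → Set M.Dom) → Form → Prop
  | e, _, Form.eq s t => M.val e s = M.val e t
  | e, _, Form.lt s t => M.lt (M.val e s) (M.val e t)
  | e, E, Form.mem t i => M.val e t ∈ E i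
  | _, _, Form.bot => False
  | e, E, Form.imp φ ψ => Holds e E φ → Holds e E ψ
  | e, E, Form.allN φ => ∀ d, Holds (push d e) E φ
  | e, E, Form.allS φ => ∀ A ∈ M.sets, Holds e (push A E) φ

variable {M}

theorem val_subst (e : ℕ → M.Dom) (σ : ℕ → Term) (t : Term) :
    M.val e (t.subst σ) = M.val (fun i => M.val e (σ i)) t := by
  induction t with
  | var i => rfl
  | zero => rfl
  | one => rfl
  | add s t hs ht => simp only [Term.subst, val, hs, ht]
  | mul s t hs ht => simp only [Term.subst, val, hs, ht]

theorem val_up (e : ℕ → M.Dom) (d : M.Dom) (t : Term) : M.val (push d e) t.up = M.val e t := by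
  rw [Term.up, val_subst]; rfl

theorem holds_subst (φ : Form) (e : ℕ → M.Dom) (E : ℕ → Set M.Dom) (σ : ℕ → Term) (ρ : ℕ → ℕ) :
    M.Holds e E (φ.subst σ ρ) ↔ M.Holds (fun i => M.val e (σ i)) (fun i => E (ρ i)) φ := by
  induction φ generalizing e E σ ρ with
  | eq s t => simp only [Form.subst, Holds, val_subst]
  | lt s t => simp only [Form.subst, Holds, val_subst]
  | mem t i => simp only [Form.subst, Holds, val_subst]
  | bot => rfl
  | imp φ ψ hφ hψ => simp only [Form.subst, Holds, hφ, hψ]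
  | allN φ ih =>
    simp only [Form.subst, Holds, ih]
    refine forall_congr' fun d => ?_
    have : (fun i => M.val (push d e) (liftN σ i)) = push d fun i => M.val e (σ i) := by
      funext i
      cases i with
      | zero => rfl
      | succ i => exact val_up e d (σ i)
    rw [this]
  | allS φ ih =>
    simp only [Form.subst, Holds, ih]
    refine forall₂_congr fun A _ => ?_
    have : (fun i => push A E (liftS ρ i)) = push A fun i => E (ρ i) := by
      funext i
      cases i <;> rfl
    rw [this]

theorem holds_upN (φ : Form) (e : ℕ → M.Dom) (E : ℕ → Set M.Dom) (d : M.Dom) :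
    M.Holds (push d e) E φ.upN ↔ M.Holds e E φ := by
  rw [Form.upN, holds_subst]; rfl

theorem holds_upS (φ : Form) (e : ℕ → M.Dom) (E : ℕ → Set M.Dom) (A : Set M.Dom) :
    M.Holds e (push A E) φ.upS ↔ M.Holds e E φ := by
  rw [Form.upS, holds_subst]; rfl

theorem holds_instN (φ : Form) (e : ℕ → M.Dom) (E : ℕ → Set M.Dom) (t : Term) :
    M.Holds e E (φ.instN t) ↔ M.Holds (push (M.val e t) e) E φ := by
  rw [Form.instN, holds_subst]
  have : (fun i => M.val e (push t Term.var i)) = push (M.val e t) e := by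
    funext i; cases i <;> rfl
  rw [this]; rfl

theorem holds_instS (φ : Form) (e : ℕ → M.Dom) (E : ℕ → Set M.Dom) (j : ℕ) :
    M.Holds e E (φ.instS j) ↔ M.Holds e (push (E j) E) φ := by
  rw [Form.instS, holds_subst]
  have : (fun i => E (push j id i)) = push (E j) E := by
    funext i; cases i <;> rfl
  rw [this]; rfl

theorem holds_succ (φ : Form) (e : ℕ → M.Dom) (E : ℕ → Set M.Dom) (d : M.Dom) :
    M.Holds (push d e) E φ.succ ↔ M.Holds (push (M.add d M.one) e) E φ := by
  rw [Form.succ, holds_subst]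
  have : (fun i => M.val (push d e) (push (Term.var 0 + 1) (fun i => Term.var (i + 1)) i)) =
      push (M.add d M.one) e := by
    funext i
    cases i with
    | zero => rfl
    | succ i => rfl
  rw [this]; rfl

@[simp] theorem holds_neg (φ : Form) (e : ℕ → M.Dom) (E : ℕ → Set M.Dom) :
    M.Holds e E φ.neg ↔ ¬ M.Holds e E φ := Iff.rfl

@[simp] theorem holds_and (φ ψ : Form) (e : ℕ → M.Dom) (E : ℕ → Set M.Dom) :
    M.Holds e E (φ ⩓ ψ) ↔ M.Holds e E φ ∧ M.Holds e E ψ := by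
  simp only [Form.and, holds_neg, Holds]; tauto

@[simp] theorem holds_or (φ ψ : Form) (e : ℕ → M.Dom) (E : ℕ → Set M.Dom) :
    M.Holds e E (φ ⩔ ψ) ↔ M.Holds e E φ ∨ M.Holds e E ψ := by
  simp only [Form.or, holds_neg, Holds]; tauto

@[simp] theorem holds_iff (φ ψ : Form) (e : ℕ → M.Dom) (E : ℕ → Set M.Dom) :
    M.Holds e E (φ ⇿ ψ) ↔ (M.Holds e E φ ↔ M.Holds e E ψ) := by
  simp only [Form.iff, holds_and, Holds]; tauto

theorem push_mem {S : Set (Set M.Dom)} {A : Set M.Dom} {E : ℕ → Set M.Dom} (hA : A ∈ S)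
    (hE : ∀ i, E i ∈ S) (i : ℕ) : push A E i ∈ S := by
  cases i
  · exact hA
  · exact hE _

/-- Arbitrary structures are allowed because consistency with `PA` is shown below through possibly
nonstandard models. -/
theorem soundness {T : Set Form} (hT : ∀ φ ∈ T, ∀ e E, (∀ i, E i ∈ M.sets) → M.Holds e E φ)
    {Γ : List Form} {φ : Form} (h : Derives T Γ φ) (e : ℕ → M.Dom) (E : ℕ → Set M.Dom)
    (hE : ∀ i, E i ∈ M.sets) (hΓ : ∀ ψ ∈ Γ, M.Holds e E ψ) : M.Holds e E φ := by
  induction h generalizing e E with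
  | ax h => exact hT _ h _ _ hE
  | hyp h => exact hΓ _ h
  | impI _ ih =>
    intro hφ
    exact ih e E hE (by simpa using ⟨hφ, hΓ⟩)
  | impE _ _ ih1 ih2 => exact ih1 e E hE hΓ (ih2 e E hE hΓ)
  | raa _ ih =>
    by_contra hn
    exact ih e E hE (by simpa using ⟨hn, hΓ⟩)
  | allNI _ ih =>
    intro d
    refine ih _ E hE fun ψ hψ => ?_
    obtain ⟨χ, hχ, rfl⟩ := List.mem_map.1 hψ
    exact (holds_upN _ _ _ _).2 (hΓ χ hχ)
  | allNE t _ ih => exact (holds_instN _ _ _ _).2 (ih e E hE hΓ _)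
  | allSI _ ih =>
    intro A hA
    refine ih e _ (push_mem hA hE) fun ψ hψ => ?_
    obtain ⟨χ, hχ, rfl⟩ := List.mem_map.1 hψ
    exact (holds_upS _ _ _ _).2 (hΓ χ hχ)
  | allSE j _ ih => exact (holds_instS _ _ _ _).2 (ih e E hE hΓ _ (hE j))
  | eqI t => rfl
  | eqE _ _ ih1 ih2 =>
    have h1 := ih1 e E hE hΓ
    have h2 := (holds_instN _ _ _ _).1 (ih2 e E hE hΓ)
    rw [show M.val e _ = M.val e _ from h1] at h2
    exact (holds_instN _ _ _ _).2 h2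

end Model

/-- The `ω`-structure with the given sets. -/
def omegaModel (S : Set (Set ℕ)) : Model where
  Dom := ℕ
  zero := 0
  one := 1
  add := (· + ·)
  mul := (· * ·)
  lt := (· < ·)
  sets := S

theorem omegaModel_val (S : Set (Set ℕ)) (e : ℕ → ℕ) (t : Term) :
    (omegaModel S).val e t = t.val e := by
  induction t with
  | var i => rfl
  | zero => rfl
  | one => rfl
  | add s t hs ht => exact congrArg₂ (· + ·) hs ht
  | mul s t hs ht => exact congrArg₂ (· * ·) hs ht

theorem omegaModel_holds (S : Set (Set ℕ)) (φ : Form) (e : ℕ → ℕ) (E : ℕ → Set ℕ) :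
    (omegaModel S).Holds e E φ ↔ Sat S e E φ := by
  induction φ generalizing e E with
  | eq s t => exact Eq.congr (omegaModel_val S e s) (omegaModel_val S e t)
  | lt s t =>
    change (_ : ℕ) < _ ↔ _
    rw [omegaModel_val, omegaModel_val]; rfl
  | mem t i =>
    change (_ : ℕ) ∈ E i ↔ _
    rw [omegaModel_val]; rfl
  | bot => rfl
  | imp φ ψ hφ hψ => exact imp_congr (hφ e E) (hψ e E)
  | allN φ ih => exact forall_congr' fun n => ih (push n e) E
  | allS φ ih => exact forall₂_congr fun A _ => ih e (push A E)

section

variable {S : Set (Set ℕ)} {e : ℕ → ℕ} {E : ℕ → Set ℕ}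

@[simp] theorem sat_neg {φ : Form} : Sat S e E φ.neg ↔ ¬ Sat S e E φ := Iff.rfl

@[simp] theorem sat_and {φ ψ : Form} : Sat S e E (φ ⩓ ψ) ↔ Sat S e E φ ∧ Sat S e E ψ := by
  simp only [Form.and, sat_neg, Sat]; tauto

@[simp] theorem sat_or {φ ψ : Form} : Sat S e E (φ ⩔ ψ) ↔ Sat S e E φ ∨ Sat S e E ψ := by
  simp only [Form.or, sat_neg, Sat]; tauto

@[simp] theorem sat_iff {φ ψ : Form} : Sat S e E (φ ⇿ ψ) ↔ (Sat S e E φ ↔ Sat S e E ψ) := by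
  simp only [Form.iff, sat_and, Sat]; tauto

@[simp] theorem sat_exN {φ : Form} : Sat S e E φ.exN ↔ ∃ n, Sat S (push n e) E φ := by
  simp only [Form.exN, sat_neg, Sat, not_forall, not_not]

@[simp] theorem sat_exS {φ : Form} : Sat S e E φ.exS ↔ ∃ A ∈ S, Sat S e (push A E) φ := by
  simp only [Form.exS, sat_neg, Sat, not_forall, not_not, exists_prop]

@[simp] theorem val_up (t : Term) (n : ℕ) : t.up.val (push n e) = t.val e := by
  exact (omegaModel_val ∅ (push n e) t.up).symm.trans
    ((Model.val_up (M := omegaModel ∅) e n t).trans (omegaModel_val ∅ e t))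

theorem sat_instN {φ : Form} {t : Term} :
    Sat S e E (φ.instN t) ↔ Sat S (push (t.val e) e) E φ := by
  have := Model.holds_instN (M := omegaModel S) φ e E t
  rw [omegaModel_holds, omegaModel_val] at this
  exact this.trans (omegaModel_holds _ _ _ _)

theorem sat_succ {φ : Form} {n : ℕ} :
    Sat S (push n e) E φ.succ ↔ Sat S (push (n + 1) e) E φ :=
  (omegaModel_holds S _ _ _).symm.trans
    ((Model.holds_succ (M := omegaModel S) φ e E n).trans (omegaModel_holds S _ _ _))

theorem sat_upS {φ : Form} {A : Set ℕ} : Sat S e (push A E) φ.upS ↔ Sat S e E φ :=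
  (omegaModel_holds S _ _ _).symm.trans
    ((Model.holds_upS (M := omegaModel S) φ e E A).trans (omegaModel_holds S _ _ _))

end

theorem trueIn_of_proves {S : Set (Set ℕ)} {T : Set Form} (hS : ∀ φ ∈ T, TrueIn S φ) {φ : Form}
    (h : Proves T φ) : TrueIn S φ := by
  intro e E hE
  rw [← omegaModel_holds]
  exact Model.soundness (M := omegaModel S)
    (fun ψ hψ e E hE => (omegaModel_holds S ψ e E).2 (hS ψ hψ e E hE)) h e E hE (by simp)

end SOA

/-! ## Coding of binary strings by numbers -/

namespace SOA

/-- The pairing function `(a, b) = (a + b)² + a`. -/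
def prN (a b : ℕ) : ℕ := (a + b) * (a + b) + a

/-- The first component of a pair. -/
def prFst (s : ℕ) : ℕ := s - s.sqrt * s.sqrt

/-- The second component of a pair. -/
def prSnd (s : ℕ) : ℕ := s.sqrt - prFst s

-- The remainder `a` is at most `2 (a + b)`, so the integer square root of `prN a b` is `a + b`.
@[simp] theorem prFst_prN (a b : ℕ) : prFst (prN a b) = a := by
  rw [prFst, prN, Nat.sqrt_add_eq _ (by omega)]; omega

@[simp] theorem prSnd_prN (a b : ℕ) : prSnd (prN a b) = b := by
  rw [prSnd, prFst_prN, prN, Nat.sqrt_add_eq _ (by omega)]; omega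

theorem prN_inj {a b c d : ℕ} (h : prN a b = prN c d) : a = c ∧ b = d := by
  constructor
  · rw [← prFst_prN a b, h, prFst_prN]
  · rw [← prSnd_prN a b, h, prSnd_prN]

/-- Bit `i` of the sequence described by the parameters `m, n`. -/
def bitN (m n i : ℕ) : Bool := decide (n % (m * (i + 1) + 1) = 0)

theorem bitN_eq_true {m n i : ℕ} : bitN m n i = true ↔ (m * (i + 1) + 1) ∣ n := by
  rw [bitN, decide_eq_true_eq, Nat.dvd_iff_mod_eq_zero]

/-- The string described by `s`. -/
def dec (s : ℕ) : List Bool :=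
  (List.range (prFst s)).map (bitN (prFst (prSnd s)) (prSnd (prSnd s)))

/-- `s` has the form of a triple. -/
def Valid (s : ℕ) : Prop := prN (prFst s) (prN (prFst (prSnd s)) (prSnd (prSnd s))) = s

/-- `s` is the code of a string. -/
def IsStr (s : ℕ) : Prop := Valid s ∧ ∀ t < s, Valid t → dec t ≠ dec s

theorem dec_prN (l m n : ℕ) : dec (prN l (prN m n)) = (List.range l).map (bitN m n) := by
  simp [dec]

theorem valid_prN (l m n : ℕ) : Valid (prN l (prN m n)) := by simp [Valid]

theorem valid_iff {s : ℕ} : Valid s ↔ ∃ l m n, s = prN l (prN m n) :=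
  ⟨fun h => ⟨_, _, _, h.symm⟩, fun ⟨_, _, _, h⟩ => h ▸ valid_prN _ _ _⟩

theorem dec_eq_iff {l m n m' n' : ℕ} : dec (prN l (prN m' n')) = dec (prN l (prN m n)) ↔
    ∀ i < l, (bitN m' n' i ↔ bitN m n i) := by
  rw [dec_prN, dec_prN, List.map_inj_left]
  simp only [List.mem_range]
  exact forall₂_congr fun i _ => Bool.eq_iff_iff

/-- Equal strings have equal lengths, so minimality need only be tested against triples with the
same first component, as in the formula `isStr`. -/
theorem isStr_iff {s : ℕ} : IsStr s ↔ ∃ l m n, s = prN l (prN m n) ∧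
    ∀ m' n', prN l (prN m' n') < s → ∃ i < l, ¬ (bitN m' n' i ↔ bitN m n i) := by
  constructor
  · rintro ⟨hv, h⟩
    obtain ⟨l, m, n, rfl⟩ := valid_iff.1 hv
    refine ⟨l, m, n, rfl, fun m' n' hlt => ?_⟩
    have := h _ hlt (valid_prN _ _ _)
    rw [Ne, dec_eq_iff] at this
    simpa using this
  · rintro ⟨l, m, n, rfl, h⟩
    refine ⟨valid_prN _ _ _, fun t ht hv hd => ?_⟩
    obtain ⟨l', m', n', rfl⟩ := valid_iff.1 hv
    have hl : l' = l := by simpa [dec_prN] using congrArg List.length hd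
    subst hl
    obtain ⟨i, hi, hi'⟩ := h _ _ ht
    exact hi' (dec_eq_iff.1 hd i hi)

theorem IsStr.eq_of_dec_eq {s t : ℕ} (hs : IsStr s) (ht : IsStr t) (h : dec s = dec t) : s = t := by
  rcases lt_trichotomy s t with hlt | heq | hgt
  · exact absurd h (ht.2 s hlt hs.1)
  · exact heq
  · exact absurd h.symm (hs.2 t hgt ht.1)

/-- Gödel's beta function: for `m = l!` the numbers `m (i + 1) + 1` with `i < l` are pairwise
coprime, so the product of those belonging to the digits `1` is divisible by no other of them. -/
theorem exists_valid (σ : List Bool) : ∃ s, Valid s ∧ dec s = σ := by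
  set l := σ.length
  set m := l.factorial
  have hcop : ∀ i < l, ∀ j < l, i ≠ j → Nat.Coprime (m * (i + 1) + 1) (m * (j + 1) + 1) := by
    have : ∀ i j, i < j → j < l → Nat.Coprime (m * (i + 1) + 1) (m * (j + 1) + 1) := by
      intro i j hij hj
      rw [mul_comm m, mul_comm m]
      exact Nat.coprime_mul_succ (Nat.dvd_factorial (by omega) (by omega))
    intro i hi j hj hne
    rcases lt_or_gt_of_ne hne with h | h
    · exact this i j h hj
    · exact (this j i h hi).symm
  set n := ∏ i ∈ (Finset.range l).filter (fun i => σ[i]? = some true), (m * (i + 1) + 1)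
  refine ⟨prN l (prN m n), valid_prN _ _ _, ?_⟩
  rw [dec_prN]
  refine List.ext_getElem (by simp [l]) fun i hi _ => ?_
  have hil : i < l := by simpa using hi
  rw [List.getElem_map, List.getElem_range, Bool.eq_iff_iff, bitN_eq_true]
  have hsome : σ[i]? = some σ[i] := List.getElem?_eq_getElem _
  constructor
  · intro hd
    by_contra hf
    have : Nat.Coprime (m * (i + 1) + 1) n := by
      refine Nat.Coprime.prod_right fun j hj => ?_
      rw [Finset.mem_filter, Finset.mem_range] at hj
      refine hcop i hil j hj.1 ?_
      rintro rfl
      rw [hsome] at hj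
      exact hf (by simpa using hj.2)
    have h1 := Nat.Coprime.eq_one_of_dvd this hd
    have : 0 < m := Nat.factorial_pos l
    have : 0 < m * (i + 1) := by positivity
    omega
  · intro ht
    exact Finset.dvd_prod_of_mem (fun i => m * (i + 1) + 1)
      (Finset.mem_filter.2 ⟨Finset.mem_range.2 hil, by rw [hsome, ht]⟩)

theorem exists_isStr (σ : List Bool) : ∃ s, IsStr s ∧ dec s = σ := by
  classical
  have h := exists_valid σ
  refine ⟨Nat.find h, ⟨(Nat.find_spec h).1, fun t ht hv hd => ?_⟩, (Nat.find_spec h).2⟩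
  exact Nat.find_min h ht ⟨hv, hd.trans (Nat.find_spec h).2⟩

/-- The code of a string. -/
noncomputable def enc (σ : List Bool) : ℕ := (exists_isStr σ).choose

theorem isStr_enc (σ : List Bool) : IsStr (enc σ) := (exists_isStr σ).choose_spec.1

@[simp] theorem dec_enc (σ : List Bool) : dec (enc σ) = σ := (exists_isStr σ).choose_spec.2

theorem IsStr.enc_dec {s : ℕ} (h : IsStr s) : enc (dec s) = s :=
  (isStr_enc _).eq_of_dec_eq h (dec_enc _)

theorem isStr_iff_exists {s : ℕ} : IsStr s ↔ ∃ σ, s = enc σ :=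
  ⟨fun h => ⟨dec s, h.enc_dec.symm⟩, fun ⟨_, h⟩ => h ▸ isStr_enc _⟩

theorem enc_injective : Function.Injective enc := fun σ τ h => by
  rw [← dec_enc σ, h, dec_enc]

theorem enc_eq_prN (σ : List Bool) : ∃ m n, enc σ = prN σ.length (prN m n) ∧
    ∀ i, i < σ.length → (bitN m n i = true ↔ σ[i]? = some true) := by
  obtain ⟨l, m, n, h⟩ := valid_iff.1 (isStr_enc σ).1
  have hd : σ = (List.range l).map (bitN m n) := by rw [← dec_prN, ← h, dec_enc]
  have hl : σ.length = l := by simp [hd]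
  refine ⟨m, n, hl ▸ h, fun i hi => ?_⟩
  have hil := hl ▸ hi
  rw [hd]
  simp [hil]

section Primrec

variable {α : Type*} [Primcodable α]

theorem primrec_prN {f g : α → ℕ} (hf : Primrec f) (hg : Primrec g) :
    Primrec fun a => prN (f a) (g a) :=
  ((hf.add' hg).mul' (hf.add' hg)).add' hf

theorem primrec_prFst : Primrec prFst :=
  Primrec.id.sub' (Primrec.nat_sqrt.mul' Primrec.nat_sqrt)

theorem primrec_prSnd : Primrec prSnd := Primrec.nat_sqrt.sub' primrec_prFst

theorem primrec_dec : Primrec dec := by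
  refine Primrec.mapRange primrec_prFst ?_
  have h : Primrec fun x : ℕ × ℕ => prSnd x.1 := primrec_prSnd.comp Primrec.fst
  exact (PrimrecPred.eq' (Primrec.nat_mod.comp (primrec_prSnd.comp h)
    (Primrec.succ.comp ((primrec_prFst.comp h).mul' (Primrec.succ.comp Primrec.snd))))
    (Primrec.const 0)).decide

theorem primrec_valid : PrimrecPred Valid :=
  PrimrecPred.eq' (primrec_prN primrec_prFst (primrec_prN (primrec_prFst.comp primrec_prSnd)
    (primrec_prSnd.comp primrec_prSnd))) Primrec.id

theorem primrec_isStr : PrimrecPred IsStr :=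
  primrec_valid.and (PrimrecPred.ball (p := fun s t => Valid t → dec t ≠ dec s)
    ((primrec_valid.comp Primrec.snd).imp (PrimrecPred.eq' (primrec_dec.comp Primrec.snd)
      (primrec_dec.comp Primrec.fst)).not) Primrec.id)

end Primrec

/-! ### Truth of the coding formulas -/

section

variable {S : Set (Set ℕ)} {e : ℕ → ℕ} {E : ℕ → Set ℕ}

@[simp] theorem push_zero {α : Type} (a : α) (e : ℕ → α) : push a e 0 = a := rfl

@[simp] theorem push_succ {α : Type} (a : α) (e : ℕ → α) (i : ℕ) : push a e (i + 1) = e i := rfl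

@[simp] theorem val_var (i : ℕ) : (Term.var i).val e = e i := rfl

@[simp] theorem val_zero : (0 : Term).val e = 0 := rfl

@[simp] theorem val_one : (1 : Term).val e = 1 := rfl

@[simp] theorem val_add (s t : Term) : (s + t).val e = s.val e + t.val e := rfl

@[simp] theorem val_mul (s t : Term) : (s * t).val e = s.val e * t.val e := rfl

@[simp] theorem val_pr (s t : Term) : (pr s t).val e = prN (s.val e) (t.val e) := rfl

theorem sat_eq {s t : Term} : Sat S e E (s ≐ t) ↔ s.val e = t.val e := Iff.rfl

theorem sat_lt {s t : Term} : Sat S e E (s <ₙ t) ↔ s.val e < t.val e := Iff.rfl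

theorem sat_mem {t : Term} {i : ℕ} : Sat S e E (t ∈ₛ i) ↔ t.val e ∈ E i := Iff.rfl

theorem sat_imp {φ ψ : Form} : Sat S e E (φ ⇾ ψ) ↔ (Sat S e E φ → Sat S e E ψ) := Iff.rfl

theorem sat_allN {φ : Form} : Sat S e E (Form.allN φ) ↔ ∀ n, Sat S (push n e) E φ := Iff.rfl

theorem sat_allS {φ : Form} : Sat S e E (Form.allS φ) ↔ ∀ A ∈ S, Sat S e (push A E) φ := Iff.rfl

theorem sat_bit {m n i : Term} :
    Sat S e E (bit m n i) ↔ bitN (m.val e) (n.val e) (i.val e) = true := by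
  rw [bitN_eq_true, bit, dvd, sat_exN]
  simp only [sat_eq, val_mul, val_var, push_zero, val_up, val_add, val_one]
  exact ⟨fun ⟨d, hd⟩ => ⟨d, by rw [← hd, mul_comm]⟩, fun ⟨d, hd⟩ => ⟨d, by rw [hd, mul_comm]⟩⟩

theorem sat_isStr {s : Term} : Sat S e E (isStr s) ↔ IsStr (s.val e) := by
  rw [isStr_iff]
  simp only [isStr, sat_exN, sat_and, sat_eq, sat_allN, sat_imp, sat_lt, sat_neg, sat_iff, sat_bit,
    val_up, val_pr, val_var, push_zero, push_succ]

theorem sat_len {s l : Term} {σ : List Bool} (hs : s.val e = enc σ) :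
    Sat S e E (len s l) ↔ l.val e = σ.length := by
  obtain ⟨m, n, h, -⟩ := enc_eq_prN σ
  simp only [len, sat_exN, sat_eq, val_up, val_pr, val_var, push_zero, push_succ, hs, h]
  constructor
  · rintro ⟨m', n', h'⟩
    exact (prN_inj h').1.symm
  · intro hl
    exact ⟨m, n, by rw [hl]⟩

theorem sat_digitOne {s i : Term} {σ : List Bool} (hs : s.val e = enc σ) :
    Sat S e E (digitOne s i) ↔ σ[i.val e]? = some true := by
  obtain ⟨m, n, h, hb⟩ := enc_eq_prN σ
  simp only [digitOne, sat_exN, sat_eq, sat_and, sat_lt, sat_bit, val_up, val_pr, val_var,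
    push_zero, push_succ, hs, h]
  constructor
  · rintro ⟨l', m', n', h', hi, hbit⟩
    obtain ⟨rfl, h''⟩ := prN_inj h'
    obtain ⟨rfl, rfl⟩ := prN_inj h''
    exact (hb _ hi).1 hbit
  · intro hi
    have hlt := (List.getElem?_eq_some_iff.1 hi).1
    exact ⟨_, m, n, rfl, hlt, (hb _ hlt).2 hi⟩

theorem getElem?_inj_of_bits {σ τ : List Bool} {i : ℕ} (h1 : i < σ.length) (h2 : i < τ.length) :
    (σ[i]? = some true ↔ τ[i]? = some true) ↔ σ[i]? = τ[i]? := by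
  rw [List.getElem?_eq_getElem h1, List.getElem?_eq_getElem h2]
  cases σ[i] <;> cases τ[i] <;> simp

theorem sat_isPrefix {s t : Term} {σ τ : List Bool} (hs : s.val e = enc σ) (ht : t.val e = enc τ) :
    Sat S e E (isPrefix s t) ↔ σ <+: τ := by
  have hs2 : ∀ a b, (s.up.up).val (push b (push a e)) = enc σ := by simp [hs]
  have ht2 : ∀ a b, (t.up.up).val (push b (push a e)) = enc τ := by simp [ht]
  have hs3 : ∀ a b c, (s.up.up.up).val (push c (push b (push a e))) = enc σ := by simp [hs]
  have ht3 : ∀ a b c, (t.up.up.up).val (push c (push b (push a e))) = enc τ := by simp [ht]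
  simp only [isPrefix, sat_exN, sat_and, sat_len (hs2 _ _), sat_len (ht2 _ _), sat_lt, sat_allN,
    sat_imp, sat_iff, sat_digitOne (hs3 _ _ _), sat_digitOne (ht3 _ _ _), val_var, val_add, val_one,
    push_zero, push_succ]
  constructor
  · rintro ⟨_, _, rfl, rfl, hl, h⟩
    refine CantorDyn.prefix_of_getElem? fun i hi => ?_
    exact (getElem?_inj_of_bits hi (by omega)).1 (h i hi)
  · intro h
    refine ⟨_, _, rfl, rfl, by have := h.length_le; omega, fun i hi => ?_⟩
    rw [CantorDyn.getElem?_of_prefix h hi]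

theorem bits_iff_eq_res {σ : List Bool} {X : Set ℕ} :
    (∀ i < σ.length, (σ[i]? = some true ↔ i ∈ X)) ↔ σ = CantorDyn.res X σ.length := by
  rw [eq_comm, CantorDyn.res_eq_iff_str]
  exact forall₂_congr fun i _ => Iff.comm

theorem sat_isInit {s : Term} {X : ℕ} {σ : List Bool} (hs : s.val e = enc σ) :
    Sat S e E (isInit s X) ↔ σ = CantorDyn.res (E X) σ.length := by
  have hs1 : ∀ a, (s.up).val (push a e) = enc σ := by simp [hs]
  have hs2 : ∀ a b, (s.up.up).val (push b (push a e)) = enc σ := by simp [hs]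
  simp only [isInit, sat_exN, sat_and, sat_len (hs1 _), sat_lt, sat_allN, sat_imp, sat_iff, sat_mem,
    sat_digitOne (hs2 _ _), val_var, push_zero, push_succ, exists_eq_left, bits_iff_eq_res]

theorem sat_isInitCol {s k : Term} {Y : ℕ} {σ : List Bool} (hs : s.val e = enc σ) :
    Sat S e E (isInitCol s k Y) ↔
      σ = CantorDyn.res {i | prN (k.val e) i ∈ E Y} σ.length := by
  have hs1 : ∀ a, (s.up).val (push a e) = enc σ := by simp [hs]
  have hs2 : ∀ a b, (s.up.up).val (push b (push a e)) = enc σ := by simp [hs]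
  rw [← bits_iff_eq_res]
  simp only [isInitCol, sat_exN, sat_and, sat_len (hs1 _), sat_lt, sat_allN, sat_imp, sat_iff,
    sat_mem, sat_digitOne (hs2 _ _), val_var, val_up, val_pr, push_zero, push_succ, exists_eq_left,
    Set.mem_ofPred_eq]

end

end SOA

/-! ## The `ω`-model of columns of a Scott set -/

namespace SOA

open CantorDyn

/-- A formula uses finitely many set variables, so its parameters lie in finitely many columns and a
mask can keep them all. -/
theorem sat_congr (φ : Form) : ∃ K, ∀ (S : Set (Set ℕ)) (e : ℕ → ℕ) (E E' : ℕ → Set ℕ),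
    (∀ i < K, E i = E' i) → (Sat S e E φ ↔ Sat S e E' φ) := by
  induction φ with
  | eq s t => exact ⟨0, fun _ _ _ _ _ => Iff.rfl⟩
  | lt s t => exact ⟨0, fun _ _ _ _ _ => Iff.rfl⟩
  | mem t i =>
    refine ⟨i + 1, fun S e E E' h => ?_⟩
    rw [sat_mem, sat_mem, h i (Nat.lt_succ_self i)]
  | bot => exact ⟨0, fun _ _ _ _ _ => Iff.rfl⟩
  | imp φ ψ hφ hψ =>
    obtain ⟨K, hK⟩ := hφ
    obtain ⟨L, hL⟩ := hψ
    exact ⟨max K L, fun S e E E' h => imp_congr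
      (hK S e E E' fun i hi => h i (lt_max_of_lt_left hi))
      (hL S e E E' fun i hi => h i (lt_max_of_lt_right hi))⟩
  | allN φ ih =>
    obtain ⟨K, hK⟩ := ih
    exact ⟨K, fun S e E E' h => forall_congr' fun n => hK S _ E E' h⟩
  | allS φ ih =>
    obtain ⟨K, hK⟩ := ih
    refine ⟨K, fun S e E E' h => forall₂_congr fun A _ => hK S _ _ _ fun i hi => ?_⟩
    cases i with
    | zero => rfl
    | succ i => exact h i (by omega)

theorem primrec_val {α : Type*} [Primcodable α] {v : α → ℕ → ℕ} (hv : ∀ i, Primrec fun a => v a i)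
    (t : Term) : Primrec fun a => t.val (v a) := by
  induction t with
  | var i => exact hv i
  | zero => exact Primrec.const 0
  | one => exact Primrec.const 1
  | add s t hs ht => exact hs.add' ht
  | mul s t hs ht => exact hs.mul' ht

theorem primrec_push {α : Type*} [Primcodable α] {v : α → ℕ → ℕ}
    (hv : ∀ i, Primrec fun a => v a i) (i : ℕ) :
    Primrec fun x : α × ℕ => push x.2 (v x.1) i := by
  cases i with
  | zero => exact Primrec.snd
  | succ i => exact (hv i).comp Primrec.fst

/-- Bounded formulas are decidable in their parameters; carrying the negation along is what lets the
induction pass implications. -/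
theorem sig_sat_bounded {φ : Form} (hφ : φ.IsBounded) (S : Set (Set ℕ)) (c : ℕ → ℕ) {α : Type}
    [Primcodable α] {v : α → ℕ → ℕ} (hv : ∀ i, Primrec fun a => v a i) :
    Sig (fun a X => Sat S (v a) (fun i => column (c i) X) φ) ∧
      Sig (fun a X => ¬ Sat S (v a) (fun i => column (c i) X) φ) := by
  induction hφ generalizing α with
  | eq s t =>
    have := PrimrecPred.eq' (primrec_val hv s) (primrec_val hv t)
    exact ⟨Sig.pred this, Sig.pred this.not⟩
  | lt s t =>
    have := PrimrecPred.natLt (primrec_val hv s) (primrec_val hv t)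
    exact ⟨Sig.pred this, Sig.pred this.not⟩
  | mem t i =>
    have := Primrec.pairNat (Primrec.const (c i)) (primrec_val hv t)
    exact ⟨Sig.mem this, Sig.notMem this⟩
  | bot => exact ⟨Sig.pred (PrimrecPred.const False), Sig.pred (PrimrecPred.const False).not⟩
  | @imp φ ψ _ _ h1 h2 =>
    refine ⟨((h1 hv).2.or (h2 hv).1).of_iff fun a X => ?_,
      ((h1 hv).1.and (h2 hv).2).of_iff fun a X => ?_⟩
    · rw [sat_imp]; tauto
    · rw [sat_imp]; tauto
  | @ball φ t _ ih =>
    have h := ih (primrec_push hv)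
    have ht := primrec_val hv t
    refine ⟨(Sig.ball (P := fun a n X => Sat S (push n (v a)) (fun i => column (c i) X) φ)
      h.1 ht).of_iff fun a X => ?_,
      (Sig.bex (P := fun a n X => ¬ Sat S (push n (v a)) (fun i => column (c i) X) φ)
      h.2 ht).of_iff fun a X => ?_⟩
    · simp only [sat_allN, sat_imp, sat_lt, val_var, push_zero, val_up]
    · simp only [sat_allN, sat_imp, sat_lt, val_var, push_zero, val_up, not_forall, exists_prop]

theorem sig_sat_sigma {φ : Form} (hφ : φ.IsSigma) (S : Set (Set ℕ)) (c : ℕ → ℕ) {α : Type}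
    [Primcodable α] {v : α → ℕ → ℕ} (hv : ∀ i, Primrec fun a => v a i) :
    Sig fun a X => Sat S (v a) (fun i => column (c i) X) φ := by
  obtain ⟨θ, hθ, rfl⟩ := hφ
  refine (Sig.ex (P := fun a n X => Sat S (push n (v a)) (fun i => column (c i) X) θ)
    (sig_sat_bounded hθ S c (primrec_push hv)).1).of_iff fun a X => ?_
  rw [sat_exN]

theorem sig_not_sat_pi {φ : Form} (hφ : φ.IsPi) (S : Set (Set ℕ)) (c : ℕ → ℕ) {α : Type}
    [Primcodable α] {v : α → ℕ → ℕ} (hv : ∀ i, Primrec fun a => v a i) :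
    Sig fun a X => ¬ Sat S (v a) (fun i => column (c i) X) φ := by
  obtain ⟨θ, hθ, rfl⟩ := hφ
  refine (Sig.ex (P := fun a n X => ¬ Sat S (push n (v a)) (fun i => column (c i) X) θ)
    (sig_sat_bounded hθ S c (primrec_push hv)).2).of_iff fun a X => ?_
  rw [sat_allN, not_forall]

variable {X : Set ℕ}

theorem trueIn_basicAxioms (S : Set (Set ℕ)) {φ : Form} (hφ : φ ∈ basicAxioms) : TrueIn S φ := by
  intro e E _
  simp only [basicAxioms, Set.mem_insert_iff, Set.mem_singleton_iff] at hφ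
  rcases hφ with rfl | rfl | rfl | rfl | rfl | rfl | rfl | rfl <;>
    simp only [sat_neg, sat_imp, sat_iff, sat_or, sat_eq, sat_lt, val_var, val_add, val_mul,
      val_zero, val_one] <;> first | omega | ring

theorem trueIn_induction (S : Set (Set ℕ)) (φ : Form) : TrueIn S (induction φ) := by
  intro e E _
  simp only [induction, sat_imp, sat_and, sat_instN, sat_allN, sat_succ]
  rintro ⟨h0, hs⟩ n
  induction n with
  | zero => exact h0
  | succ n ih => exact hs n ih

theorem trueIn_comprehension (hX : IsScott X) {φ ψ : Form} (hφ : φ.IsSigma) (hψ : ψ.IsPi) :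
    TrueIn (columns X) (comprehension φ ψ) := by
  intro e E hE
  choose c hc using hE
  beta_reduce at hc
  obtain rfl : (fun i => column (c i) X) = E := funext hc
  simp only [comprehension, sat_imp, sat_allN, sat_iff, sat_exS, sat_upS, sat_mem, val_var,
    push_zero]
  intro h
  obtain ⟨K, hK⟩ := sat_congr φ
  obtain ⟨L, hL⟩ := sat_congr ψ
  -- `N` exceeds the index of every column that `φ` or `ψ` can use as a parameter.
  set N := (Finset.range (max K L)).sup fun i => c i + 1
  have hN : ∀ i < max K L, column (c i) (mask N X) = column (c i) X := fun i hi =>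
    column_mask_of_lt (Nat.lt_of_succ_le
      (Finset.le_sup (f := fun i => c i + 1) (Finset.mem_range.2 hi))) X
  have hv : ∀ i, Primrec fun m : ℕ => push m e i := fun i => by
    cases i with
    | zero => exact Primrec.id
    | succ i => exact Primrec.const _
  have h1 : ∀ m, Sat (columns X) (push m e) (fun i => column (c i) (mask N X)) φ ↔
      Sat (columns X) (push m e) (fun i => column (c i) X) φ := fun m =>
    hK _ _ _ _ fun i hi => hN i (lt_max_of_lt_left hi)
  have h2 : ∀ m, Sat (columns X) (push m e) (fun i => column (c i) (mask N X)) ψ ↔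
      Sat (columns X) (push m e) (fun i => column (c i) X) ψ := fun m =>
    hL _ _ _ _ fun i hi => hN i (lt_max_of_lt_right hi)
  obtain ⟨n, hn⟩ := hX.exists_column_eq (sig_sat_sigma hφ (columns X) c hv)
    (sig_not_sat_pi hψ (columns X) c hv) N fun m => by rw [h1, h2, not_not]; exact h m
  refine ⟨column n X, ⟨n, rfl⟩, fun m => ?_⟩
  rw [hn, Set.mem_ofPred_eq, h1]

theorem sat_isTree_iff {S : Set (Set ℕ)} {e : ℕ → ℕ} {E : ℕ → Set ℕ} {C : ℕ} :
    Sat S e E (isTree C) ↔ (∀ s ∈ E C, IsStr s) ∧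
      ∀ σ τ : List Bool, σ <+: τ → enc τ ∈ E C → enc σ ∈ E C := by
  simp only [isTree, sat_allN, sat_imp, sat_mem, sat_and, sat_isStr, val_var, push_zero]
  constructor
  · intro h
    refine ⟨fun s hs => (h s hs).1, fun σ τ hστ hτ => (h _ hτ).2 _ ⟨isStr_enc σ, ?_⟩⟩
    rwa [sat_isPrefix (σ := σ) (τ := τ) rfl rfl]
  · rintro ⟨h1, h2⟩ s hs
    refine ⟨h1 s hs, ?_⟩
    rintro t ⟨ht, hp⟩
    obtain ⟨τ, rfl⟩ := isStr_iff_exists.1 (h1 s hs)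
    obtain ⟨σ, rfl⟩ := isStr_iff_exists.1 ht
    exact h2 _ _ ((sat_isPrefix (σ := σ) (τ := τ) rfl rfl).1 hp) hs

theorem sat_isPath_iff {S : Set (Set ℕ)} {e : ℕ → ℕ} {E : ℕ → Set ℕ} {A C : ℕ} :
    Sat S e E (isPath A C) ↔ E A ∈ paths {σ | enc σ ∈ E C} := by
  simp only [isPath, sat_allN, sat_imp, sat_mem, sat_and, sat_isStr, val_var, push_zero]
  constructor
  · intro h l
    refine h _ ⟨isStr_enc _, ?_⟩
    rw [sat_isInit (σ := res (E A) l) rfl, res_length]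
  · rintro h s ⟨hs, hi⟩
    obtain ⟨σ, rfl⟩ := isStr_iff_exists.1 hs
    rw [(sat_isInit (σ := σ) rfl).1 hi]
    exact h _

/-- Not being a path is `Σ⁰₁` in tree and candidate. The tree is column `c`, and the candidate is
placed in column `c + 1`. -/
theorem exists_path_column (hX : IsScott X) (c : ℕ)
    (h : (paths {σ | enc σ ∈ column c X}).Nonempty) :
    ∃ n, column n X ∈ paths {σ | enc σ ∈ column c X} := by
  obtain ⟨A, hA⟩ := h
  let P : Set ℕ → Prop := fun W => ∃ s, (IsStr s ∧ Nat.pair c s ∉ W) ∧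
    dec s = res (column (c + 1) W) (dec s).length
  have hP : Sig fun (_ : ℕ) W => P W := by
    refine Sig.ex (P := fun _ s W => (IsStr s ∧ Nat.pair c s ∉ W) ∧
      dec s = res (column (c + 1) W) (dec s).length) (Sig.and (Sig.and ?_ ?_) ?_)
    · exact Sig.pred (primrec_isStr.comp Primrec.snd)
    · exact Sig.notMem (Primrec.pairNat (Primrec.const c) Primrec.snd)
    · have hd : Primrec fun x : ℕ × ℕ => dec x.2 := primrec_dec.comp Primrec.snd
      refine (Sig.strings (R := fun (x : ℕ × ℕ) σ => dec x.2 = σ)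
        (PrimrecPred.eq' (hd.comp Primrec.fst) Primrec.snd) hd.length'
        (b := fun _ _ => true) (Primrec.const true) (h := fun _ i => Nat.pair (c + 1) i)
        (Primrec.pairNat (Primrec.const _) Primrec.snd)).of_iff fun x W => ?_
      simp only [Bool.true_and]
      rfl
  have hPA : ∀ B, ¬ P (glue (c + 1) X B) ↔ B ∈ paths {σ | enc σ ∈ column c X} := by
    intro B
    simp only [P, column_glue_self, not_exists, not_and, and_imp]
    have hmem : ∀ s, Nat.pair c s ∈ glue (c + 1) X B ↔ s ∈ column c X := fun s => by
      rw [← column_glue_of_lt (Nat.lt_succ_self c) X B]; rfl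
    constructor
    · intro h l
      by_contra hl
      refine h (enc (res B l)) (isStr_enc _) (fun hm => hl ((hmem _).1 hm)) ?_
      rw [dec_enc, res_length]
    · intro h s hs hm he
      refine hm ((hmem _).2 ?_)
      rw [← hs.enc_dec, he]
      exact h _
  obtain ⟨n, hn⟩ := hX.exists_column hP (c + 1) ⟨A, (hPA A).2 hA⟩
  exact ⟨n, (hPA _).1 hn⟩

theorem trueIn_WKL (hX : IsScott X) : TrueIn (columns X) WKL := by
  intro e E _
  simp only [WKL, sat_allS, sat_imp, sat_and, sat_exS, sat_isTree_iff, sat_isPath_iff, sat_allN,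
    sat_exN, sat_lt, sat_mem, val_var, push_zero, push_succ]
  rintro _ ⟨c, rfl⟩ ⟨⟨hstr, htree⟩, hinf⟩
  beta_reduce at hstr htree hinf
  obtain ⟨n, hn⟩ := exists_path_column hX c (exists_path_of_infinite _ (fun σ τ h hτ => htree σ τ h hτ)
    fun l => by
      -- The formula provides arbitrarily large codes, not long strings. `N` bounds the codes of all
      -- strings shorter than `l`, so a larger code belongs to a string of length at least `l`.
      set N := ((List.range l).flatMap allStrings).toFinset.sup enc
      obtain ⟨s, hs, hsC⟩ := hinf N
      obtain ⟨σ, rfl⟩ := isStr_iff_exists.1 (hstr s hsC)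
      have hl : l ≤ σ.length := by
        by_contra! hlt
        refine hs.not_ge (Finset.le_sup (f := enc) ?_)
        rw [List.mem_toFinset, List.mem_flatMap]
        exact ⟨σ.length, List.mem_range.2 hlt, mem_allStrings.2 rfl⟩
      exact ⟨σ.take l, htree _ _ (List.take_prefix l σ) hsC, by simp [hl]⟩)
  exact ⟨column n X, ⟨n, rfl⟩, hn⟩

theorem isOmegaModel_columns (hX : IsScott X) : IsOmegaModel (columns X) WKL0 := by
  refine ⟨⟨column 0 X, 0, rfl⟩, ?_⟩
  rintro φ (((h | ⟨φ, -, rfl⟩) | ⟨φ, ψ, hφ, hψ, rfl⟩) | rfl)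
  · exact trueIn_basicAxioms _ h
  · exact trueIn_induction _ _
  · exact trueIn_comprehension hX hφ hψ
  · exact trueIn_WKL hX

end SOA

/-! ## Failure of `AP` in the model of columns -/

namespace SOA

open CantorDyn

theorem mem_columns_of_primrec {X : Set ℕ} (hX : IsScott X) {p : ℕ → Prop} (hp : PrimrecPred p) :
    {m | p m} ∈ columns X := by
  obtain ⟨n, hn⟩ := hX.exists_column_eq (Sig.pred hp) (Sig.pred hp.not) 0 fun m => not_not.symm
  exact ⟨n, hn⟩

/-- The set of codes of a set of strings. -/
def treeCode (C : Set (List Bool)) : Set ℕ := {s | IsStr s ∧ dec s ∈ C}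

/-- The graph of a string function, coded as a set of numbers. -/
def funCode (f : List Bool → List Bool) : Set ℕ :=
  {p | (prN (prFst p) (prSnd p) = p ∧ IsStr (prFst p)) ∧ IsStr (prSnd p) ∧
    dec (prSnd p) = f (dec (prFst p))}

theorem enc_mem_treeCode {C : Set (List Bool)} {σ : List Bool} : enc σ ∈ treeCode C ↔ σ ∈ C := by
  simp [treeCode, isStr_enc]

theorem mem_funCode {f : List Bool → List Bool} {s t : ℕ} :
    prN s t ∈ funCode f ↔ ∃ σ, s = enc σ ∧ t = enc (f σ) := by
  simp only [funCode, Set.mem_ofPred_eq, prFst_prN, prSnd_prN, true_and]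
  constructor
  · rintro ⟨hs, ht, h⟩
    exact ⟨dec s, hs.enc_dec.symm, by rw [← h, ht.enc_dec]⟩
  · rintro ⟨σ, rfl, rfl⟩
    exact ⟨isStr_enc _, isStr_enc _, by simp⟩

theorem setOf_enc_mem_treeCode (C : Set (List Bool)) : {σ | enc σ ∈ treeCode C} = C :=
  Set.ext fun _ => enc_mem_treeCode

section

variable {S : Set (Set ℕ)} {e : ℕ → ℕ} {E : ℕ → Set ℕ}

theorem sat_encodesTransformation {f : List Bool → List Bool} (hf : EncodesTransformation f) {i : ℕ}
    (hi : E i = funCode f) : Sat S e E (encodesTransformation i) := by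
  simp only [encodesTransformation, isStrFun, sat_and, sat_allN, sat_exN, sat_imp, sat_mem, sat_isStr,
    sat_eq, sat_lt, val_pr, val_var, val_add, val_one, val_zero, push_zero, push_succ, hi,
    mem_funCode]
  refine ⟨⟨?_, ?_⟩, ?_, ?_, ?_⟩
  · rintro s t ⟨σ, rfl, rfl⟩
    exact ⟨isStr_enc _, isStr_enc _⟩
  · intro s hs
    obtain ⟨σ, rfl⟩ := isStr_iff_exists.1 hs
    refine ⟨_, ⟨σ, rfl, rfl⟩, ?_⟩
    rintro t ⟨τ, hτ, rfl⟩
    rw [← enc_injective hτ]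
  · rintro _ _ _ _ ⟨⟨σ, rfl, rfl⟩, ⟨τ, rfl, rfl⟩, hp⟩
    rw [sat_isPrefix (σ := σ) (τ := τ) rfl rfl] at hp
    rw [sat_isPrefix (σ := f σ) (τ := f τ) rfl rfl]
    exact hf.mono _ _ hp
  · intro l
    obtain ⟨m, hm⟩ := hf.unbounded l
    refine ⟨m, ?_⟩
    rintro _ _ ⟨⟨σ, rfl, rfl⟩, hl⟩
    rw [sat_len (σ := σ) rfl] at hl
    refine ⟨(f σ).length, ?_, ?_⟩
    · rw [sat_len (σ := f σ) rfl]; rfl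
    · have := hm σ hl.symm
      exact Nat.lt_succ_of_le this
  · rintro _ _ _ _ ⟨⟨σ, rfl, rfl⟩, h1, h2, h3⟩
    rw [sat_len (σ := σ) rfl] at h1
    rw [sat_len (σ := f σ) rfl] at h2
    have := hf.shrink σ
    simp only [val_var, push_zero, push_succ] at h1 h2
    subst h1 h2
    exact this (by rintro rfl; simp at h3)

theorem sat_isSystem {C : Set (List Bool)} {f : List Bool → List Bool} (h : IsSystem C f) {i j : ℕ}
    (hi : E i = treeCode C) (hj : E j = funCode f) (hp : ∃ A ∈ S, A ∈ paths C) :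
    Sat S e E (isSystem i j) := by
  rw [isSystem, sat_and, sat_and, sat_and, sat_isTree_iff, sat_exS, hi]
  refine ⟨⟨?_, ?_⟩, sat_encodesTransformation h.encodes hj, ?_, ?_⟩
  · exact fun s hs => hs.1
  · intro σ τ hστ
    rw [enc_mem_treeCode, enc_mem_treeCode]
    exact h.tree σ τ hστ
  · obtain ⟨A, hA, hAp⟩ := hp
    refine ⟨A, hA, ?_⟩
    rw [sat_isPath_iff, push_zero, push_succ, hi, setOf_enc_mem_treeCode]
    exact hAp
  · simp only [sat_allN, sat_imp, sat_and, sat_mem, val_pr, val_var, push_zero, push_succ, hi, hj,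
      mem_funCode]
    rintro _ _ ⟨⟨σ, rfl, rfl⟩, hσ⟩
    exact enc_mem_treeCode.2 (h.closed σ (enc_mem_treeCode.1 hσ))

/-- An orbit is only required to have the string `f (res B l)` as an initial segment of the next
column; unbounded output lengths make these segments determine that column. -/
theorem transform_eq_of_isOrbit {f : List Bool → List Bool} (hf : EncodesTransformation f)
    {B B' : Set ℕ} (h : ∀ l, f (res B l) = res B' (f (res B l)).length) : transform f B = B' := by
  ext i
  constructor
  · rintro ⟨l, hl⟩
    rw [h, res_getElem?] at hl
    split_ifs at hl
    simpa using hl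
  · intro hi
    obtain ⟨m, hm⟩ := hf.unbounded (i + 1)
    refine ⟨m, ?_⟩
    rw [h, res_getElem?_of_lt (hm _ (res_length _ _))]
    simpa using hi

theorem isAlmostPeriodic_of_sat {C : Set (List Bool)} {f : List Bool → List Bool}
    (h : IsSystem C f) {a i j : ℕ} (hi : E i = treeCode C) (hj : E j = funCode f)
    (hs : Sat S e E (isAlmostPeriodic a i j)) : IsAlmostPeriodic C f (E a) := by
  rw [isAlmostPeriodic, sat_and, sat_isPath_iff, hi, setOf_enc_mem_treeCode, sat_exS] at hs
  obtain ⟨hp, Y, -, hY⟩ := hs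
  refine ⟨hp, ?_⟩
  simp only [isOrbit, sat_and, sat_allN, sat_exN, sat_imp, sat_iff, sat_mem, sat_lt, val_pr, val_var,
    val_add, val_zero, push_zero, push_succ, hj, mem_funCode] at hY
  obtain ⟨⟨h0, hstep⟩, hap⟩ := hY
  have hcol : ∀ k, {i | prN k i ∈ Y} = (transform f)^[k] (E a) := by
    intro k
    induction k with
    | zero =>
      ext i
      exact h0 i
    | succ k ih =>
      rw [Function.iterate_succ_apply', ← ih]
      refine (transform_eq_of_isOrbit h.encodes fun l => ?_).symm
      have := hstep k _ _ ⟨⟨res {i | prN k i ∈ Y} l, rfl, rfl⟩, ?_⟩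
      · rw [sat_isInitCol (σ := f (res {i | prN k i ∈ Y} l)) rfl] at this
        exact this
      · rw [sat_isInitCol (σ := res {i | prN k i ∈ Y} l) rfl, res_length]
        rfl
  intro c
  obtain ⟨b, hb⟩ := hap c
  refine ⟨b, fun n => ?_⟩
  obtain ⟨k, hk, hk'⟩ := hb n
  refine ⟨k, hk, ?_⟩
  rw [← hcol, res_eq_iff]
  exact hk'

end

/-- The codes of `C` and `f` are primitive recursive sets, hence columns, and some path through `C`
is a column too. So the model sees a system, and a solution inside it would be a genuine almost
periodic point. -/
theorem not_trueIn_AP {X : Set ℕ} (hX : IsScott X) {C : Set (List Bool)}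
    {f : List Bool → List Bool} (h : IsSystem C f) (hC : PrimrecPred fun σ => σ ∈ C)
    (hf : Primrec f) (hAP : ∀ Z ∈ columns X, ¬ IsAlmostPeriodic C f Z) :
    ¬ TrueIn (columns X) AP := by
  intro hT
  have hC' : treeCode C ∈ columns X :=
    mem_columns_of_primrec hX (primrec_isStr.and (hC.comp primrec_dec))
  have hf' : funCode f ∈ columns X :=
    mem_columns_of_primrec hX (((PrimrecPred.eq' (primrec_prN primrec_prFst primrec_prSnd)
      Primrec.id).and (primrec_isStr.comp primrec_prFst)).and
      ((primrec_isStr.comp primrec_prSnd).and (PrimrecPred.eq' (primrec_dec.comp primrec_prSnd)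
        (hf.comp (primrec_dec.comp primrec_prFst)))))
  obtain ⟨c, hc⟩ := id hC'
  beta_reduce at hc
  obtain ⟨n, hn⟩ := exists_path_column hX c (by
    rw [hc, setOf_enc_mem_treeCode]; exact h.nonempty)
  rw [hc, setOf_enc_mem_treeCode] at hn
  have := hT (fun _ => 0) (fun _ => column 0 X) (fun _ => ⟨0, rfl⟩) _ hC' _ hf'
    (sat_isSystem h rfl rfl ⟨_, ⟨n, rfl⟩, hn⟩)
  rw [sat_exS] at this
  obtain ⟨Z, hZ, hs⟩ := this
  exact hAP Z hZ (isAlmostPeriodic_of_sat h rfl rfl hs)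

end SOA

/-! ## Satisfaction classes for Peano arithmetic -/

namespace CantorDyn

/-- `P` is a `Δ⁰₁` predicate with a set parameter. -/
def Delta {α : Type} [Primcodable α] (P : α → Set ℕ → Prop) : Prop :=
  Sig P ∧ Sig fun a X => ¬ P a X

namespace Delta

variable {α : Type} [Primcodable α] {P Q : α → Set ℕ → Prop}

theorem not (hP : Delta P) : Delta fun a X => ¬ P a X :=
  ⟨hP.2, hP.1.of_iff fun _ _ => not_not⟩

theorem and (hP : Delta P) (hQ : Delta Q) : Delta fun a X => P a X ∧ Q a X :=
  ⟨hP.1.and hQ.1, (hP.2.or hQ.2).of_iff fun _ _ => not_and_or⟩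

theorem or (hP : Delta P) (hQ : Delta Q) : Delta fun a X => P a X ∨ Q a X :=
  ⟨hP.1.or hQ.1, (hP.2.and hQ.2).of_iff fun _ _ => not_or⟩

theorem imp (hP : Delta P) (hQ : Delta Q) : Delta fun a X => P a X → Q a X :=
  ⟨(hP.2.or hQ.1).of_iff fun _ _ => imp_iff_not_or, (hP.1.and hQ.2).of_iff fun _ _ => Classical.not_imp⟩

theorem iff (hP : Delta P) (hQ : Delta Q) : Delta fun a X => (P a X ↔ Q a X) := by
  have := (hP.imp hQ).and (hQ.imp hP)
  exact ⟨this.1.of_iff fun _ _ => iff_iff_implies_and_implies,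
    this.2.of_iff fun _ _ => not_congr iff_iff_implies_and_implies⟩

theorem mem {g : α → ℕ} (hg : Primrec g) : Delta fun a X => g a ∈ X := ⟨Sig.mem hg, Sig.notMem hg⟩

theorem pred {p : α → Prop} (hp : PrimrecPred p) : Delta fun a _ => p a :=
  ⟨Sig.pred hp, Sig.pred hp.not⟩

theorem sig_not_forall {P : ℕ → ℕ → ℕ → ℕ → Set ℕ → Prop}
    (h : Delta fun (x : ℕ × ℕ × ℕ × ℕ) X => P x.1 x.2.1 x.2.2.1 x.2.2.2 X) :
    Sig fun (_ : ℕ) X => ¬ ∀ a b c d, P a b c d X := by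
  refine (Sig.exCode (P := fun (_ : ℕ) (x : ℕ × ℕ × ℕ × ℕ) X => ¬ P x.1 x.2.1 x.2.2.1 x.2.2.2 X)
    (h.2.comp Primrec.snd)).of_iff fun _ X => ?_
  simp only [not_forall, Prod.exists]

end Delta

end CantorDyn

namespace SOA

open CantorDyn

/-! ### Names of elements and positions of bits -/

/-- Elements of the coded structure are named by numbers with a tag as first component. Zero is
named by `0 = Nat.pair 0 0`; names are identified when the corresponding equality bit is set. -/
abbrev nOne : ℕ := Nat.pair 1 0
abbrev nAdd (x y : ℕ) : ℕ := Nat.pair 2 (Nat.pair x y)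
abbrev nMul (x y : ℕ) : ℕ := Nat.pair 3 (Nat.pair x y)
/-- The value of the term with code `t` in the environment `e`. -/
abbrev nVal (t e : ℕ) : ℕ := Nat.pair 4 (Nat.pair t e)
/-- The least counterexample to the formula with code `a` in the environment `e`. -/
abbrev nWit (a e : ℕ) : ℕ := Nat.pair 5 (Nat.pair a e)
/-- The predecessor. -/
abbrev nPred (x : ℕ) : ℕ := Nat.pair 6 x

abbrev bEq (x y : ℕ) : ℕ := Nat.pair 0 (Nat.pair x y)
abbrev bLt (x y : ℕ) : ℕ := Nat.pair 1 (Nat.pair x y)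
/-- Satisfaction of the formula with code `c` in the environment `e`. -/
abbrev bSat (c e : ℕ) : ℕ := Nat.pair 2 (Nat.pair c e)
/-- `c` is the code of a formula of first-order arithmetic with variables less than `n`. -/
abbrev bFO (n c : ℕ) : ℕ := Nat.pair 3 (Nat.pair n c)
/-- `c` is the code of a term with variables less than `n`. -/
abbrev bTV (n c : ℕ) : ℕ := Nat.pair 4 (Nat.pair n c)
/-- `c` is the code of a true sentence. -/
abbrev bOut (c : ℕ) : ℕ := Nat.pair 5 c

/-- Equality is a congruence. -/
def EqConds (a b c d : ℕ) (A : Set ℕ) : Prop :=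
  bEq a a ∈ A ∧ (bEq a b ∈ A → bEq b a ∈ A) ∧ (bEq a b ∈ A → bEq b c ∈ A → bEq a c ∈ A) ∧
  (bEq a b ∈ A → bEq c d ∈ A → bEq (nAdd a c) (nAdd b d) ∈ A) ∧
  (bEq a b ∈ A → bEq c d ∈ A → bEq (nMul a c) (nMul b d) ∈ A) ∧
  (bEq a b ∈ A → bEq c d ∈ A → bLt a c ∈ A → bLt b d ∈ A)

/-- The basic axioms, and every element is zero or a successor. -/
def ArithConds (a b : ℕ) (A : Set ℕ) : Prop :=
  bEq (nAdd a nOne) 0 ∉ A ∧ (bEq (nAdd a nOne) (nAdd b nOne) ∈ A → bEq a b ∈ A) ∧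
  bEq (nAdd a 0) a ∈ A ∧ bEq (nAdd a (nAdd b nOne)) (nAdd (nAdd a b) nOne) ∈ A ∧
  bEq (nMul a 0) 0 ∈ A ∧ bEq (nMul a (nAdd b nOne)) (nAdd (nMul a b) a) ∈ A ∧
  bLt a 0 ∉ A ∧ (bLt a (nAdd b nOne) ∈ A ↔ bLt a b ∈ A ∨ bEq a b ∈ A) ∧
  -- This clause lets a least counterexample be written as a successor, which yields induction.
  (bEq a 0 ∈ A ∨ bEq a (nAdd (nPred a) nOne) ∈ A)

/-- The values of terms. -/
def ValConds (a b c : ℕ) (A : Set ℕ) : Prop :=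
  bEq (nVal (Nat.pair 0 0) (Nat.pair a b)) a ∈ A ∧
  bEq (nVal (Nat.pair 0 (c + 1)) (Nat.pair a b)) (nVal (Nat.pair 0 c) b) ∈ A ∧
  bEq (nVal (Nat.pair 1 0) a) 0 ∈ A ∧ bEq (nVal (Nat.pair 2 0) a) nOne ∈ A ∧
  bEq (nVal (Nat.pair 3 (Nat.pair a b)) c) (nAdd (nVal a c) (nVal b c)) ∈ A ∧
  bEq (nVal (Nat.pair 4 (Nat.pair a b)) c) (nMul (nVal a c) (nVal b c)) ∈ A

/-- Satisfaction of formulas. -/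
def SatConds (a b c : ℕ) (A : Set ℕ) : Prop :=
  (bSat (Nat.pair 0 (Nat.pair a b)) c ∈ A ↔ bEq (nVal a c) (nVal b c) ∈ A) ∧
  (bSat (Nat.pair 1 (Nat.pair a b)) c ∈ A ↔ bLt (nVal a c) (nVal b c) ∈ A) ∧
  bSat (Nat.pair 3 0) c ∉ A ∧
  (bSat (Nat.pair 4 (Nat.pair a b)) c ∈ A ↔ (bSat a c ∈ A → bSat b c ∈ A)) ∧
  (bSat (Nat.pair 5 a) b ∈ A → bSat a (Nat.pair c b) ∈ A) ∧
  (bSat (Nat.pair 5 a) b ∉ A → bSat a (Nat.pair (nWit a b) b) ∉ A) ∧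
  -- Minimality of the witness, needed for induction; the preceding two clauses settle the truth of
  -- universal formulas.
  (bLt c (nWit a b) ∈ A → bSat a (Nat.pair c b) ∈ A)

/-- The codes of first-order formulas. -/
def FOConds (a b c : ℕ) (A : Set ℕ) : Prop :=
  ((bTV a (Nat.pair 0 b) ∈ A ↔ b < a) ∧ (bTV a (Nat.pair 1 b) ∈ A ↔ b = 0) ∧
  (bTV a (Nat.pair 2 b) ∈ A ↔ b = 0) ∧
  (bTV a (Nat.pair 3 (Nat.pair b c)) ∈ A ↔ bTV a b ∈ A ∧ bTV a c ∈ A) ∧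
  (bTV a (Nat.pair 4 (Nat.pair b c)) ∈ A ↔ bTV a b ∈ A ∧ bTV a c ∈ A) ∧
  bTV a (Nat.pair (b + 5) c) ∉ A) ∧
  ((bFO a (Nat.pair 0 (Nat.pair b c)) ∈ A ↔ bTV a b ∈ A ∧ bTV a c ∈ A) ∧
  (bFO a (Nat.pair 1 (Nat.pair b c)) ∈ A ↔ bTV a b ∈ A ∧ bTV a c ∈ A) ∧
  bFO a (Nat.pair 2 b) ∉ A ∧ (bFO a (Nat.pair 3 b) ∈ A ↔ b = 0) ∧
  (bFO a (Nat.pair 4 (Nat.pair b c)) ∈ A ↔ bFO a b ∈ A ∧ bFO a c ∈ A) ∧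
  (bFO a (Nat.pair 5 b) ∈ A ↔ bFO (a + 1) b ∈ A) ∧ bFO a (Nat.pair (b + 6) c) ∉ A) ∧
  -- This bit makes the set of codes of true sentences a primitive recursive preimage of `A`.
  (bOut a ∈ A ↔ bFO 0 a ∈ A ∧ bSat a 0 ∈ A)

/-- `A` codes a model of Peano arithmetic together with its satisfaction relation. -/
def SatClass (A : Set ℕ) : Prop :=
  ∀ a b c d, EqConds a b c d A ∧ ArithConds a b A ∧ ValConds a b c A ∧ SatConds a b c A ∧
    FOConds a b c A

theorem sig_not_satClass : Sig fun (_ : ℕ) A => ¬ SatClass A := by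
  have va : Primrec fun x : ℕ × ℕ × ℕ × ℕ => x.1 := Primrec.fst
  have vb : Primrec fun x : ℕ × ℕ × ℕ × ℕ => x.2.1 := Primrec.fst.comp Primrec.snd
  have vc : Primrec fun x : ℕ × ℕ × ℕ × ℕ => x.2.2.1 :=
    Primrec.fst.comp (Primrec.snd.comp Primrec.snd)
  have vd : Primrec fun x : ℕ × ℕ × ℕ × ℕ => x.2.2.2 :=
    Primrec.snd.comp (Primrec.snd.comp Primrec.snd)
  refine Delta.sig_not_forall ?_
  unfold EqConds ArithConds ValConds SatConds FOConds
  repeat' with_reducible first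
    | apply Delta.and
    | apply Delta.iff
    | apply Delta.or
    | apply Delta.not
    | apply Delta.mem
    | apply Delta.imp
    | apply Delta.pred
  all_goals
    repeat' with_reducible first
      | apply Primrec.pairNat
      | exact va
      | exact vb
      | exact vc
      | exact vd
      | apply PrimrecPred.natLt
      | apply PrimrecPred.eq'
      | apply Primrec.add'
      | apply Primrec.const

end SOA

/-! ### The standard satisfaction class -/

namespace SOA

open CantorDyn

theorem unpair_right_lt {c : ℕ} (h : c.unpair.1 ≠ 0) : c.unpair.2 < c := by
  have := Nat.add_le_pair c.unpair.1 c.unpair.2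
  rw [Nat.pair_unpair] at this
  omega

theorem unpair_right_left_lt {c : ℕ} (h : c.unpair.1 ≠ 0) : c.unpair.2.unpair.1 < c :=
  (Nat.unpair_left_le _).trans_lt (unpair_right_lt h)

theorem unpair_right_right_lt {c : ℕ} (h : c.unpair.1 ≠ 0) : c.unpair.2.unpair.2 < c :=
  (Nat.unpair_right_le _).trans_lt (unpair_right_lt h)

/-- The term with code `c` (with an arbitrary choice if there is none). -/
def toTerm (c : ℕ) : Term :=
  if _h : c.unpair.1 = 3 then .add (toTerm c.unpair.2.unpair.1) (toTerm c.unpair.2.unpair.2)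
  else if _h : c.unpair.1 = 4 then .mul (toTerm c.unpair.2.unpair.1) (toTerm c.unpair.2.unpair.2)
  else if c.unpair.1 = 0 then .var c.unpair.2
  else if c.unpair.1 = 1 then .zero
  else .one
termination_by c
decreasing_by
  all_goals first
    | exact unpair_right_left_lt (by omega)
    | exact unpair_right_right_lt (by omega)

/-- The formula with code `c` (with an arbitrary choice if there is none). -/
def toForm (c : ℕ) : Form :=
  if c.unpair.1 = 0 then .eq (toTerm c.unpair.2.unpair.1) (toTerm c.unpair.2.unpair.2)
  else if c.unpair.1 = 1 then .lt (toTerm c.unpair.2.unpair.1) (toTerm c.unpair.2.unpair.2)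
  else if _h : c.unpair.1 = 4 then .imp (toForm c.unpair.2.unpair.1) (toForm c.unpair.2.unpair.2)
  else if _h : c.unpair.1 = 5 then .allN (toForm c.unpair.2)
  else .bot
termination_by c
decreasing_by
  all_goals first
    | exact unpair_right_left_lt (by omega)
    | exact unpair_right_right_lt (by omega)
    | exact unpair_right_lt (by omega)

theorem toTerm_code (t : Term) : toTerm t.code = t := by
  induction t with
  | var i => rw [toTerm]; simp [Term.code]
  | zero => rw [toTerm]; simp [Term.code]
  | one => rw [toTerm]; simp [Term.code]
  | add s t hs ht => rw [toTerm]; simp [Term.code, hs, ht]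
  | mul s t hs ht => rw [toTerm]; simp [Term.code, hs, ht]

theorem toTerm_var (i : ℕ) : toTerm (Nat.pair 0 i) = .var i := toTerm_code (.var i)

/-- The environment with code `e`. -/
def envOf : ℕ → ℕ → ℕ
  | e, 0 => e.unpair.1
  | e, i + 1 => envOf e.unpair.2 i

theorem envOf_le (e i : ℕ) : envOf e i ≤ e := by
  induction i generalizing e with
  | zero => exact Nat.unpair_left_le e
  | succ i ih => exact (ih _).trans (Nat.unpair_right_le e)

theorem envOf_pair (x e : ℕ) : envOf (Nat.pair x e) = push x (envOf e) := by
  funext i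
  cases i <;> simp [envOf]

theorem exists_envOf (e : ℕ → ℕ) (n : ℕ) : ∃ c, ∀ i < n, envOf c i = e i := by
  induction n generalizing e with
  | zero => exact ⟨0, by simp⟩
  | succ n ih =>
    obtain ⟨c, hc⟩ := ih fun i => e (i + 1)
    refine ⟨Nat.pair (e 0) c, fun i hi => ?_⟩
    rw [envOf_pair]
    cases i with
    | zero => rfl
    | succ i => exact hc i (by omega)

open Classical in
/-- The least number without the property `p`, or `0`. -/
noncomputable def leastFail (p : ℕ → Prop) : ℕ := if h : ∃ y, ¬ p y then Nat.find h else 0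

theorem leastFail_spec {p : ℕ → Prop} (h : ¬ ∀ y, p y) : ¬ p (leastFail p) := by
  classical
  have h' := not_forall.1 h
  rw [leastFail, dif_pos h']
  exact Nat.find_spec h'

theorem of_lt_leastFail {p : ℕ → Prop} {y : ℕ} (h : y < leastFail p) : p y := by
  classical
  rw [leastFail] at h
  split_ifs at h with h'
  · exact not_not.1 (Nat.find_min h' h)
  · omega

/-- The number with a given name. -/
noncomputable def std (x : ℕ) : ℕ :=
  if x.unpair.1 = 1 then 1
  else if _h : x.unpair.1 = 2 then std x.unpair.2.unpair.1 + std x.unpair.2.unpair.2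
  else if _h : x.unpair.1 = 3 then std x.unpair.2.unpair.1 * std x.unpair.2.unpair.2
  -- The entries of a coded environment are bounded by its code, so the names they carry are smaller
  -- and the recursion is well founded.
  else if _h : x.unpair.1 = 4 then
    (toTerm x.unpair.2.unpair.1).val fun i => std (envOf x.unpair.2.unpair.2 i)
  else if _h : x.unpair.1 = 5 then
    leastFail fun y => Sat ∅ (push y fun i => std (envOf x.unpair.2.unpair.2 i)) (fun _ => ∅)
      (toForm x.unpair.2.unpair.1)
  else if _h : x.unpair.1 = 6 then std x.unpair.2 - 1
  else 0
termination_by x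
decreasing_by
  all_goals first
    | exact unpair_right_left_lt (by omega)
    | exact unpair_right_right_lt (by omega)
    | exact unpair_right_lt (by omega)
    | exact (envOf_le _ _).trans_lt (unpair_right_right_lt (by omega))

/-- Satisfaction in the standard model. -/
def StdSat (c e : ℕ) : Prop := Sat ∅ (fun i => std (envOf e i)) (fun _ => ∅) (toForm c)

theorem std_zero : std 0 = 0 := by
  rw [std]; simp

theorem std_one : std nOne = 1 := by
  rw [std]; simp

theorem std_add (x y : ℕ) : std (nAdd x y) = std x + std y := by
  rw [std]; simp

theorem std_mul (x y : ℕ) : std (nMul x y) = std x * std y := by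
  rw [std]; simp

theorem std_val (t e : ℕ) : std (nVal t e) = (toTerm t).val fun i => std (envOf e i) := by
  rw [std]; simp

theorem std_comp_envOf (x e : ℕ) :
    (fun i => std (envOf (Nat.pair x e) i)) = push (std x) fun i => std (envOf e i) := by
  rw [envOf_pair]
  funext i
  cases i <;> rfl

theorem std_wit (a e : ℕ) : std (nWit a e) = leastFail fun y =>
    Sat ∅ (push y fun i => std (envOf e i)) (fun _ => ∅) (toForm a) := by
  rw [std]; simp

theorem std_pred (x : ℕ) : std (nPred x) = std x - 1 := by
  rw [std]; simp

/-- `c` is the code of a first-order formula with variables less than `n`. -/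
def FOCode (n c : ℕ) : Prop := ∃ φ : Form, φ.code = c ∧ φ.IsFirstOrder n

/-- `c` is the code of a term with variables less than `n`. -/
def TermCode (n c : ℕ) : Prop := ∃ t : Term, t.code = c ∧ t.VarsLT n

/-- The satisfaction class of the standard model. -/
def stdClass : Set ℕ :=
  {n | (n.unpair.1 = 0 ∧ std n.unpair.2.unpair.1 = std n.unpair.2.unpair.2) ∨
    (n.unpair.1 = 1 ∧ std n.unpair.2.unpair.1 < std n.unpair.2.unpair.2) ∨
    (n.unpair.1 = 2 ∧ StdSat n.unpair.2.unpair.1 n.unpair.2.unpair.2) ∨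
    (n.unpair.1 = 3 ∧ FOCode n.unpair.2.unpair.1 n.unpair.2.unpair.2) ∨
    (n.unpair.1 = 4 ∧ TermCode n.unpair.2.unpair.1 n.unpair.2.unpair.2) ∨
    (n.unpair.1 = 5 ∧ FOCode 0 n.unpair.2 ∧ StdSat n.unpair.2 0)}

theorem bEq_mem (x y : ℕ) : bEq x y ∈ stdClass ↔ std x = std y := by simp [stdClass]

theorem bLt_mem (x y : ℕ) : bLt x y ∈ stdClass ↔ std x < std y := by simp [stdClass]

theorem bSat_mem (c e : ℕ) : bSat c e ∈ stdClass ↔ StdSat c e := by simp [stdClass]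

theorem bFO_mem (n c : ℕ) : bFO n c ∈ stdClass ↔ FOCode n c := by simp [stdClass]

theorem bTV_mem (n c : ℕ) : bTV n c ∈ stdClass ↔ TermCode n c := by simp [stdClass]

theorem bOut_mem (c : ℕ) : bOut c ∈ stdClass ↔ FOCode 0 c ∧ StdSat c 0 := by simp [stdClass]

theorem valConds_std (a b c : ℕ) : ValConds a b c stdClass := by
  refine ⟨?_, ?_, ?_, ?_, ?_, ?_⟩ <;> rw [bEq_mem, std_val, toTerm]
  · simp [envOf]
  · rw [std_val, toTerm]
    simp [envOf, toTerm_var]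
  · simp [Term.val, std_zero]
  · simp [Term.val, std_one]
  · rw [std_add, std_val, std_val]
    simp [Term.val]
  · rw [std_mul, std_val, std_val]
    simp [Term.val]

theorem satConds_std (a b c : ℕ) : SatConds a b c stdClass := by
  have hall : StdSat (Nat.pair 5 a) b ↔
      ∀ y, Sat ∅ (push y fun i => std (envOf b i)) (fun _ => ∅) (toForm a) := by
    rw [StdSat, toForm]; simp [sat_allN]
  have hpair : ∀ x, StdSat a (Nat.pair x b) ↔
      Sat ∅ (push (std x) fun i => std (envOf b i)) (fun _ => ∅) (toForm a) := fun x => by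
    rw [StdSat, std_comp_envOf]
  refine ⟨?_, ?_, ?_, ?_, ?_, ?_, ?_⟩
  · rw [bSat_mem, bEq_mem, std_val, std_val, StdSat, toForm]
    simp [sat_eq]
  · rw [bSat_mem, bLt_mem, std_val, std_val, StdSat, toForm]
    simp [sat_lt]
  · rw [bSat_mem, StdSat, toForm]
    simp [Sat]
  · rw [bSat_mem, bSat_mem, bSat_mem, StdSat, toForm]
    simp [sat_imp, StdSat]
  · rw [bSat_mem, bSat_mem, hall, hpair]
    exact fun h => h _
  · rw [bSat_mem, bSat_mem, hall, hpair, std_wit]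
    exact leastFail_spec
  · rw [bLt_mem, bSat_mem, hpair, std_wit]
    exact of_lt_leastFail

theorem termCode_conds (a b c : ℕ) :
    (TermCode a (Nat.pair 0 b) ↔ b < a) ∧ (TermCode a (Nat.pair 1 b) ↔ b = 0) ∧
    (TermCode a (Nat.pair 2 b) ↔ b = 0) ∧
    (TermCode a (Nat.pair 3 (Nat.pair b c)) ↔ TermCode a b ∧ TermCode a c) ∧
    (TermCode a (Nat.pair 4 (Nat.pair b c)) ↔ TermCode a b ∧ TermCode a c) ∧
    ¬ TermCode a (Nat.pair (b + 5) c) := by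
  refine ⟨⟨?_, fun h => ⟨.var b, rfl, h⟩⟩, ⟨?_, fun h => ⟨.zero, by rw [h]; rfl, trivial⟩⟩,
    ⟨?_, fun h => ⟨.one, by rw [h]; rfl, trivial⟩⟩, ⟨?_, ?_⟩, ⟨?_, ?_⟩, ?_⟩
  · rintro ⟨t, h, ht⟩
    cases t <;> simp [Term.code] at h
    exact h ▸ ht
  · rintro ⟨t, h, ht⟩
    cases t <;> simp [Term.code] at h
    exact h.symm
  · rintro ⟨t, h, ht⟩
    cases t <;> simp [Term.code] at h
    exact h.symm
  · rintro ⟨t, h, ht⟩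
    cases t <;> simp [Term.code] at h
    exact ⟨⟨_, h.1, ht.1⟩, ⟨_, h.2, ht.2⟩⟩
  · rintro ⟨⟨s, rfl, hs⟩, ⟨t, rfl, ht⟩⟩
    exact ⟨.add s t, rfl, hs, ht⟩
  · rintro ⟨t, h, ht⟩
    cases t <;> simp [Term.code] at h
    exact ⟨⟨_, h.1, ht.1⟩, ⟨_, h.2, ht.2⟩⟩
  · rintro ⟨⟨s, rfl, hs⟩, ⟨t, rfl, ht⟩⟩
    exact ⟨.mul s t, rfl, hs, ht⟩
  · rintro ⟨t, h, ht⟩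
    cases t <;> simp [Term.code] at h

theorem foCode_conds (a b c : ℕ) :
    (FOCode a (Nat.pair 0 (Nat.pair b c)) ↔ TermCode a b ∧ TermCode a c) ∧
    (FOCode a (Nat.pair 1 (Nat.pair b c)) ↔ TermCode a b ∧ TermCode a c) ∧
    ¬ FOCode a (Nat.pair 2 b) ∧ (FOCode a (Nat.pair 3 b) ↔ b = 0) ∧
    (FOCode a (Nat.pair 4 (Nat.pair b c)) ↔ FOCode a b ∧ FOCode a c) ∧
    (FOCode a (Nat.pair 5 b) ↔ FOCode (a + 1) b) ∧ ¬ FOCode a (Nat.pair (b + 6) c) := by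
  refine ⟨⟨?_, ?_⟩, ⟨?_, ?_⟩, ?_, ⟨?_, fun h => ⟨.bot, by rw [h]; rfl, trivial⟩⟩, ⟨?_, ?_⟩,
    ⟨?_, ?_⟩, ?_⟩
  · rintro ⟨φ, h, hφ⟩
    cases φ <;> simp [Form.code] at h
    exact ⟨⟨_, h.1, hφ.1⟩, ⟨_, h.2, hφ.2⟩⟩
  · rintro ⟨⟨s, rfl, hs⟩, ⟨t, rfl, ht⟩⟩
    exact ⟨.eq s t, rfl, hs, ht⟩
  · rintro ⟨φ, h, hφ⟩
    cases φ <;> simp [Form.code] at h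
    exact ⟨⟨_, h.1, hφ.1⟩, ⟨_, h.2, hφ.2⟩⟩
  · rintro ⟨⟨s, rfl, hs⟩, ⟨t, rfl, ht⟩⟩
    exact ⟨.lt s t, rfl, hs, ht⟩
  · rintro ⟨φ, h, hφ⟩
    cases φ <;> simp [Form.code] at h
    exact hφ
  · rintro ⟨φ, h, hφ⟩
    cases φ <;> simp [Form.code] at h
    exact h.symm
  · rintro ⟨φ, h, hφ⟩
    cases φ <;> simp [Form.code] at h
    exact ⟨⟨_, h.1, hφ.1⟩, ⟨_, h.2, hφ.2⟩⟩
  · rintro ⟨⟨s, rfl, hs⟩, ⟨t, rfl, ht⟩⟩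
    exact ⟨.imp s t, rfl, hs, ht⟩
  · rintro ⟨φ, h, hφ⟩
    cases φ <;> simp [Form.code] at h
    exact ⟨_, h, hφ⟩
  · rintro ⟨φ, rfl, hφ⟩
    exact ⟨.allN φ, rfl, hφ⟩
  · rintro ⟨φ, h, hφ⟩
    cases φ <;> simp [Form.code] at h
    exact hφ

theorem satClass_std : SatClass stdClass := by
  intro a b c d
  refine ⟨?_, ?_, valConds_std a b c, satConds_std a b c, ?_⟩
  · simp only [EqConds, bEq_mem, bLt_mem, std_add, std_mul]
    refine ⟨trivial, Eq.symm, Eq.trans, fun h1 h2 => by rw [h1, h2], fun h1 h2 => by rw [h1, h2],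
      fun h1 h2 => by rw [h1, h2]; exact id⟩
  · simp only [ArithConds, bEq_mem, bLt_mem, std_add, std_mul, std_one, std_zero, std_pred]
    refine ⟨by omega, by omega, by omega, by omega, by omega, by ring, by omega, by omega, by omega⟩
  · simp only [FOConds, bTV_mem, bFO_mem, bSat_mem, bOut_mem]
    exact ⟨termCode_conds a b c, foCode_conds a b c, trivial⟩

end SOA

/-! ### The model of Peano arithmetic coded by a satisfaction class -/

namespace SOA

open CantorDyn

namespace SatClass

variable {A : Set ℕ}

theorem eqC (h : SatClass A) (a b c d : ℕ) : EqConds a b c d A := (h a b c d).1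

theorem arithC (h : SatClass A) (a b : ℕ) : ArithConds a b A := (h a b 0 0).2.1

theorem valC (h : SatClass A) (a b c : ℕ) : ValConds a b c A := (h a b c 0).2.2.1

theorem satC (h : SatClass A) (a b c : ℕ) : SatConds a b c A := (h a b c 0).2.2.2.1

theorem foC (h : SatClass A) (a b c : ℕ) : FOConds a b c A := (h a b c 0).2.2.2.2

/-- Equality of elements. -/
def setoid (h : SatClass A) : Setoid ℕ where
  r x y := bEq x y ∈ A
  iseqv :=
    { refl := fun x => (h.eqC x 0 0 0).1
      symm := fun {x y} => (h.eqC x y 0 0).2.1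
      trans := fun {x y z} => (h.eqC x y z 0).2.2.1 }

/-- The model coded by a satisfaction class. -/
def model (h : SatClass A) : Model where
  Dom := Quotient h.setoid
  zero := Quotient.mk _ 0
  one := Quotient.mk _ nOne
  add := Quotient.map₂ nAdd fun a b hab c d hcd => (h.eqC a b c d).2.2.2.1 hab hcd
  mul := Quotient.map₂ nMul fun a b hab c d hcd => (h.eqC a b c d).2.2.2.2.1 hab hcd
  lt := Quotient.lift₂ (fun x y => bLt x y ∈ A) fun a c b d hab hcd => propext
    ⟨(h.eqC a b c d).2.2.2.2.2 hab hcd,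
      (h.eqC b a d c).2.2.2.2.2 ((h.eqC a b 0 0).2.1 hab) ((h.eqC c d 0 0).2.1 hcd)⟩
  sets := {∅}

/-- The element with a given name. -/
def elt (h : SatClass A) (x : ℕ) : h.model.Dom := Quotient.mk h.setoid x

theorem elt_eq (h : SatClass A) {x y : ℕ} : h.elt x = h.elt y ↔ bEq x y ∈ A := Quotient.eq

theorem exists_elt (h : SatClass A) (d : h.model.Dom) : ∃ x, h.elt x = d := Quotient.exists_rep d

theorem add_elt (h : SatClass A) (x y : ℕ) :
    h.model.add (h.elt x) (h.elt y) = h.elt (nAdd x y) := rfl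

theorem mul_elt (h : SatClass A) (x y : ℕ) :
    h.model.mul (h.elt x) (h.elt y) = h.elt (nMul x y) := rfl

theorem lt_elt (h : SatClass A) (x y : ℕ) : h.model.lt (h.elt x) (h.elt y) ↔ bLt x y ∈ A := Iff.rfl

/-- The environment with a given code. -/
def env (h : SatClass A) (e : ℕ) : ℕ → h.model.Dom := fun i => h.elt (envOf e i)

theorem env_pair (h : SatClass A) (x e : ℕ) : h.env (Nat.pair x e) = push (h.elt x) (h.env e) := by
  unfold env
  rw [envOf_pair]
  funext i
  cases i <;> rfl

theorem exists_env (h : SatClass A) (e : ℕ → h.model.Dom) (n : ℕ) :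
    ∃ c, ∀ i < n, h.env c i = e i := by
  choose x hx using fun i => h.exists_elt (e i)
  obtain ⟨c, hc⟩ := exists_envOf x n
  exact ⟨c, fun i hi => by rw [env, hc i hi, hx]⟩

theorem val_eq (h : SatClass A) (t : Term) (e : ℕ) :
    h.model.val (h.env e) t = h.elt (nVal t.code e) := by
  induction t with
  | var i =>
    change h.env e i = _
    induction i generalizing e with
    | zero =>
      have := (h.valC e.unpair.1 e.unpair.2 0).1
      rw [Nat.pair_unpair] at this
      exact (h.elt_eq.2 this).symm
    | succ i ih =>
      have := (h.valC e.unpair.1 e.unpair.2 i).2.1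
      rw [Nat.pair_unpair] at this
      exact (ih e.unpair.2).trans (h.elt_eq.2 this).symm
  | zero => exact (h.elt_eq.2 (h.valC e 0 0).2.2.1).symm
  | one => exact (h.elt_eq.2 (h.valC e 0 0).2.2.2.1).symm
  | add s t hs ht =>
    rw [Model.val, hs, ht, add_elt]
    exact (h.elt_eq.2 (h.valC s.code t.code e).2.2.2.2.1).symm
  | mul s t hs ht =>
    rw [Model.val, hs, ht, mul_elt]
    exact (h.elt_eq.2 (h.valC s.code t.code e).2.2.2.2.2).symm

/-- Every element has a name, and the named counterexample `nWit` handles the universal quantifier.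
-/
theorem holds_iff_sat (h : SatClass A) {φ : Form} {n : ℕ} (hφ : φ.IsFirstOrder n) (e : ℕ)
    (E : ℕ → Set h.model.Dom) : h.model.Holds (h.env e) E φ ↔ bSat φ.code e ∈ A := by
  induction φ generalizing n e with
  | eq s t =>
    rw [Model.Holds, val_eq, val_eq, elt_eq]
    exact (h.satC s.code t.code e).1.symm
  | lt s t =>
    rw [Model.Holds, val_eq, val_eq, lt_elt]
    exact (h.satC s.code t.code e).2.1.symm
  | mem t i => exact hφ.elim
  | bot => exact iff_of_false id (h.satC 0 0 e).2.2.1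
  | imp φ ψ h1 h2 =>
    rw [Model.Holds, h1 hφ.1, h2 hφ.2]
    exact (h.satC φ.code ψ.code e).2.2.2.1.symm
  | allN φ ih =>
    rw [Model.Holds]
    constructor
    · intro hall
      by_contra hn
      refine (h.satC φ.code e 0).2.2.2.2.2.1 hn ?_
      rw [← ih hφ, env_pair]
      exact hall _
    · intro hs d
      obtain ⟨x, rfl⟩ := h.exists_elt d
      rw [← env_pair, ih hφ]
      exact (h.satC φ.code e x).2.2.2.2.1 hs
  | allS φ => exact hφ.elim

end SatClass

theorem Model.val_congr {M : Model} {t : Term} {n : ℕ} (ht : t.VarsLT n) {e e' : ℕ → M.Dom}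
    (he : ∀ i < n, e i = e' i) : M.val e t = M.val e' t := by
  induction t with
  | var i => exact he i ht
  | zero => rfl
  | one => rfl
  | add s t hs ht' => rw [Model.val, Model.val, hs ht.1, ht' ht.2]
  | mul s t hs ht' => rw [Model.val, Model.val, hs ht.1, ht' ht.2]

theorem Model.holds_congr {M : Model} {φ : Form} {n : ℕ} (hφ : φ.IsFirstOrder n) {e e' : ℕ → M.Dom}
    (he : ∀ i < n, e i = e' i) (E : ℕ → Set M.Dom) : M.Holds e E φ ↔ M.Holds e' E φ := by
  induction φ generalizing n e e' with
  | eq s t => rw [Model.Holds, Model.Holds, val_congr hφ.1 he, val_congr hφ.2 he]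
  | lt s t => rw [Model.Holds, Model.Holds, val_congr hφ.1 he, val_congr hφ.2 he]
  | mem t i => exact hφ.elim
  | bot => rfl
  | imp φ ψ h1 h2 => exact imp_congr (h1 hφ.1 he) (h2 hφ.2 he)
  | allN φ ih =>
    refine forall_congr' fun d => ih hφ fun i hi => ?_
    cases i with
    | zero => rfl
    | succ i => exact he i (by omega)
  | allS φ => exact hφ.elim

namespace SatClass

variable {A : Set ℕ}

/-- If `φ` fails somewhere, it fails at the named element `w` and holds below it. The base case
excludes `w = 0`, so `w` is the successor of its predecessor, where `φ` holds, and the induction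
step contradicts the choice of `w`. -/
theorem holds_induction (h : SatClass A) {φ : Form} {n : ℕ} (hφ : φ.IsFirstOrder n)
    (e : ℕ → h.model.Dom) (E : ℕ → Set h.model.Dom) : h.model.Holds e E (induction φ) := by
  -- Only the first `n` variables matter, so `e` may be replaced by an environment that has a code.
  obtain ⟨c, hc⟩ := h.exists_env e n
  have key : ∀ x, h.model.Holds (push (h.elt x) e) E φ ↔ bSat φ.code (Nat.pair x c) ∈ A := by
    intro x
    rw [← h.holds_iff_sat hφ _ E, env_pair]
    refine Model.holds_congr hφ (fun i hi => ?_) E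
    cases i with
    | zero => rfl
    | succ i => exact (hc i (by omega)).symm
  have hsucc : ∀ φ' (d : h.model.Dom), h.model.Holds (push d e) E (Form.succ φ') ↔
      h.model.Holds (push (h.model.add d h.model.one) e) E φ' := fun φ' d => Model.holds_succ _ _ _ _
  intro hyp
  rw [Model.holds_and, Model.holds_instN] at hyp
  obtain ⟨h0, hs⟩ := hyp
  by_contra hn
  have hn' : bSat (Nat.pair 5 φ.code) c ∉ A := by
    intro hsat
    refine hn fun d => ?_
    obtain ⟨x, rfl⟩ := h.exists_elt d
    exact (key x).2 ((h.satC φ.code c x).2.2.2.2.1 hsat)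
  have hw := (h.satC φ.code c 0).2.2.2.2.2.1 hn'
  set w := nWit φ.code c
  rcases (h.arithC w 0).2.2.2.2.2.2.2.2 with h1 | h1
  · apply hw
    rw [← key, h.elt_eq.2 h1]
    exact h0
  · have hlt : bLt (nPred w) w ∈ A := by
      refine (h.eqC (nPred w) (nPred w) (nAdd (nPred w) nOne) w).2.2.2.2.2 (h.eqC _ 0 0 0).1
        ((h.eqC _ _ 0 0).2.1 h1) ?_
      exact (h.arithC (nPred w) (nPred w)).2.2.2.2.2.2.2.1.2 (Or.inr (h.eqC _ 0 0 0).1)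
    have hp := (key _).2 ((h.satC φ.code c (nPred w)).2.2.2.2.2.2 hlt)
    apply hw
    rw [← key, h.elt_eq.2 h1]
    exact (hsucc φ _).1 (hs _ hp)

theorem holds_basicAxioms (h : SatClass A) {φ : Form} (hφ : φ ∈ basicAxioms)
    (e : ℕ → h.model.Dom) (E : ℕ → Set h.model.Dom) : h.model.Holds e E φ := by
  obtain ⟨a, ha⟩ := h.exists_elt (e 0)
  obtain ⟨b, hb⟩ := h.exists_elt (e 1)
  have hc := h.arithC a b
  have v0 : h.model.val e (Term.var 0) = h.elt a := ha.symm
  have v1 : h.model.val e (Term.var 1) = h.elt b := hb.symm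
  have z : h.model.val e 0 = h.elt 0 := rfl
  have o : h.model.val e 1 = h.elt nOne := rfl
  have va : ∀ s t : Term, h.model.val e (s + t) = h.model.add (h.model.val e s) (h.model.val e t) :=
    fun _ _ => rfl
  have vm : ∀ s t : Term, h.model.val e (s * t) = h.model.mul (h.model.val e s) (h.model.val e t) :=
    fun _ _ => rfl
  simp only [basicAxioms, Set.mem_insert_iff, Set.mem_singleton_iff] at hφ
  rcases hφ with rfl | rfl | rfl | rfl | rfl | rfl | rfl | rfl <;>
    simp only [Model.holds_neg, Model.holds_iff, Model.holds_or, Model.Holds, va, vm, v0, v1, z, o,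
      add_elt, mul_elt, elt_eq, lt_elt]
  · exact hc.1
  · exact hc.2.1
  · exact hc.2.2.1
  · exact hc.2.2.2.1
  · exact hc.2.2.2.2.1
  · exact hc.2.2.2.2.2.1
  · exact hc.2.2.2.2.2.2.1
  · exact hc.2.2.2.2.2.2.2.1

/-- The theory of the model coded by a satisfaction class. -/
def theory (A : Set ℕ) : Set Form := {φ | φ.IsFirstOrder 0 ∧ bSat φ.code 0 ∈ A}

theorem isCompleteExtensionPA (h : SatClass A) : IsCompleteExtensionPA (theory A) where
  sentences _ hφ := hφ.1
  complete φ hφ := by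
    by_cases hs : bSat φ.code 0 ∈ A
    · exact Or.inl ⟨hφ, hs⟩
    · refine Or.inr ⟨⟨hφ, trivial⟩, ?_⟩
      exact (h.satC φ.code (Nat.pair 3 0) 0).2.2.2.1.2 fun h' => absurd h' hs
  consistent hp := by
    refine Model.soundness (M := h.model) (T := PA ∪ theory A) ?_ hp (h.env 0) (fun _ => ∅)
      (fun _ => Set.mem_singleton _) (by simp)
    rintro φ ((hφ | ⟨φ, ⟨n, hφ⟩, rfl⟩) | hφ) e E -
    · exact h.holds_basicAxioms hφ e E
    · exact h.holds_induction hφ e E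
    · exact (Model.holds_congr hφ.1 (e := e) (e' := h.env 0) (by simp) E).2
        ((h.holds_iff_sat hφ.1 0 E).2 hφ.2)

/-- The clauses in `FOConds` determine these bits by recursion on the code, an actual natural
number, however nonstandard the coded model is. -/
theorem bTV_iff (h : SatClass A) (n c : ℕ) : bTV n c ∈ A ↔ TermCode n c := by
  induction c using Nat.strong_induction_on with
  | _ c ih =>
    obtain ⟨k, r, rfl⟩ : ∃ k r, c = Nat.pair k r := ⟨_, _, (Nat.pair_unpair c).symm⟩
    have hr : k ≠ 0 → r < Nat.pair k r := fun hk => by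
      have := unpair_right_lt (c := Nat.pair k r) (by simpa using hk)
      simpa using this
    obtain ⟨x, y, rfl⟩ : ∃ x y, r = Nat.pair x y := ⟨_, _, (Nat.pair_unpair r).symm⟩
    have hx : k ≠ 0 → x < Nat.pair k (Nat.pair x y) := fun hk =>
      (Nat.left_le_pair x y).trans_lt (hr hk)
    have hy : k ≠ 0 → y < Nat.pair k (Nat.pair x y) := fun hk =>
      (Nat.right_le_pair x y).trans_lt (hr hk)
    match k with
    | 0 => exact (h.foC n _ 0).1.1.trans (termCode_conds n _ 0).1.symm
    | 1 => exact (h.foC n _ 0).1.2.1.trans (termCode_conds n _ 0).2.1.symm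
    | 2 => exact (h.foC n _ 0).1.2.2.1.trans (termCode_conds n _ 0).2.2.1.symm
    | 3 =>
      rw [(h.foC n x y).1.2.2.2.1, (termCode_conds n x y).2.2.2.1, ih x (hx (by omega)),
        ih y (hy (by omega))]
    | 4 =>
      rw [(h.foC n x y).1.2.2.2.2.1, (termCode_conds n x y).2.2.2.2.1, ih x (hx (by omega)),
        ih y (hy (by omega))]
    | k + 5 => exact iff_of_false (h.foC n k _).1.2.2.2.2.2 (termCode_conds n k _).2.2.2.2.2

theorem bFO_iff (h : SatClass A) (n c : ℕ) : bFO n c ∈ A ↔ FOCode n c := by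
  induction c using Nat.strong_induction_on generalizing n with
  | _ c ih =>
    obtain ⟨k, r, rfl⟩ : ∃ k r, c = Nat.pair k r := ⟨_, _, (Nat.pair_unpair c).symm⟩
    have hr : k ≠ 0 → r < Nat.pair k r := fun hk => by
      have := unpair_right_lt (c := Nat.pair k r) (by simpa using hk)
      simpa using this
    obtain ⟨x, y, rfl⟩ : ∃ x y, r = Nat.pair x y := ⟨_, _, (Nat.pair_unpair r).symm⟩
    have hx : k ≠ 0 → x < Nat.pair k (Nat.pair x y) := fun hk =>
      (Nat.left_le_pair x y).trans_lt (hr hk)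
    have hy : k ≠ 0 → y < Nat.pair k (Nat.pair x y) := fun hk =>
      (Nat.right_le_pair x y).trans_lt (hr hk)
    match k with
    | 0 =>
      rw [(h.foC n x y).2.1.1, (foCode_conds n x y).1, h.bTV_iff, h.bTV_iff]
    | 1 =>
      rw [(h.foC n x y).2.1.2.1, (foCode_conds n x y).2.1, h.bTV_iff, h.bTV_iff]
    | 2 => exact iff_of_false (h.foC n _ 0).2.1.2.2.1 (foCode_conds n _ 0).2.2.1
    | 3 => exact (h.foC n _ 0).2.1.2.2.2.1.trans (foCode_conds n _ 0).2.2.2.1.symm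
    | 4 =>
      rw [(h.foC n x y).2.1.2.2.2.2.1, (foCode_conds n x y).2.2.2.2.1, ih x (hx (by omega)),
        ih y (hy (by omega))]
    | 5 =>
      rw [(h.foC n _ 0).2.1.2.2.2.2.2.1, (foCode_conds n _ 0).2.2.2.2.2.1,
        ih _ (hr (by omega))]
    | k + 6 => exact iff_of_false (h.foC n k _).2.1.2.2.2.2.2.2 (foCode_conds n k _).2.2.2.2.2.2

theorem image_code_theory (h : SatClass A) : Form.code '' theory A = {c | bOut c ∈ A} := by
  ext c
  rw [Set.mem_ofPred_eq, (h.foC c 0 0).2.2, h.bFO_iff]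
  constructor
  · rintro ⟨φ, ⟨h1, h2⟩, rfl⟩
    exact ⟨⟨φ, rfl, h1⟩, h2⟩
  · rintro ⟨⟨φ, rfl, h1⟩, h2⟩
    exact ⟨φ, ⟨h1, h2⟩, rfl⟩

end SatClass

theorem isPADegree_of_satClass {X : Set ℕ} {n : ℕ} (h : SatClass (column n X)) : IsPADegree X := by
  refine ⟨_, h.isCompleteExtensionPA, ?_⟩
  rw [h.image_code_theory]
  exact computes_preimage (Primrec.pairNat (Primrec.const n)
    (Primrec.pairNat (Primrec.const 5) Primrec.id)) X

/-- The satisfaction classes form a `Π⁰₁` class containing the standard one, so some column of `X`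
is a satisfaction class, perhaps for a nonstandard model. -/
theorem isPADegree_of_isScott {X : Set ℕ} (hX : IsScott X) : IsPADegree X := by
  have hs : Sig fun (_ : ℕ) W => ¬ SatClass (column 0 W) :=
    (sig_not_satClass.subst (b := fun _ _ => true) (Primrec.const true)
      (h := fun _ i => Nat.pair 0 i) (Primrec.pairNat (Primrec.const 0) Primrec.snd)).of_iff
      fun _ W => by simp [column]
  obtain ⟨n, hn⟩ := hX.exists_column hs 0
    ⟨stdClass, by rw [column_glue_self]; exact not_not.2 satClass_std⟩
  rw [column_glue_self] at hn
  exact isPADegree_of_satClass (not_not.1 hn)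

end SOA

/-! ### The main theorem -/

theorem mainTheorem5 :
    ¬ SOA.Proves SOA.WKL0 SOA.AP ∧
    ∃ (C : Set (List Bool)) (f : List Bool → List Bool),
      CantorDyn.IsComputableSystem C f ∧ CantorDyn.IsProductShift C f ∧
      ∃ X : Set ℕ, SOA.IsPADegree X ∧
        (∀ Z : Set ℕ, CantorDyn.IsAlmostPeriodic C f Z → ¬ CantorDyn.Computes X Z) ∧
        ∃ S : Set (Set ℕ), SOA.IsOmegaModel S SOA.WKL0 ∧
          (∀ A ∈ S, CantorDyn.Computes X A) ∧
          (∀ Z ∈ S, ¬ CantorDyn.IsAlmostPeriodic C f Z) ∧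
          ¬ SOA.TrueIn S SOA.AP := by
  open CantorDyn SOA in
  have hT := evTree_event_isSystem
  have hsys := prodTree_isComputableSystem hT primrec_evTree_event
  obtain ⟨u, hu⟩ := sig_not_isScott.exists_index
  have hu' : ∀ X, ¬ Univ u X ↔ IsScott X := fun X => by rw [← hu, not_not]
  -- Forcing inside the `Π⁰₁` class of Scott sets yields the PA degree, the model and the failure to
  -- compute almost periodic points from one set.
  obtain ⟨X, hX, hZ⟩ := exists_not_computes u (by simpa only [hu'] using exists_isScott)
  rw [hu'] at hX
  have hcol : ∀ A ∈ columns X, Computes X A := by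
    rintro _ ⟨n, rfl⟩
    exact computes_column X n
  have hAP : ∀ Z ∈ columns X, ¬ IsAlmostPeriodic hardTree shiftCols Z :=
    fun Z hm h => hZ Z h (hcol Z hm)
  have hmodel := isOmegaModel_columns hX
  have hfail := not_trueIn_AP hX hsys.1 (primrec_prodTree primrec_evTree_event) primrec_shiftCols hAP
  exact ⟨fun hp => hfail (trueIn_of_proves hmodel.2 hp), hardTree, shiftCols, hsys,
    prodTree_isProductShift hT primrec_evTree_event, X, isPADegree_of_isScott hX, hZ, columns X,
    hmodel, hcol, hAP, hfail⟩
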